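/- Let $R,a,\nu,T>0$ and let $\Omega=\{x\in\mathbb{R}^3: r<R,\ |x_3|<a\}$, $r=\sqrt{x_1^2+x_2^2}$, with boundary $S=S_1\cup S_2$ (lateral part $S_1$: $r=R$; bottom and top $S_2$: $x_3=\pm a$). Write $\Omega^T=\Omega\times(0,T)$, $S^T=S\times(0,T)$, and let $(r,\varphi,z)$ be cylindrical coordinates with unit vectors $\bar e_r,\bar e_\varphi,\bar e_z$, so that $w_r=w\cdot\bar e_r$, $w_\varphi=w\cdot\bar e_\varphi$, $w_z=w\cdot\bar e_z$ for a vector field $w$. Let $(v,p)$, with $v\in W_2^{2,1}(\Omega^T)$ and $\nabla p\in L_2(\Omega^T)$, be an axially symmetric solution (that is, $v_r,v_\varphi,v_z,p,f_r,f_\varphi,f_z$ do not depend on $\varphi$) of the Navier–Stokes problem $$ \begin{aligned} &v_t+v\cdot\nabla v-\nu\Delta v+\nabla p=f,\quad \operatorname{div}v=0 &&\text{in }\Omega^T,\\ &v\cdot\bar n=0,\quad \bar n\cdot\mathbb{D}(v)\cdot\bar\tau_\alpha=0,\ \alpha=1,2, &&\text{on }S^T,\\ &v|_{t=0}=v_0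 &&\text{in }\Omega, \end{aligned} $$ where $\mathbb{D}(v)=\nabla v+\nabla v^T$, $\bar n$ is the unit outward normal and $\bar\tau_1,\bar\tau_2$ are tangent vectors to $S$; the boundary and initial conditions hold in the sense of traces. Let $u=rv_\varphi$ be the swirl, $u_0=r(v_0)_\varphi$ and $g=rf_\varphi$. **Lemma 3.1.** For given $\Omega$, $\nu$ and $T$ there is a function $d_6=d_6(\cdot,\cdot)$ such that for every such solution with $u_0\in L_\infty(\Omega)$ and $g\in L_\infty(\Omega^T)$ one has $u\in L_\infty(\Omega^T)$ and $$\|u\|_{L_\infty(\Omega^T)}\le d_6\big(\|u_0\|_{L_\infty(\Omega)},\|g\|_{L_\infty(\Omega^T)}\big).$$ -/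

import Mathlib

open MeasureTheory Set
open scoped NNReal ENNReal ContDiff

noncomputable section

namespace AxisymNS

/-- Physical space `ℝ³` (coordinates `x 0, x 1, x 2` stand for `x₁, x₂, x₃`). -/
abbrev Space : Type := EuclideanSpace ℝ (Fin 3)

/-- Space-time; a point is a pair `(x, t)`. -/
abbrev SpaceTime : Type := Space × ℝ

/-- The distance `r` to the `x₃`-axis. -/
def cylR (x : Space) : ℝ := Real.sqrt (x 0 ^ 2 + x 1 ^ 2)

/-- The unit vector `e_r` at `x` (the value on the axis, a null set, is irrelevant). -/
def eR (x : Space) : Space := !₂[x 0 / cylR x, x 1 / cylR x, 0]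

/-- The unit vector `e_φ` at `x` (the value on the axis, a null set, is irrelevant). -/
def ePhi (x : Space) : Space := !₂[-(x 1) / cylR x, x 0 / cylR x, 0]

/-- The unit vector `e_z`. -/
def eZ : Space := !₂[0, 0, 1]

/-- The finite cylinder `Ω = {r < R, |z| < a}`. -/
def cyl (R a : ℝ) : Set Space := {x | cylR x < R ∧ |x 2| < a}

/-- The lateral part `S₁` of the boundary; its outward unit normal is `e_r`. -/
def lateral (R a : ℝ) : Set Space := {x | cylR x = R ∧ |x 2| < a}

/-- The bottom and the top `S₂`; the outward unit normal is `-e_z` and `e_z`, respectively. -/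
def caps (R a : ℝ) : Set Space := {x | cylR x < R ∧ (x 2 = -a ∨ x 2 = a)}

/-- The space-time cylinder `Ω^T = Ω × (0, T)`. -/
def cylT (R a T : ℝ) : Set SpaceTime := cyl R a ×ˢ Ioo 0 T

/-- Lebesgue measure on `Ω`. -/
def muX (R a : ℝ) : Measure Space := volume.restrict (cyl R a)

/-- Lebesgue measure on `Ω^T`. -/
def muT (R a T : ℝ) : Measure SpaceTime := volume.restrict (cylT R a T)

/-- The direction of `∂_{x_j}` in space-time. -/
def dirX (j : Fin 3) : SpaceTime := (EuclideanSpace.single j 1, 0)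

/-- The direction of `∂_t` in space-time. -/
def dirT : SpaceTime := (0, 1)

/-- `w'` is the weak (distributional) derivative of `w` on the open set `U` of space-time in the
direction `e`. -/
def HasWeakDeriv (U : Set SpaceTime) (e : SpaceTime) (w w' : SpaceTime → ℝ) : Prop :=
  LocallyIntegrableOn w U ∧ LocallyIntegrableOn w' U ∧
    ∀ φ : SpaceTime → ℝ, ContDiff ℝ ∞ φ → HasCompactSupport φ → tsupport φ ⊆ U →
      ∫ y in U, w y * fderiv ℝ φ y e = -∫ y in U, w' y * φ y

/-- Rotation of `ℝ³` about the `x₃`-axis by the angle `θ`. -/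
def rotZ (θ : ℝ) (x : Space) : Space :=
  !₂[Real.cos θ * x 0 - Real.sin θ * x 1, Real.sin θ * x 0 + Real.cos θ * x 1, x 2]

/-- The scalar function `h` on `Ω^T` does not depend on the angle `φ` (as a class of functions
modulo equality almost everywhere). -/
def IndepAngle (R a T : ℝ) (h : SpaceTime → ℝ) : Prop :=
  ∀ θ : ℝ, ∀ᵐ y ∂(muT R a T), h (rotZ θ y.1, y.2) = h y

/-- The cylindrical components of the vector field `w` do not depend on the angle `φ`. -/
def AxisymField (R a T : ℝ) (w : SpaceTime → Space) : Prop :=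
  IndepAngle R a T (fun y => inner ℝ (w y) (eR y.1)) ∧
  IndepAngle R a T (fun y => inner ℝ (w y) (ePhi y.1)) ∧
  IndepAngle R a T (fun y => inner ℝ (w y) eZ)

/-- `v ∈ W_2^{2,1}(Ω^T; ℝ³)`: the field `v` and its weak derivatives `vt = ∂_t v`,
`Dv j = ∂_j v`, `DDv j k = ∂_k ∂_j v` belong to `L_2(Ω^T)`. -/
structure MemW221 (R a T : ℝ) (v vt : SpaceTime → Space) (Dv : Fin 3 → SpaceTime → Space)
    (DDv : Fin 3 → Fin 3 → SpaceTime → Space) : Prop where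
  memLp : MemLp v 2 (muT R a T)
  memLp_t : MemLp vt 2 (muT R a T)
  memLp_x : ∀ j, MemLp (Dv j) 2 (muT R a T)
  memLp_xx : ∀ j k, MemLp (DDv j k) 2 (muT R a T)
  deriv_t : ∀ i, HasWeakDeriv (cylT R a T) dirT (fun y => v y i) (fun y => vt y i)
  deriv_x : ∀ i j, HasWeakDeriv (cylT R a T) (dirX j) (fun y => v y i) (fun y => Dv j y i)
  deriv_xx : ∀ i j k,
    HasWeakDeriv (cylT R a T) (dirX k) (fun y => Dv j y i) (fun y => DDv j k y i)

/-- The trace condition `v · n = 0` on `S^T`: the normal trace of `v`, which Green's formula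
`∫_{Ω^T} (v · ∇φ + (div v) φ) = ∫_{S^T} (v · n) φ` defines, is zero. -/
def NoFlux (R a T : ℝ) (v : SpaceTime → Space) (Dv : Fin 3 → SpaceTime → Space) : Prop :=
  ∀ φ : SpaceTime → ℝ, ContDiff ℝ ∞ φ →
    ∫ y in cylT R a T,
      ((∑ j, v y j * fderiv ℝ φ y (dirX j)) + (∑ j, Dv j y j) * φ y) = 0

/-- The test field `ψ` is tangent to the boundary `S = S₁ ∪ S₂` at all times. -/
def TangentOnBoundary (R a : ℝ) (ψ : SpaceTime → Space) : Prop :=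
  ∀ t : ℝ, (∀ x ∈ lateral R a, inner ℝ (ψ (x, t)) (eR x) = 0) ∧
    (∀ x ∈ caps R a, inner ℝ (ψ (x, t)) eZ = 0)

/-- The trace condition `n · 𝔻(v) · τ_α = 0`, `α = 1, 2`, on `S^T`, where
`𝔻(v)_{ij} = ∂_i v_j + ∂_j v_i`: the normal trace `𝔻(v) n`, which Green's formula
`∫_{Ω^T} (𝔻(v) : ∇ψ + (div 𝔻(v)) · ψ) = ∫_{S^T} (𝔻(v) n) · ψ` defines, vanishes on all smooth
fields `ψ` that are tangent to the boundary. -/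
def PerfectSlip (R a T : ℝ) (Dv : Fin 3 → SpaceTime → Space)
    (DDv : Fin 3 → Fin 3 → SpaceTime → Space) : Prop :=
  ∀ ψ : SpaceTime → Space, ContDiff ℝ ∞ ψ → TangentOnBoundary R a ψ →
    ∫ y in cylT R a T, ∑ i, ∑ j,
      ((Dv i y j + Dv j y i) * fderiv ℝ ψ y (dirX j) i
        + (DDv i j y j + DDv j j y i) * ψ y i) = 0

/-- The initial condition `v|_{t=0} = v₀` in `Ω`, for the trace of `v` at `t = 0` which the
integration by parts in time defines: `∫_{Ω^T} (v_t φ + v φ_t) = -∫_Ω v(0) φ(0)` for the test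
functions `φ` that vanish near `t = T` and near the boundary of `Ω`. -/
def HasInitialValue (R a T : ℝ) (v vt : SpaceTime → Space) (v₀ : Space → Space) : Prop :=
  MemLp v₀ 2 (muX R a) ∧
  ∀ i : Fin 3, ∀ φ : SpaceTime → ℝ, ContDiff ℝ ∞ φ → HasCompactSupport φ →
    tsupport φ ⊆ cyl R a ×ˢ Iio T →
      ∫ y in cylT R a T, (vt y i * φ y + v y i * fderiv ℝ φ y dirT)
        = -∫ x in cyl R a, v₀ x i * φ (x, 0)

/-- `(v, p)` is an axially symmetric solution, `v ∈ W_2^{2,1}(Ω^T)` and `∇p ∈ L_2(Ω^T)`, of the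
Navier-Stokes problem with viscosity `ν`, external force `f`, slip boundary conditions and initial
velocity `v₀`. -/
def IsAxisymSolution (R a ν T : ℝ) (v : SpaceTime → Space) (p : SpaceTime → ℝ)
    (f : SpaceTime → Space) (v₀ : Space → Space) : Prop :=
  ∃ (vt : SpaceTime → Space) (Dv : Fin 3 → SpaceTime → Space)
    (DDv : Fin 3 → Fin 3 → SpaceTime → Space) (gradp : SpaceTime → Space),
    MemW221 R a T v vt Dv DDv ∧
    (∀ i, HasWeakDeriv (cylT R a T) (dirX i) p (fun y => gradp y i)) ∧
    MemLp gradp 2 (muT R a T) ∧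
    -- momentum equation
    (∀ᵐ y ∂(muT R a T), ∀ i,
      vt y i + (∑ j, v y j * Dv j y i) - ν * (∑ j, DDv j j y i) + gradp y i = f y i) ∧
    -- incompressibility
    (∀ᵐ y ∂(muT R a T), ∑ j, Dv j y j = 0) ∧
    NoFlux R a T v Dv ∧
    PerfectSlip R a T Dv DDv ∧
    HasInitialValue R a T v vt v₀ ∧
    AxisymField R a T v ∧ IndepAngle R a T p ∧ AxisymField R a T f

/-- The swirl `u = r v_φ` of the velocity `v`; applied to the force it is `g = r f_φ`. -/
def swirl (w : SpaceTime → Space) (y : SpaceTime) : ℝ := cylR y.1 * inner ℝ (w y) (ePhi y.1)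

/-- The swirl `u₀ = r v_φ(0)` of the initial velocity. -/
def swirl₀ (w : Space → Space) (x : Space) : ℝ := cylR x * inner ℝ (w x) (ePhi x)

/-- The norm of `L_∞(μ)` (for functions that belong to this space). -/
def normLinf {α : Type*} [MeasurableSpace α] (μ : Measure α) (h : α → ℝ) : ℝ≥0 :=
  (eLpNorm h ⊤ μ).toNNReal

end AxisymNS

end

/-! With indices counted from 0 as in the code, the swirl is `u = x₀v₁ - x₁v₀`. Axial symmetry
removes the pressure from its equation `u_t + v·∇u - ν div(∇u - 2(v₁, -v₀, 0)) = g`, and the slip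
condition makes the normal component of the flux under the divergence vanish
(`IsAxisymSolution.swirlSystem`).

Test with `F(u)`. Convection drops out because `v` is solenoidal and tangent to the boundary. The
one dangerous term is `2νF'(u)(v₁∂₀u - v₀∂₁u)`, which by symmetry equals `2νF'(u) u ∂_r u / r`. Away
from the axis `1/r` is bounded and Young's inequality absorbs the term into the dissipation. Near
the axis it is `2ν ∂_r G(u) / r` with `G'(s) = sF'(s)`. It is integrated by parts against `χ(r²) r⁻²
(x₀, x₁, 0)`, whose divergence off the axis is the bounded function `2χ'(r²)`. The point mass on the
axis contributes nothing because `|u| ≤ r² m` with `m` in `L²` (`axis_identity`). The resulting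
balance (`energy_identity`) contains no norm of `v`.

With `F` close to `(s - k)₊` and `k` above `u₀` and `|g|`, this gives a De Giorgi inequality:
`½∫(u-k)₊²` at time `t`, as well as `ν/2` times the gradient energy on `{u > k}`, is at most a
constant times `∫∫_{u>k} (k² + (u-k)²)` (`EnergySystem.energy_le`). An elementary interpolation of
`L²` between `H¹` and `L¹` on convex sets (`lintegral_sq_le_of_convex`) replaces Sobolev embedding
and yields a recursion for `A_k = ∫∫(u-k)₊²`, with a linear term whose coefficient can be made small
and a quadratic term (`EnergySystem.levelSq_le`).

Gronwall's inequality gives `A_k ≤ M k²`, so `A/L²` is small at the level `L = Λk` for a large `Λ`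
that does not depend on the solution. Iterating over `L(2 - 2⁻ⁿ)` gives `u ≤ 2Λk`
(`exists_upper_bound`). The same bound for `-u` finishes the proof, with `d₆` affine in the two
norms. Nonlinear functions of the Sobolev function `u` are handled through smooth approximations
(`exists_smooth_approx`). -/

noncomputable section

open Filter Topology Module

set_option linter.unusedSectionVars false

/-! ### Mollification by averages contracted into a convex set. -/

section SmoothAverage

theorem eLpNorm_two_sq {α : Type*} [MeasurableSpace α] {μ : Measure α} (f : α → ℝ) :
    eLpNorm f 2 μ ^ 2 = ∫⁻ x, ‖f x‖ₑ ^ 2 ∂μ := by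
  have := eLpNorm_nnreal_pow_eq_lintegral (f := f) (μ := μ) (p := 2) (by norm_num)
  simpa using this

theorem sq_lintegral_le {α : Type*} [MeasurableSpace α] (μ : Measure α) {f : α → ℝ≥0∞}
    (hf : AEMeasurable f μ) : (∫⁻ x, f x ∂μ) ^ 2 ≤ μ univ * ∫⁻ x, f x ^ 2 ∂μ := by
  have h := ENNReal.lintegral_mul_le_Lp_mul_Lq μ Real.HolderConjugate.two_two
    (f := f) (g := fun _ => 1) hf aemeasurable_const
  simp only [Pi.mul_apply, mul_one, ENNReal.rpow_two, one_pow, lintegral_const, one_mul] at h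
  calc (∫⁻ x, f x ∂μ) ^ 2
      ≤ ((∫⁻ x, f x ^ 2 ∂μ) ^ (1 / 2 : ℝ) * (μ univ) ^ (1 / 2 : ℝ)) ^ 2 := by gcongr
    _ = μ univ * ∫⁻ x, f x ^ 2 ∂μ := by
      rw [mul_pow, ← ENNReal.rpow_two, ← ENNReal.rpow_two, ← ENNReal.rpow_mul,
        ← ENNReal.rpow_mul]
      norm_num [mul_comm]

variable {E : Type*} [NormedAddCommGroup E] [NormedSpace ℝ E] [FiniteDimensional ℝ E]
  [MeasurableSpace E] [BorelSpace E] {μ : Measure E} [μ.IsAddHaarMeasure]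

theorem lintegral_comp_smul_add (f : E → ℝ≥0∞) (hf : Measurable f) {s : ℝ} (hs : 0 < s) (b : E) :
    ∫⁻ x, f (s • x + b) ∂μ = ENNReal.ofReal ((s ^ finrank ℝ E)⁻¹) * ∫⁻ x, f x ∂μ := by
  have h1 : ∫⁻ x, f (s • x + b) ∂μ = ∫⁻ x, f (x + b) ∂(Measure.map (s • ·) μ) := by
    rw [lintegral_map (by fun_prop) (by fun_prop)]
  rw [h1, Measure.map_addHaar_smul μ hs.ne', lintegral_smul_measure, lintegral_add_right_eq_self f b,
    smul_eq_mul, abs_of_pos (by positivity)]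

/-- The average of `h` over the set `(1 - l) x + l supp ρ`, with weight `ρ`. -/
def smoothAvg (μ : Measure E) (ρ : E → ℝ) (l : ℝ) (h : E → ℝ) (x : E) : ℝ :=
  ∫ y, ρ y * h ((1 - l) • x + l • y) ∂μ

/-- The rescaled and reflected weight. -/
def avgKernel (ρ : E → ℝ) (l : ℝ) (w : E) : ℝ := (l ^ finrank ℝ E)⁻¹ * ρ (-(l⁻¹ • w))

/-- The substitution `z = (1-l)x + ly` moves `x` from the argument of the rough function `h` into
the smooth kernel. -/
theorem smoothAvg_eq_integral (ρ : E → ℝ) {l : ℝ} (hl : 0 < l) (h : E → ℝ) (x : E) :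
    smoothAvg μ ρ l h x = ∫ z, h z * avgKernel ρ l ((1 - l) • x - z) ∂μ := by
  have h1 : ∀ y, ρ y * h ((1 - l) • x + l • y) =
      (fun w => ρ (l⁻¹ • w) * h ((1 - l) • x + w)) (l • y) := by
    intro y; simp [smul_smul, inv_mul_cancel₀ hl.ne']
  have h2 : smoothAvg μ ρ l h x =
      ∫ y, (fun w => ρ (l⁻¹ • w) * h ((1 - l) • x + w)) (l • y) ∂μ := integral_congr_ae (.of_forall h1)
  rw [h2, Measure.integral_comp_smul μ (fun w => ρ (l⁻¹ • w) * h ((1 - l) • x + w)), abs_of_pos (by positivity),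
    ← integral_sub_right_eq_self _ ((1 - l) • x), smul_eq_mul, ← integral_const_mul]
  congr 1; ext z
  simp only [avgKernel, add_sub_cancel, ← smul_neg, neg_sub]
  ring

theorem smoothAvg_eq_convolution (ρ : E → ℝ) {l : ℝ} (hl : 0 < l) (h : E → ℝ) (x : E) :
    smoothAvg μ ρ l h x =
      convolution h (avgKernel ρ l) (ContinuousLinearMap.mul ℝ ℝ) μ ((1 - l) • x) := by
  rw [smoothAvg_eq_integral ρ hl, convolution_def]; rfl

theorem contDiff_avgKernel {ρ : E → ℝ} (hρ : ContDiff ℝ ∞ ρ) (l : ℝ) :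
    ContDiff ℝ ∞ (avgKernel ρ l) := by
  unfold avgKernel; fun_prop

theorem hasCompactSupport_avgKernel {ρ : E → ℝ} (hρ : HasCompactSupport ρ) {l : ℝ} (hl : 0 < l) :
    HasCompactSupport (avgKernel ρ l) := by
  have h1 : HasCompactSupport fun w : E => ρ (-(l⁻¹ • w)) :=
    hρ.comp_homeomorph ((Homeomorph.smulOfNeZero l⁻¹ (inv_ne_zero hl.ne')).trans (Homeomorph.neg E))
  exact h1.mul_left

theorem contDiff_smoothAvg {ρ : E → ℝ} (hρ : ContDiff ℝ ∞ ρ) (hρc : HasCompactSupport ρ) {l : ℝ}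
    (hl : 0 < l) {h : E → ℝ} (hh : LocallyIntegrable h μ) :
    ContDiff ℝ ∞ (smoothAvg μ ρ l h) := by
  have h1 : smoothAvg μ ρ l h = fun x =>
      convolution h (avgKernel ρ l) (ContinuousLinearMap.mul ℝ ℝ) μ ((1 - l) • x) :=
    funext fun x => smoothAvg_eq_convolution ρ hl h x
  rw [h1]
  have h2 := (hasCompactSupport_avgKernel hρc hl).contDiff_convolution_right (n := ⊤)
    (ContinuousLinearMap.mul ℝ ℝ) hh (contDiff_avgKernel hρ l)
  exact h2.comp (contDiff_const_smul (1 - l))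

/-- The kernel depends on `x` only through `(1-l)x - z`, so an `x`-derivative is `-(1-l)` times a
`z`-derivative. In this form the definition of a weak derivative of `h` applies. -/
theorem fderiv_smoothAvg {ρ : E → ℝ} (hρ : ContDiff ℝ ∞ ρ) (hρc : HasCompactSupport ρ) {l : ℝ}
    (hl : 0 < l) {h : E → ℝ} (hh : LocallyIntegrable h μ) (x e : E) :
    fderiv ℝ (smoothAvg μ ρ l h) x e =
      -(1 - l) * ∫ z, h z * fderiv ℝ (fun z => avgKernel ρ l ((1 - l) • x - z)) z e ∂μ := by
  have h1 : smoothAvg μ ρ l h = fun x =>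
      convolution h (avgKernel ρ l) (ContinuousLinearMap.mul ℝ ℝ) μ ((1 - l) • x) :=
    funext fun x => smoothAvg_eq_convolution ρ hl h x
  have hk := contDiff_avgKernel hρ l
  have hkc := hasCompactSupport_avgKernel hρc hl
  have h2 := hkc.hasFDerivAt_convolution_right (ContinuousLinearMap.mul ℝ ℝ) hh
    (hk.of_le (by norm_num)) ((1 - l) • x)
  have h3 : HasFDerivAt (fun x : E => (1 - l) • x) ((1 - l) • ContinuousLinearMap.id ℝ E) x :=
    (hasFDerivAt_id x).const_smul (1 - l)
  rw [h1]
  have h4 := (h2.comp x h3).fderiv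
  simp only [Function.comp_def] at h4
  rw [h4]
  simp only [ContinuousLinearMap.comp_apply, smul_apply,
    ContinuousLinearMap.id_apply, map_smul, smul_eq_mul]
  rw [convolution_precompR_apply _ hh (hkc.fderiv ℝ) (hk.continuous_fderiv (by norm_num)),
    convolution_def, neg_mul, ← mul_neg, ← integral_neg]
  congr 1
  congr 1; ext z
  have h5 : HasFDerivAt (fun z : E => avgKernel ρ l ((1 - l) • x - z))
      ((fderiv ℝ (avgKernel ρ l) ((1 - l) • x - z)).comp (-ContinuousLinearMap.id ℝ E)) z := by
    have := (hasFDerivAt_id (𝕜 := ℝ) z).const_sub ((1 - l) • x)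
    exact ((hk.differentiable (by norm_num)) _).hasFDerivAt.comp z this
  rw [h5.fderiv]
  simp

/-- The kernel lives on the contraction of `supp ρ` towards `x`, which convexity keeps in `D`. It is
therefore an admissible test function for every `x ∈ D`, however close to the boundary, and no
extension operator is needed. -/
theorem tsupport_avgKernel_sub_subset {ρ : E → ℝ} (hρc : HasCompactSupport ρ) {D : Set E}
    (hD : Convex ℝ D) (hρD : tsupport ρ ⊆ D) {l : ℝ} (hl : 0 < l) (hl1 : l ≤ 1) {x : E}
    (hx : x ∈ D) : tsupport (fun z => avgKernel ρ l ((1 - l) • x - z)) ⊆ D := by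
  have h1 : tsupport (fun z => avgKernel ρ l ((1 - l) • x - z)) ⊆
      (fun y => (1 - l) • x + l • y) '' tsupport ρ := by
    apply closure_minimal
    · intro z hz
      refine ⟨l⁻¹ • (z - (1 - l) • x), subset_tsupport _ ?_, ?_⟩
      · intro h0
        apply hz
        simp only [avgKernel, ← smul_neg, neg_sub, h0, mul_zero]
      · simp [smul_smul, mul_inv_cancel₀ hl.ne']
    · exact (hρc.image (by fun_prop)).isClosed
  refine h1.trans ?_
  rintro _ ⟨y, hy, rfl⟩
  exact hD hx (hρD hy) (by linarith) hl.le (by ring)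

theorem hasCompactSupport_avgKernel_sub {ρ : E → ℝ} (hρc : HasCompactSupport ρ)
    {l : ℝ} (hl : 0 < l) (x : E) :
    HasCompactSupport (fun z => avgKernel ρ l ((1 - l) • x - z)) :=
  (hasCompactSupport_avgKernel hρc hl).comp_homeomorph (Homeomorph.subLeft ((1 - l) • x))

/-- Cauchy–Schwarz for the probability measure `ρ dy`, then Fubini: for fixed `y` the map `x ↦
(1-l)x + ly` has Jacobian at least `2⁻ⁿ` when `l ≤ 1/2`. -/
theorem eLpNorm_smoothAvg_le {ρ : E → ℝ} (hρ : Continuous ρ) (hρ0 : ∀ y, 0 ≤ ρ y)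
    (hρ1 : ∫⁻ y, ENNReal.ofReal (ρ y) ∂μ = 1) {l : ℝ} (hl1 : l ≤ 1 / 2) {h : E → ℝ}
    (hh : Measurable h) :
    eLpNorm (smoothAvg μ ρ l h) 2 μ ^ 2 ≤ 2 ^ finrank ℝ E * eLpNorm h 2 μ ^ 2 := by
  set ν : Measure E := μ.withDensity fun y => ENNReal.ofReal (ρ y)
  have hν : ν univ = 1 := by simp [ν, hρ1]
  have : IsProbabilityMeasure ν := ⟨hν⟩
  have hpt : ∀ x, ‖smoothAvg μ ρ l h x‖ₑ ^ 2 ≤ ∫⁻ y, ‖h ((1 - l) • x + l • y)‖ₑ ^ 2 ∂ν := by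
    intro x
    have hm : Measurable fun y : E => ‖h ((1 - l) • x + l • y)‖ₑ := by fun_prop
    have h1 : ‖smoothAvg μ ρ l h x‖ₑ ≤ ∫⁻ y, ‖h ((1 - l) • x + l • y)‖ₑ ∂ν := by
      refine (enorm_integral_le_lintegral_enorm _).trans ?_
      rw [lintegral_withDensity_eq_lintegral_mul _ (by fun_prop) hm]
      apply lintegral_mono
      intro y
      simp only [Pi.mul_apply, enorm_mul]
      rw [Real.enorm_of_nonneg (hρ0 y)]
    calc _ ≤ (∫⁻ y, ‖h ((1 - l) • x + l • y)‖ₑ ∂ν) ^ 2 := by gcongr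
      _ ≤ _ := by simpa [hν] using sq_lintegral_le ν hm.aemeasurable
  rw [eLpNorm_two_sq, eLpNorm_two_sq]
  calc _ ≤ ∫⁻ x, ∫⁻ y, ‖h ((1 - l) • x + l • y)‖ₑ ^ 2 ∂ν ∂μ := lintegral_mono hpt
    _ = ∫⁻ y, ∫⁻ x, ‖h ((1 - l) • x + l • y)‖ₑ ^ 2 ∂μ ∂ν :=
      lintegral_lintegral_swap (by fun_prop)
    _ = ∫⁻ y, ENNReal.ofReal (((1 - l) ^ finrank ℝ E)⁻¹) * ∫⁻ x, ‖h x‖ₑ ^ 2 ∂μ ∂ν := by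
      congr 1; ext y
      exact lintegral_comp_smul_add (fun x => ‖h x‖ₑ ^ 2) (by fun_prop) (by linarith) _
    _ = ENNReal.ofReal (((1 - l) ^ finrank ℝ E)⁻¹) * ∫⁻ x, ‖h x‖ₑ ^ 2 ∂μ := by simp
    _ ≤ _ := by
      gcongr
      rw [← inv_pow, ENNReal.ofReal_pow (by rw [inv_nonneg]; linarith)]
      gcongr
      rw [show (2 : ℝ≥0∞) = ENNReal.ofReal 2 by simp]
      apply ENNReal.ofReal_le_ofReal
      rw [inv_le_comm₀ (by linarith) (by norm_num)]; linarith

theorem integrable_mul_avgKernel {ρ : E → ℝ} (hρ : ContDiff ℝ ∞ ρ) (hρc : HasCompactSupport ρ)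
    {l : ℝ} (hl : 0 < l) {h : E → ℝ} (hh : LocallyIntegrable h μ) (x : E) :
    Integrable (fun z => h z * avgKernel ρ l ((1 - l) • x - z)) μ :=
  (hasCompactSupport_avgKernel hρc hl).convolutionExists_right (ContinuousLinearMap.mul ℝ ℝ) hh
    (contDiff_avgKernel hρ l).continuous ((1 - l) • x)

theorem smoothAvg_sub {ρ : E → ℝ} (hρ : ContDiff ℝ ∞ ρ) (hρc : HasCompactSupport ρ)
    {l : ℝ} (hl : 0 < l) {h g : E → ℝ} (hh : LocallyIntegrable h μ) (hg : LocallyIntegrable g μ)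
    (x : E) : smoothAvg μ ρ l (h - g) x = smoothAvg μ ρ l h x - smoothAvg μ ρ l g x := by
  simp only [smoothAvg_eq_integral ρ hl, Pi.sub_apply, sub_mul]
  exact integral_sub (integrable_mul_avgKernel hρ hρc hl hh x)
    (integrable_mul_avgKernel hρ hρc hl hg x)

theorem abs_smoothAvg_sub_le {ρ : E → ℝ} (hρ : Continuous ρ) (hρc : HasCompactSupport ρ)
    (hρ0 : ∀ y, 0 ≤ ρ y) (hρ1 : ∫ y, ρ y ∂μ = 1) {l : ℝ} {g : E → ℝ} (hg : Continuous g)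
    {η : ℝ} (x : E) (h : ∀ y ∈ tsupport ρ, |g ((1 - l) • x + l • y) - g x| ≤ η) :
    |smoothAvg μ ρ l g x - g x| ≤ η := by
  have hρi : Integrable ρ μ := hρ.integrable_of_hasCompactSupport hρc
  have hρg : Integrable (fun y => ρ y * g ((1 - l) • x + l • y)) μ :=
    (by fun_prop : Continuous fun y => ρ y * g ((1 - l) • x + l • y)).integrable_of_hasCompactSupport
      hρc.mul_right
  have h1 : smoothAvg μ ρ l g x - g x = ∫ y, ρ y * (g ((1 - l) • x + l • y) - g x) ∂μ := by
    simp only [mul_sub]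
    rw [integral_sub hρg (hρi.mul_const _), integral_mul_const, hρ1, one_mul]; rfl
  rw [h1, ← Real.norm_eq_abs]
  calc _ ≤ ∫ y, ρ y * η ∂μ := by
        apply norm_integral_le_of_norm_le (hρi.mul_const _)
        refine .of_forall fun y => ?_
        by_cases hy : y ∈ tsupport ρ
        · rw [norm_mul, Real.norm_of_nonneg (hρ0 y)]
          exact mul_le_mul_of_nonneg_left (h y hy) (hρ0 y)
        · simp [image_eq_zero_of_notMem_tsupport hy]
    _ = η := by rw [integral_mul_const, hρ1, one_mul]

theorem tendsto_eLpNorm_smoothAvg_sub_of_continuous {ρ : E → ℝ} (hρ : Continuous ρ)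
    (hρc : HasCompactSupport ρ)
    (hρ0 : ∀ y, 0 ≤ ρ y) (hρ1 : ∫ y, ρ y ∂μ = 1) {g : E → ℝ} (hg : Continuous g)
    (hgc : HasCompactSupport g) {D : Set E} (hDm : MeasurableSet D) (hD : Bornology.IsBounded D)
    {l : ℕ → ℝ} (hl : Tendsto l atTop (𝓝 0)) :
    Tendsto (fun n => eLpNorm (fun x => smoothAvg μ ρ (l n) g x - g x) 2 (μ.restrict D)) atTop
      (𝓝 0) := by
  have hfin : μ D ≠ ⊤ := hD.measure_lt_top.ne
  obtain ⟨M, hM0, hM⟩ : ∃ M : ℝ, 0 < M ∧ ∀ y ∈ tsupport ρ, ∀ x ∈ D, ‖y - x‖ ≤ M := by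
    obtain ⟨M1, h1⟩ := hρc.isBounded.exists_norm_le
    obtain ⟨M2, h2⟩ := hD.exists_norm_le
    refine ⟨|M1| + |M2| + 1, by positivity, fun y hy x hx => ?_⟩
    have := norm_sub_le y x
    have := h1 y hy
    have := h2 x hx
    have := le_abs_self M1
    have := le_abs_self M2
    linarith
  have key : ∀ η > 0, ∀ᶠ n in atTop, ∀ x ∈ D, |smoothAvg μ ρ (l n) g x - g x| ≤ η := by
    intro η hη
    have huc := hgc.uniformContinuous_of_continuous hg
    obtain ⟨δ, hδ, h⟩ := Metric.uniformContinuous_iff.1 huc η hη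
    have : ∀ᶠ n in atTop, |l n| < δ / M := by
      simpa using hl.eventually (Metric.ball_mem_nhds 0 (div_pos hδ hM0))
    filter_upwards [this] with n hn x hx
    apply abs_smoothAvg_sub_le hρ hρc hρ0 hρ1 hg
    intro y hy
    refine (h ?_).le
    rw [dist_eq_norm, show (1 - l n) • x + l n • y - x = l n • (y - x) by module, norm_smul,
      Real.norm_eq_abs]
    calc |l n| * ‖y - x‖ ≤ |l n| * M := by gcongr; exact hM y hy x hx
      _ < δ / M * M := by gcongr
      _ = δ := by field_simp
  rw [ENNReal.tendsto_nhds_zero]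
  intro ε hε
  obtain ⟨η, hη, hηε⟩ : ∃ η : ℝ, 0 < η ∧ μ D ^ (1 / 2 : ℝ) * ENNReal.ofReal η ≤ ε := by
    have ht : Tendsto (fun η : ℝ => μ D ^ (1 / 2 : ℝ) * ENNReal.ofReal η) (𝓝[>] 0)
        (𝓝 (μ D ^ (1 / 2 : ℝ) * ENNReal.ofReal 0)) := by
      apply ENNReal.Tendsto.const_mul _ (Or.inr (by simp [hfin]))
      exact ((ENNReal.continuous_ofReal.tendsto 0).mono_left nhdsWithin_le_nhds)
    simp only [ENNReal.ofReal_zero, mul_zero] at ht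
    obtain ⟨η, h1, h2⟩ := ((ht.eventually_le_const hε).and self_mem_nhdsWithin).exists
    exact ⟨η, h2, h1⟩
  filter_upwards [key η hη] with n hn
  have h1 := eLpNorm_le_of_ae_bound (p := 2) (μ := μ.restrict D) (C := η)
    (f := fun x => smoothAvg μ ρ (l n) g x - g x)
    ((ae_restrict_iff' hDm).2 (.of_forall fun x hx => by simpa using hn x hx))
  refine h1.trans ?_
  simpa using hηε

theorem tendsto_eLpNorm_smoothAvg_sub {ρ : E → ℝ} (hρ : ContDiff ℝ ∞ ρ)
    (hρc : HasCompactSupport ρ)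
    (hρ0 : ∀ y, 0 ≤ ρ y) (hρ1 : ∫ y, ρ y ∂μ = 1) {h : E → ℝ} (hh : MemLp h 2 μ)
    (hhm : Measurable h) {D : Set E} (hDm : MeasurableSet D) (hD : Bornology.IsBounded D)
    {l : ℕ → ℝ} (hl0 : ∀ n, 0 < l n) (hl1 : ∀ n, l n ≤ 1 / 2) (hl : Tendsto l atTop (𝓝 0)) :
    Tendsto (fun n => eLpNorm (fun x => smoothAvg μ ρ (l n) h x - h x) 2 (μ.restrict D)) atTop
      (𝓝 0) := by
  have hρ1' : ∫⁻ y, ENNReal.ofReal (ρ y) ∂μ = 1 := by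
    rw [← ofReal_integral_eq_lintegral_ofReal (hρ.continuous.integrable_of_hasCompactSupport hρc)
      (.of_forall hρ0), hρ1, ENNReal.ofReal_one]
  rw [ENNReal.tendsto_nhds_zero]
  intro ε hε
  -- The three errors of the splitting below are at most `2ⁿ`, `1` and `1` times `ε / C`.
  set C : ℝ≥0∞ := 2 ^ finrank ℝ E + 2
  have hC0 : C ≠ 0 := by simp [C]
  have hCt : C ≠ ⊤ := by simp [C]
  have hε3 : ε / C ≠ 0 := (ENNReal.div_pos hε.ne' hCt).ne'
  obtain ⟨g, hgc, hgε, hg, hgm⟩ := hh.exists_hasCompactSupport_eLpNorm_sub_le (by norm_num) hε3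
  have hli : LocallyIntegrable h μ := hh.locallyIntegrable (by norm_num)
  have hlg : LocallyIntegrable g μ := hg.locallyIntegrable
  have hc := tendsto_eLpNorm_smoothAvg_sub_of_continuous hρ.continuous hρc hρ0 hρ1 hg hgc hDm hD hl
  filter_upwards [ENNReal.tendsto_nhds_zero.1 hc (ε / C) (pos_iff_ne_zero.2 hε3)] with n hn
  have hb : eLpNorm (smoothAvg μ ρ (l n) (h - g)) 2 (μ.restrict D) ≤
      2 ^ finrank ℝ E * (ε / C) := by
    refine (eLpNorm_restrict_le _ _ _ _).trans ?_
    have h1 := eLpNorm_smoothAvg_le (μ := μ) hρ.continuous hρ0 hρ1' (hl1 n)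
      (hhm.sub hg.measurable)
    have h2 : eLpNorm (smoothAvg μ ρ (l n) (h - g)) 2 μ ^ 2 ≤
        (2 ^ finrank ℝ E * (ε / C)) ^ 2 := by
      refine h1.trans ?_
      rw [mul_pow]
      have h3 : (1 : ℝ≥0∞) ≤ 2 ^ finrank ℝ E := one_le_pow₀ (by norm_num)
      exact mul_le_mul' (le_self_pow₀ h3 two_ne_zero) (pow_le_pow_left₀ bot_le hgε 2)
    exact (ENNReal.pow_le_pow_left_iff two_ne_zero).1 h2
  have hm1 : AEStronglyMeasurable (smoothAvg μ ρ (l n) (h - g)) (μ.restrict D) :=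
    (contDiff_smoothAvg hρ hρc (hl0 n) (hli.sub hlg)).continuous.aestronglyMeasurable
  have hm2 : AEStronglyMeasurable (fun x => smoothAvg μ ρ (l n) g x - g x) (μ.restrict D) :=
    ((contDiff_smoothAvg hρ hρc (hl0 n) hlg).continuous.sub hg).aestronglyMeasurable
  have hsplit : (fun x => smoothAvg μ ρ (l n) h x - h x) =
      (smoothAvg μ ρ (l n) (h - g) + fun x => smoothAvg μ ρ (l n) g x - g x) - (h - g) := by
    ext x
    simp only [Pi.add_apply, Pi.sub_apply, smoothAvg_sub hρ hρc (hl0 n) hli hlg]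
    ring
  rw [hsplit]
  calc _ ≤ eLpNorm (smoothAvg μ ρ (l n) (h - g) + fun x => smoothAvg μ ρ (l n) g x - g x) 2
          (μ.restrict D) + eLpNorm (h - g) 2 (μ.restrict D) :=
        eLpNorm_sub_le (hm1.add hm2) (hhm.sub hg.measurable).aestronglyMeasurable (by norm_num)
    _ ≤ eLpNorm (smoothAvg μ ρ (l n) (h - g)) 2 (μ.restrict D) +
          eLpNorm (fun x => smoothAvg μ ρ (l n) g x - g x) 2 (μ.restrict D) +
          eLpNorm (h - g) 2 (μ.restrict D) := by
        gcongr
        exact eLpNorm_add_le hm1 hm2 (by norm_num)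
    _ ≤ 2 ^ finrank ℝ E * (ε / C) + ε / C + ε / C := by
        gcongr
        exact (eLpNorm_restrict_le _ _ _ _).trans hgε
    _ = C * (ε / C) := by simp only [C]; ring
    _ = ε := ENNReal.mul_div_cancel hC0 hCt

end SmoothAverage

/-! ### Interpolation of `L²` between `H¹` and `L¹` on bounded convex sets. -/

section NashInequality

variable {E : Type*} [NormedAddCommGroup E] [NormedSpace ℝ E] [FiniteDimensional ℝ E]
  [MeasurableSpace E] [BorelSpace E] {μ : Measure E} [μ.IsAddHaarMeasure]

theorem setLIntegral_comp_segment_le {D : Set E} (hD : Convex ℝ D) (hDm : MeasurableSet D)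
    (f : E → ℝ≥0∞) (hf : Measurable f) {s t : ℝ} (hs : 0 < s) (ht : 0 ≤ t) (hst : s + t = 1)
    {b : E} (hb : b ∈ D) :
    ∫⁻ x in D, f (s • x + t • b) ∂μ ≤ ENNReal.ofReal ((s ^ finrank ℝ E)⁻¹) * ∫⁻ x in D, f x ∂μ := by
  rw [← lintegral_indicator hDm, ← lintegral_indicator hDm,
    ← lintegral_comp_smul_add (D.indicator f) (hf.indicator hDm) hs (t • b)]
  apply lintegral_mono
  intro x
  by_cases hx : x ∈ D
  · change D.indicator (fun x => f (s • x + t • b)) x ≤ D.indicator f (s • x + t • b)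
    rw [indicator_of_mem hx, indicator_of_mem (hD hx hb hs.le ht hst)]
  · simp [hx]

/-- Fundamental theorem of calculus along the segment. Cauchy–Schwarz on `[0, l]` produces one
factor `l`; the outer integral over `s` will produce the second one. -/
theorem enorm_sub_sq_le_of_segment {w : E → ℝ} (hw : ContDiff ℝ 1 w) {l d : ℝ} (hl : 0 ≤ l)
    {x y : E} (hd : ‖y - x‖ ≤ d) :
    ‖w ((1 - l) • x + l • y) - w x‖ₑ ^ 2 ≤ ENNReal.ofReal (l * d ^ 2) *
      ∫⁻ s in Icc 0 l, ‖fderiv ℝ w ((1 - s) • x + s • y)‖ₑ ^ 2 := by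
  have hd0 : 0 ≤ d := (norm_nonneg _).trans hd
  have hderiv : ∀ s : ℝ, HasDerivAt (fun s : ℝ => w ((1 - s) • x + s • y))
      (fderiv ℝ w ((1 - s) • x + s • y) (y - x)) s := by
    intro s
    have h1 : HasDerivAt (fun s : ℝ => (1 - s) • x + s • y) (y - x) s := by
      have := (((hasDerivAt_id s).const_sub 1).smul_const x).add ((hasDerivAt_id s).smul_const y)
      simp only [id] at this
      convert! this using 1
      module
    exact ((hw.differentiable one_ne_zero) _).hasFDerivAt.comp_hasDerivAt s h1
  have hc : Continuous fun s : ℝ => fderiv ℝ w ((1 - s) • x + s • y) :=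
    (hw.continuous_fderiv one_ne_zero).comp (by fun_prop)
  have hftc := intervalIntegral.integral_eq_sub_of_hasDerivAt (a := 0) (b := l)
    (fun s _ => hderiv s) ((hc.clm_apply continuous_const).intervalIntegrable _ _)
  simp only [sub_zero, one_smul, zero_smul, add_zero] at hftc
  rw [← hftc, intervalIntegral.integral_of_le hl, ← integral_Icc_eq_integral_Ioc]
  have h1 : ‖∫ s in Icc 0 l, fderiv ℝ w ((1 - s) • x + s • y) (y - x)‖ₑ ≤
      ENNReal.ofReal d * ∫⁻ s in Icc 0 l, ‖fderiv ℝ w ((1 - s) • x + s • y)‖ₑ := by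
    refine (enorm_integral_le_lintegral_enorm _).trans ?_
    rw [← lintegral_const_mul' _ _ ENNReal.ofReal_ne_top]
    apply lintegral_mono
    intro s
    refine ((ContinuousLinearMap.le_opENorm _ _).trans_eq (mul_comm _ _)).trans
      (mul_le_mul' ?_ le_rfl)
    rw [← ofReal_norm]
    exact ENNReal.ofReal_le_ofReal hd
  calc _ ≤ (ENNReal.ofReal d *
          ∫⁻ s in Icc 0 l, ‖fderiv ℝ w ((1 - s) • x + s • y)‖ₑ) ^ 2 := by gcongr
    _ ≤ ENNReal.ofReal d ^ 2 * (ENNReal.ofReal l *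
          ∫⁻ s in Icc 0 l, ‖fderiv ℝ w ((1 - s) • x + s • y)‖ₑ ^ 2) := by
        rw [mul_pow]
        gcongr
        have := sq_lintegral_le (volume.restrict (Icc 0 l)) hc.enorm.measurable.aemeasurable
        simpa using this
    _ = _ := by
        rw [← mul_assoc, ENNReal.ofReal_mul hl, ENNReal.ofReal_pow hd0]
        ring

/-- A quantitative interpolation of `L²` between `H¹` and `L¹` on a bounded convex set. -/
theorem lintegral_sq_le_of_convex {D : Set E} (hD : Convex ℝ D) (hDm : MeasurableSet D)
    (hD0 : μ D ≠ 0) (hDt : μ D ≠ ⊤)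
    {d : ℝ} (hd : ∀ x ∈ D, ∀ y ∈ D, ‖y - x‖ ≤ d) {w : E → ℝ} (hw : ContDiff ℝ 1 w)
    {l : ℝ} (hl : 0 < l) (hl2 : l ≤ 1 / 2) :
    ∫⁻ x in D, ‖w x‖ₑ ^ 2 ∂μ ≤
      ENNReal.ofReal (2 * d ^ 2 * l ^ 2 * 2 ^ finrank ℝ E) * ∫⁻ x in D, ‖fderiv ℝ w x‖ₑ ^ 2 ∂μ +
      2 * (μ D)⁻¹ * (ENNReal.ofReal ((l ^ finrank ℝ E)⁻¹) * ∫⁻ x in D, ‖w x‖ₑ ∂μ) ^ 2 := by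
  set I := ∫⁻ x in D, ‖fderiv ℝ w x‖ₑ ^ 2 ∂μ
  set J := ENNReal.ofReal ((l ^ finrank ℝ E)⁻¹) * ∫⁻ x in D, ‖w x‖ₑ ∂μ
  have hwm : Measurable w := hw.continuous.measurable
  have hfc : Continuous (fderiv ℝ w) := hw.continuous_fderiv one_ne_zero
  -- pointwise bound after averaging in `y`
  have hpt : ∀ x ∈ D, ‖w x‖ₑ ^ 2 ≤ 2 * (μ D)⁻¹ *
      ∫⁻ y in D, ‖w ((1 - l) • x + l • y) - w x‖ₑ ^ 2 ∂μ + 2 * ((μ D)⁻¹ * J) ^ 2 := by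
    intro x hx
    -- The value `w x` is compared with the mean of `w` over `(1-l)x + lD ⊆ D`. The mean is
    -- controlled by the `L¹` norm, at the price of the Jacobian `l⁻ⁿ`.
    have hA : μ D * ‖w x‖ₑ ≤ ∫⁻ y in D, ‖w ((1 - l) • x + l • y) - w x‖ₑ ∂μ + J := by
      have h1 : ∫⁻ y in D, ‖w ((1 - l) • x + l • y)‖ₑ ∂μ ≤ J := by
        have := setLIntegral_comp_segment_le (μ := μ) hD hDm (fun y => ‖w y‖ₑ) (by fun_prop)
          (s := l) (t := 1 - l) hl (by linarith) (by ring) hx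
        simpa only [add_comm] using this
      calc μ D * ‖w x‖ₑ = ∫⁻ y in D, ‖w x‖ₑ ∂μ := by simp [mul_comm]
        _ ≤ ∫⁻ y in D, (‖w ((1 - l) • x + l • y) - w x‖ₑ + ‖w ((1 - l) • x + l • y)‖ₑ) ∂μ := by
          apply lintegral_mono
          intro y
          have := enorm_sub_le (a := w ((1 - l) • x + l • y))
            (b := w ((1 - l) • x + l • y) - w x)
          rw [sub_sub_cancel] at this
          rwa [add_comm] at this
        _ = _ := lintegral_add_right _ (by fun_prop)
        _ ≤ _ := by gcongr
    have hB : ‖w x‖ₑ ≤ (μ D)⁻¹ * ∫⁻ y in D, ‖w ((1 - l) • x + l • y) - w x‖ₑ ∂μ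
        + (μ D)⁻¹ * J := by
      rw [← mul_add]
      calc ‖w x‖ₑ = (μ D)⁻¹ * (μ D * ‖w x‖ₑ) := by
            rw [← mul_assoc, ENNReal.inv_mul_cancel hD0 hDt, one_mul]
        _ ≤ _ := by gcongr
    calc ‖w x‖ₑ ^ 2 ≤ ((μ D)⁻¹ * ∫⁻ y in D, ‖w ((1 - l) • x + l • y) - w x‖ₑ ∂μ
          + (μ D)⁻¹ * J) ^ 2 := by gcongr
      _ ≤ 2 * (((μ D)⁻¹ * ∫⁻ y in D, ‖w ((1 - l) • x + l • y) - w x‖ₑ ∂μ) ^ 2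
          + ((μ D)⁻¹ * J) ^ 2) := by
        have := ENNReal.rpow_add_le_mul_rpow_add_rpow
          ((μ D)⁻¹ * ∫⁻ y in D, ‖w ((1 - l) • x + l • y) - w x‖ₑ ∂μ) ((μ D)⁻¹ * J)
          (p := 2) (by norm_num)
        norm_num at this
        exact this
      _ ≤ _ := by
        rw [mul_add, mul_assoc 2]
        gcongr
        rw [mul_pow]
        have h2 := sq_lintegral_le (μ.restrict D)
          (f := fun y => ‖w ((1 - l) • x + l • y) - w x‖ₑ) (by fun_prop)
        rw [Measure.restrict_apply_univ] at h2
        calc _ ≤ (μ D)⁻¹ ^ 2 * (μ D * ∫⁻ y in D, ‖w ((1 - l) • x + l • y) - w x‖ₑ ^ 2 ∂μ) := by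
              gcongr
          _ = (μ D)⁻¹ * ((μ D)⁻¹ * μ D) *
                ∫⁻ y in D, ‖w ((1 - l) • x + l • y) - w x‖ₑ ^ 2 ∂μ := by ring
          _ = _ := by rw [ENNReal.inv_mul_cancel hD0 hDt, mul_one]
  -- the double integral of the difference
  have hdouble : ∫⁻ x in D, ∫⁻ y in D, ‖w ((1 - l) • x + l • y) - w x‖ₑ ^ 2 ∂μ ∂μ ≤
      μ D * (ENNReal.ofReal (d ^ 2 * l ^ 2 * 2 ^ finrank ℝ E) * I) := by
    -- Here `x` is integrated with `y` frozen: `x ↦ (1-s)x + sy` has Jacobian at least `2⁻ⁿ` for `s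
    -- ≤ 1/2`, whereas the Jacobian in `y` degenerates as `s → 0`.
    have hin : ∀ y ∈ D, ∫⁻ x in D, ‖w ((1 - l) • x + l • y) - w x‖ₑ ^ 2 ∂μ ≤
        ENNReal.ofReal (d ^ 2 * l ^ 2 * 2 ^ finrank ℝ E) * I := by
      intro y hy
      calc _ ≤ ∫⁻ x in D, (ENNReal.ofReal (l * d ^ 2) *
            ∫⁻ s in Icc 0 l, ‖fderiv ℝ w ((1 - s) • x + s • y)‖ₑ ^ 2) ∂μ := by
            apply setLIntegral_mono' hDm
            intro x hx
            exact enorm_sub_sq_le_of_segment hw hl.le (hd x hx y hy)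
        _ = ENNReal.ofReal (l * d ^ 2) *
            ∫⁻ s in Icc 0 l, ∫⁻ x in D, ‖fderiv ℝ w ((1 - s) • x + s • y)‖ₑ ^ 2 ∂μ := by
            have hm : Measurable (Function.uncurry fun (x : E) (s : ℝ) =>
                ‖fderiv ℝ w ((1 - s) • x + s • y)‖ₑ ^ 2) := by
              apply Continuous.measurable
              have hc2 : Continuous fun q : E × ℝ => fderiv ℝ w ((1 - q.2) • q.1 + q.2 • y) :=
                hfc.comp (by fun_prop)
              exact (ENNReal.continuous_pow 2).comp hc2.enorm
            rw [lintegral_const_mul' _ _ ENNReal.ofReal_ne_top,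
              lintegral_lintegral_swap hm.aemeasurable]
        _ ≤ ENNReal.ofReal (l * d ^ 2) *
            ∫⁻ s in Icc 0 l, ENNReal.ofReal (2 ^ finrank ℝ E) * I := by
            refine mul_le_mul' le_rfl ?_
            apply setLIntegral_mono' measurableSet_Icc
            intro s hs
            refine (setLIntegral_comp_segment_le (μ := μ) hD hDm
              (fun x => ‖fderiv ℝ w x‖ₑ ^ 2)
              (((ENNReal.continuous_pow 2).comp hfc.enorm).measurable) (s := 1 - s) (t := s)
              (by linarith [hs.2]) hs.1 (by ring) hy).trans ?_
            gcongr
            rw [← inv_pow]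
            gcongr
            · rw [inv_nonneg]; linarith [hs.2]
            · rw [inv_le_comm₀ (by linarith [hs.2]) (by norm_num)]; linarith [hs.2]
        _ = _ := by
            simp only [lintegral_const, Measure.restrict_apply_univ, Real.volume_Icc, sub_zero]
            have e : ENNReal.ofReal (d ^ 2 * l ^ 2 * 2 ^ finrank ℝ E) = ENNReal.ofReal (l * d ^ 2) *
                ENNReal.ofReal (2 ^ finrank ℝ E) * ENNReal.ofReal l := by
              rw [← ENNReal.ofReal_mul (by positivity), ← ENNReal.ofReal_mul (by positivity)]
              ring_nf
            rw [e]
            ring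
    rw [lintegral_lintegral_swap (by fun_prop)]
    calc _ ≤ ∫⁻ y in D, ENNReal.ofReal (d ^ 2 * l ^ 2 * 2 ^ finrank ℝ E) * I ∂μ :=
          setLIntegral_mono' hDm hin
      _ = _ := by simp [mul_comm]
  calc ∫⁻ x in D, ‖w x‖ₑ ^ 2 ∂μ
      ≤ ∫⁻ x in D, (2 * (μ D)⁻¹ * ∫⁻ y in D, ‖w ((1 - l) • x + l • y) - w x‖ₑ ^ 2 ∂μ +
          2 * ((μ D)⁻¹ * J) ^ 2) ∂μ := setLIntegral_mono' hDm hpt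
    _ = 2 * (μ D)⁻¹ * ∫⁻ x in D, ∫⁻ y in D, ‖w ((1 - l) • x + l • y) - w x‖ₑ ^ 2 ∂μ ∂μ +
          2 * ((μ D)⁻¹ * J) ^ 2 * μ D := by
        have : 2 * (μ D)⁻¹ ≠ ⊤ := ENNReal.mul_ne_top (by simp) (by simp [hD0])
        rw [lintegral_add_right _ measurable_const, lintegral_const_mul' _ _ this]
        simp
    _ ≤ 2 * (μ D)⁻¹ * (μ D * (ENNReal.ofReal (d ^ 2 * l ^ 2 * 2 ^ finrank ℝ E) * I)) +
          2 * ((μ D)⁻¹ * J) ^ 2 * μ D := by gcongr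
    _ = 2 * ((μ D)⁻¹ * μ D) * ENNReal.ofReal (d ^ 2 * l ^ 2 * 2 ^ finrank ℝ E) * I +
          2 * (μ D)⁻¹ * ((μ D)⁻¹ * μ D) * J ^ 2 := by ring
    _ = _ := by
        rw [ENNReal.inv_mul_cancel hD0 hDt, mul_one, mul_one,
          show 2 * d ^ 2 * l ^ 2 * 2 ^ finrank ℝ E = 2 * (d ^ 2 * l ^ 2 * 2 ^ finrank ℝ E) by ring,
          ENNReal.ofReal_mul (by norm_num : (0 : ℝ) ≤ 2)]
        simp

end NashInequality

namespace AxisymNS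

/-! ### Geometry and measure of the cylinder. -/

section Geometry

theorem cylR_eq_norm (x : Space) : cylR x = ‖(⟨x 0, x 1⟩ : ℂ)‖ := by
  rw [cylR, Complex.norm_def, Complex.normSq_mk]; ring_nf

theorem cylR_nonneg (x : Space) : 0 ≤ cylR x := Real.sqrt_nonneg _

theorem cylR_sq (x : Space) : cylR x ^ 2 = x 0 ^ 2 + x 1 ^ 2 := Real.sq_sqrt (by positivity)

theorem continuous_cylR : Continuous cylR := by unfold cylR; fun_prop

theorem isOpen_cyl (R a : ℝ) : IsOpen (cyl R a) := by
  have h1 : Continuous fun x : Space => |x 2| := by fun_prop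
  exact (isOpen_lt continuous_cylR continuous_const).inter (isOpen_lt h1 continuous_const)

theorem convex_cyl (R a : ℝ) : Convex ℝ (cyl R a) := by
  intro x hx y hy s t hs ht hst
  have key : ∀ {p q M : ℝ}, p < M → q < M → s * p + t * q < M := by
    intro p q M hp hq
    rcases hs.eq_or_lt with rfl | hs'
    · obtain rfl : t = 1 := by linarith
      linarith
    · calc s * p + t * q < s * M + t * M := by nlinarith
        _ = M := by rw [← add_mul, hst, one_mul]
  constructor
  · refine lt_of_le_of_lt ?_ (key hx.1 hy.1)
    rw [cylR_eq_norm, cylR_eq_norm, cylR_eq_norm]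
    have : (⟨(s • x + t • y) 0, (s • x + t • y) 1⟩ : ℂ) =
        (s : ℂ) * ⟨x 0, x 1⟩ + (t : ℂ) * ⟨y 0, y 1⟩ := by
      apply Complex.ext <;> simp
    rw [this]
    refine (norm_add_le _ _).trans ?_
    simp [abs_of_nonneg hs, abs_of_nonneg ht]
  · refine lt_of_le_of_lt ?_ (key hx.2 hy.2)
    simp only [PiLp.add_apply, PiLp.smul_apply, smul_eq_mul]
    refine (abs_add_le _ _).trans ?_
    rw [abs_mul, abs_mul, abs_of_nonneg hs, abs_of_nonneg ht]

theorem norm_le_of_mem_cyl {R a : ℝ} {x : Space} (hx : x ∈ cyl R a) : ‖x‖ ≤ R + a := by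
  have h1 := cylR_sq x
  have h2 := hx.1
  have h3 := hx.2
  have h0 := cylR_nonneg x
  have ha : 0 < a := (abs_nonneg _).trans_lt h3
  rw [EuclideanSpace.norm_eq, Fin.sum_univ_three]
  simp only [Real.norm_eq_abs, sq_abs]
  apply Real.sqrt_le_iff.2 ⟨by linarith, ?_⟩
  have h4 : x 2 ^ 2 ≤ a ^ 2 := by
    rw [← sq_abs]; exact pow_le_pow_left₀ (abs_nonneg _) h3.le 2
  nlinarith

theorem isBounded_cyl (R a : ℝ) : Bornology.IsBounded (cyl R a) :=
  isBounded_iff_forall_norm_le.2 ⟨R + a, fun _ => norm_le_of_mem_cyl⟩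

theorem zero_mem_cyl {R a : ℝ} (hR : 0 < R) (ha : 0 < a) : (0 : Space) ∈ cyl R a := by
  simp [cyl, cylR, hR, ha]

theorem isOpen_cylT (R a T : ℝ) : IsOpen (cylT R a T) := (isOpen_cyl R a).prod isOpen_Ioo

theorem convex_cylT (R a T : ℝ) : Convex ℝ (cylT R a T) := (convex_cyl R a).prod (convex_Ioo 0 T)

theorem isBounded_cylT (R a T : ℝ) : Bornology.IsBounded (cylT R a T) :=
  (isBounded_cyl R a).prod (Metric.isBounded_Ioo 0 T)

theorem nonempty_cylT {R a T : ℝ} (hR : 0 < R) (ha : 0 < a) (hT : 0 < T) :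
    (cylT R a T).Nonempty := ⟨(0, T / 2), zero_mem_cyl hR ha, by constructor <;> simp <;> linarith⟩

theorem measurableSet_cyl (R a : ℝ) : MeasurableSet (cyl R a) := (isOpen_cyl R a).measurableSet

theorem measurableSet_cylT (R a T : ℝ) : MeasurableSet (cylT R a T) :=
  (isOpen_cylT R a T).measurableSet

theorem muT_eq_prod (R a T : ℝ) : muT R a T = (muX R a).prod (volume.restrict (Ioo 0 T)) := by
  rw [muT, muX, cylT, Measure.prod_restrict, Measure.volume_eq_prod]

instance isFiniteMeasure_muT (R a T : ℝ) : IsFiniteMeasure (muT R a T) :=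
  ⟨by rw [muT, Measure.restrict_apply_univ]; exact (isBounded_cylT R a T).measure_lt_top⟩

instance isFiniteMeasure_muX (R a : ℝ) : IsFiniteMeasure (muX R a) :=
  ⟨by rw [muX, Measure.restrict_apply_univ]; exact (isBounded_cyl R a).measure_lt_top⟩

end Geometry

/-! ### Smooth approximation of Sobolev functions on convex sets. -/

section Approximation

instance isAddHaarMeasure_spaceTime : (volume : Measure SpaceTime).IsAddHaarMeasure :=
  inferInstanceAs ((volume : Measure Space).prod (volume : Measure ℝ)).IsAddHaarMeasure

theorem HasWeakDeriv.congr {U : Set SpaceTime} {e : SpaceTime} {w w' z z' : SpaceTime → ℝ}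
    (h : HasWeakDeriv U e w w') (hz : z =ᵐ[volume.restrict U] w)
    (hz' : z' =ᵐ[volume.restrict U] w') (hzi : LocallyIntegrableOn z U)
    (hzi' : LocallyIntegrableOn z' U) : HasWeakDeriv U e z z' := by
  refine ⟨hzi, hzi', fun φ h1 h2 h3 => ?_⟩
  have e1 : ∫ y in U, z y * fderiv ℝ φ y e = ∫ y in U, w y * fderiv ℝ φ y e :=
    integral_congr_ae (by filter_upwards [hz] with y hy; rw [hy])
  have e2 : ∫ y in U, z' y * φ y = ∫ y in U, w' y * φ y :=
    integral_congr_ae (by filter_upwards [hz'] with y hy; rw [hy])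
  rw [e1, e2]
  exact h.2.2 φ h1 h2 h3

/-- For `x ∈ D` the kernel is a test function in `D`, so the derivative passes to `w'`. The factor
`1 - l` remains from the contraction of the argument. -/
theorem fderiv_smoothAvg_of_hasWeakDeriv {D : Set SpaceTime} (hDm : MeasurableSet D)
    (hDc : Convex ℝ D) {ρ : SpaceTime → ℝ} (hρ : ContDiff ℝ ∞ ρ) (hρc : HasCompactSupport ρ)
    (hρD : tsupport ρ ⊆ D) {l : ℝ} (hl : 0 < l) (hl1 : l ≤ 1) {e : SpaceTime}
    {w w' : SpaceTime → ℝ} (hw : HasWeakDeriv D e w w')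
    (hwi : LocallyIntegrable (D.indicator w)) {x : SpaceTime} (hx : x ∈ D) :
    fderiv ℝ (smoothAvg volume ρ l (D.indicator w)) x e =
      (1 - l) * smoothAvg volume ρ l (D.indicator w') x := by
  rw [fderiv_smoothAvg hρ hρc hl hwi, smoothAvg_eq_integral ρ hl]
  have h1 : ∀ (k : SpaceTime → ℝ) (h : SpaceTime → ℝ),
      ∫ z, D.indicator h z * k z = ∫ z in D, h z * k z := by
    intro k h
    rw [← integral_indicator hDm]
    congr 1; ext z
    by_cases hz : z ∈ D <;> simp [hz]
  rw [h1 (fun z => fderiv ℝ (fun z => avgKernel ρ l ((1 - l) • x - z)) z e),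
    h1 (fun z => avgKernel ρ l ((1 - l) • x - z)), hw.2.2 (fun z => avgKernel ρ l ((1 - l) • x - z))
      ((contDiff_avgKernel hρ l).comp (contDiff_const.sub contDiff_id))
      (hasCompactSupport_avgKernel_sub hρc hl x)
      (tsupport_avgKernel_sub_subset hρc hDc hρD hl hl1 hx)]
  ring

/-- On a bounded convex open set, a function in `L²` is approximated by smooth functions on the
whole space, together with all its weak derivatives that belong to `L²`. -/
theorem exists_smooth_approx {D : Set SpaceTime} (hDo : IsOpen D) (hDc : Convex ℝ D)
    (hDb : Bornology.IsBounded D) (hne : D.Nonempty) {ι : Type*} (e : ι → SpaceTime)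
    {u : SpaceTime → ℝ} {Du : ι → SpaceTime → ℝ} (hu : MemLp u 2 (volume.restrict D))
    (hDu : ∀ i, MemLp (Du i) 2 (volume.restrict D)) (hw : ∀ i, HasWeakDeriv D (e i) u (Du i)) :
    ∃ U : ℕ → SpaceTime → ℝ, (∀ n, ContDiff ℝ ∞ (U n)) ∧
      Tendsto (fun n => eLpNorm (fun y => U n y - u y) 2 (volume.restrict D)) atTop (𝓝 0) ∧
      (∀ i, Tendsto (fun n => eLpNorm (fun y => fderiv ℝ (U n) y (e i) - Du i y) 2
        (volume.restrict D)) atTop (𝓝 0)) ∧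
      ∀ᵐ y ∂(volume.restrict D), Tendsto (fun n => U n y) atTop (𝓝 (u y)) := by
  have hDm := hDo.measurableSet
  have : IsFiniteMeasure (volume.restrict D) :=
    ⟨by rw [Measure.restrict_apply_univ]; exact hDb.measure_lt_top⟩
  obtain ⟨c, hc⟩ := hne
  obtain ⟨r, hr, hrD⟩ := Metric.nhds_basis_closedBall.mem_iff.1 (hDo.mem_nhds hc)
  let f : ContDiffBump c := ⟨r / 2, r, by linarith, by linarith⟩
  set ρ : SpaceTime → ℝ := f.normed volume
  have hρ : ContDiff ℝ ∞ ρ := f.contDiff_normed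
  have hρc : HasCompactSupport ρ := f.hasCompactSupport_normed
  have hρD : tsupport ρ ⊆ D := by rw [f.tsupport_normed_eq]; exact hrD
  have hρ0 : ∀ y, 0 ≤ ρ y := f.nonneg_normed
  have hρ1 : ∫ y, ρ y = 1 := f.integral_normed
  -- measurable representatives
  have hrep : ∀ h : SpaceTime → ℝ, MemLp h 2 (volume.restrict D) →
      ∃ g : SpaceTime → ℝ, Measurable g ∧ g =ᵐ[volume.restrict D] h ∧
        MemLp (D.indicator g) 2 volume := by
    intro h hh
    refine ⟨hh.1.mk h, hh.1.stronglyMeasurable_mk.measurable, hh.1.ae_eq_mk.symm, ?_⟩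
    rw [memLp_indicator_iff_restrict hDm]
    exact (memLp_congr_ae hh.1.ae_eq_mk).1 hh
  obtain ⟨g, hgm, hge, hgL⟩ := hrep u hu
  choose G hGm hGe hGL using fun i => hrep (Du i) (hDu i)
  have hloc : ∀ {g h : SpaceTime → ℝ}, MemLp h 2 (volume.restrict D) →
      g =ᵐ[volume.restrict D] h → LocallyIntegrableOn g D := by
    intro g h hh hgh
    have h1 : IntegrableOn h D := hh.integrable (by norm_num)
    have h2 : IntegrableOn g D := h1.congr hgh.symm
    exact h2.locallyIntegrableOn
  have hwG : ∀ i, HasWeakDeriv D (e i) g (G i) := fun i =>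
    (hw i).congr hge (hGe i) (hloc hu hge) (hloc (hDu i) (hGe i))
  set l : ℕ → ℝ := fun n => 1 / ((n : ℝ) + 2)
  have hl0 : ∀ n, 0 < l n := fun n => by positivity
  have hl1 : ∀ n, l n ≤ 1 / 2 := fun n => by
    apply one_div_le_one_div_of_le (by norm_num); linarith [n.cast_nonneg (α := ℝ)]
  have hl : Tendsto l atTop (𝓝 0) :=
    tendsto_const_nhds.div_atTop (tendsto_atTop_add_const_right _ _ tendsto_natCast_atTop_atTop)
  have hconv : ∀ h : SpaceTime → ℝ, Measurable h → MemLp (D.indicator h) 2 volume →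
      Tendsto (fun n => eLpNorm (fun x => smoothAvg volume ρ (l n) (D.indicator h) x - h x) 2
        (volume.restrict D)) atTop (𝓝 0) := by
    intro h hm hL
    refine (tendsto_eLpNorm_smoothAvg_sub hρ hρc hρ0 hρ1 hL (hm.indicator hDm) hDm hDb hl0 hl1
      hl).congr fun n => ?_
    apply eLpNorm_congr_ae
    filter_upwards [ae_restrict_mem hDm] with x hx
    rw [indicator_of_mem hx]
  have hgloc : LocallyIntegrable (D.indicator g) := hgL.locallyIntegrable (by norm_num)
  have hsm : ∀ n, ContDiff ℝ ∞ (smoothAvg volume ρ (l n) (D.indicator g)) := fun n =>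
    contDiff_smoothAvg hρ hρc (hl0 n) hgloc
  have hU : Tendsto (fun n => eLpNorm (fun y => smoothAvg volume ρ (l n) (D.indicator g) y - u y) 2
      (volume.restrict D)) atTop (𝓝 0) := by
    refine (hconv g hgm hgL).congr fun n => eLpNorm_congr_ae ?_
    filter_upwards [hge] with y hy
    rw [hy]
  have hDU : ∀ i, Tendsto (fun n => eLpNorm (fun y =>
      fderiv ℝ (smoothAvg volume ρ (l n) (D.indicator g)) y (e i) - Du i y) 2
        (volume.restrict D)) atTop (𝓝 0) := by
    intro i
    have hlim : Tendsto (fun n => eLpNorm (fun x => smoothAvg volume ρ (l n) (D.indicator (G i)) x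
        - G i x) 2 (volume.restrict D) + ENNReal.ofReal (l n) *
          eLpNorm (G i) 2 (volume.restrict D)) atTop (𝓝 (0 + ENNReal.ofReal 0 *
          eLpNorm (G i) 2 (volume.restrict D))) := by
      refine (hconv (G i) (hGm i) (hGL i)).add ?_
      refine ENNReal.Tendsto.mul_const ((ENNReal.continuous_ofReal.tendsto 0).comp hl) (Or.inr ?_)
      rw [eLpNorm_congr_ae (hGe i)]
      exact (hDu i).2.ne
    simp only [ENNReal.ofReal_zero, zero_mul, add_zero] at hlim
    refine tendsto_of_tendsto_of_tendsto_of_le_of_le tendsto_const_nhds hlim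
      (fun _ => bot_le) fun n => ?_
    have hGloc : LocallyIntegrable (D.indicator (G i)) := (hGL i).locallyIntegrable (by norm_num)
    have hm : AEStronglyMeasurable (fun x => smoothAvg volume ρ (l n) (D.indicator (G i)) x
        - G i x) (volume.restrict D) :=
      (contDiff_smoothAvg hρ hρc (hl0 n) hGloc).continuous.aestronglyMeasurable.sub
        (hGm i).aestronglyMeasurable
    -- The error is `(1-l)` times the averaging error of the weak derivative, minus `l` times the
    -- derivative itself; both tend to zero in `L²`.
    have heq : (fun y => fderiv ℝ (smoothAvg volume ρ (l n) (D.indicator g)) y (e i) - Du i y)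
        =ᵐ[volume.restrict D] (1 - l n) • (fun x => smoothAvg volume ρ (l n)
          (D.indicator (G i)) x - G i x) - l n • G i := by
      filter_upwards [ae_restrict_mem hDm, hGe i] with y hy hGy
      rw [fderiv_smoothAvg_of_hasWeakDeriv hDm hDc hρ hρc hρD (hl0 n) (by linarith [hl1 n])
        (hwG i) hgloc hy, ← hGy]
      simp only [Pi.sub_apply, Pi.smul_apply, smul_eq_mul]
      ring
    dsimp only
    rw [eLpNorm_congr_ae heq]
    refine (eLpNorm_sub_le (hm.const_smul _) ((hGm i).aestronglyMeasurable.const_smul _)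
      (by norm_num)).trans ?_
    rw [eLpNorm_const_smul, eLpNorm_const_smul]
    gcongr ?_ + ?_
    · refine mul_le_of_le_one_left bot_le ?_
      rw [Real.enorm_of_nonneg (by linarith [hl1 n])]
      exact ENNReal.ofReal_le_one.2 (by linarith [hl0 n])
    · rw [Real.enorm_of_nonneg (hl0 n).le]
  -- Almost everywhere convergence holds only along a subsequence, which keeps the norm
  -- convergences.
  have hmeas := tendstoInMeasure_of_tendsto_eLpNorm (μ := volume.restrict D) (p := 2)
    (f := fun n => smoothAvg volume ρ (l n) (D.indicator g)) (g := u) (by norm_num)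
    (fun n => (hsm n).continuous.aestronglyMeasurable) hu.1 hU
  obtain ⟨ns, hns, hae⟩ := hmeas.exists_seq_tendsto_ae
  exact ⟨fun n => smoothAvg volume ρ (l (ns n)) (D.indicator g), fun n => hsm (ns n),
    hU.comp hns.tendsto_atTop, fun i => (hDU i).comp hns.tendsto_atTop, hae⟩

end Approximation

/-! ### The interpolation inequality on time slices, integrated in time. -/

section Slices

theorem enorm_sq_eq_ofReal (r : ℝ) : ‖r‖ₑ ^ 2 = ENNReal.ofReal (r ^ 2) := by
  rw [← ofReal_norm, ← ENNReal.ofReal_pow (norm_nonneg _), Real.norm_eq_abs, sq_abs]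

theorem enorm_sq_fderiv_slice_le {W : SpaceTime → ℝ} (hW : ContDiff ℝ ∞ W) (x : Space) (t : ℝ) :
    ‖fderiv ℝ (fun x : Space => W (x, t)) x‖ₑ ^ 2 ≤
      ∑ j, ‖fderiv ℝ W (x, t) (dirX j)‖ₑ ^ 2 := by
  have h1 : ∀ z : Space, fderiv ℝ (fun x : Space => W (x, t)) x z = fderiv ℝ W (x, t) (z, 0) := by
    intro z
    have h2 : HasFDerivAt (fun x : Space => (x, t)) (ContinuousLinearMap.inl ℝ Space ℝ) x :=
      hasFDerivAt_prodMk_left x t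
    have h3 := ((hW.differentiable (by norm_num)) (x, t)).hasFDerivAt.comp x h2
    have h4 : fderiv ℝ (fun x : Space => W (x, t)) x =
      (fderiv ℝ W (x, t)).comp (ContinuousLinearMap.inl ℝ Space ℝ) := h3.fderiv
    rw [h4]; simp
  have h2 : ‖fderiv ℝ (fun x : Space => W (x, t)) x‖ ≤
      Real.sqrt (∑ j, fderiv ℝ W (x, t) (dirX j) ^ 2) := by
    refine ContinuousLinearMap.opNorm_le_bound _ (Real.sqrt_nonneg _) fun z => ?_
    have hz : ((z, 0) : SpaceTime) = ∑ j, z j • dirX j := by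
      refine Prod.ext ?_ ?_
      · ext i
        simp [dirX, Prod.fst_sum, Finset.sum_apply, Pi.single_apply]
      · simp [dirX, Prod.snd_sum]
    rw [h1, hz, map_sum, Real.norm_eq_abs, EuclideanSpace.norm_eq,
      ← Real.sqrt_mul (Finset.sum_nonneg fun _ _ => sq_nonneg _)]
    apply Real.abs_le_sqrt
    simp only [map_smul, smul_eq_mul, Real.norm_eq_abs, sq_abs]
    rw [mul_comm]
    exact Finset.sum_mul_sq_le_sq_mul_sq _ _ _
  simp only [enorm_sq_eq_ofReal]
  rw [← ofReal_norm, ← ENNReal.ofReal_pow (norm_nonneg _),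
    ← ENNReal.ofReal_sum_of_nonneg (fun _ _ => sq_nonneg _)]
  apply ENNReal.ofReal_le_ofReal
  calc _ ≤ Real.sqrt (∑ j, fderiv ℝ W (x, t) (dirX j) ^ 2) ^ 2 :=
        pow_le_pow_left₀ (norm_nonneg _) h2 2
    _ = _ := Real.sq_sqrt (Finset.sum_nonneg fun _ _ => sq_nonneg _)

/-- The constant in front of the gradient in the interpolation inequality on `Ω`. -/
def nashC₁ (R a : ℝ) : ℝ := 64 * (R + a) ^ 2

/-- The constant in front of the `L¹` norm in the interpolation inequality on `Ω`. -/
def nashC₂ (R a : ℝ) : ℝ := 2 / (volume (cyl R a)).toReal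

theorem volume_cyl_ne_zero {R a : ℝ} (hR : 0 < R) (ha : 0 < a) : volume (cyl R a) ≠ 0 :=
  ((isOpen_cyl R a).measure_pos volume ⟨0, zero_mem_cyl hR ha⟩).ne'

theorem volume_cyl_ne_top (R a : ℝ) : volume (cyl R a) ≠ ⊤ := (isBounded_cyl R a).measure_lt_top.ne

theorem nash_slice {R a : ℝ} (hR : 0 < R) (ha : 0 < a) {W : SpaceTime → ℝ} (hW : ContDiff ℝ ∞ W)
    (t : ℝ) {l : ℝ} (hl : 0 < l) (hl2 : l ≤ 1 / 2) :
    ∫⁻ x, ‖W (x, t)‖ₑ ^ 2 ∂(muX R a) ≤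
      ENNReal.ofReal (nashC₁ R a * l ^ 2) *
        ∫⁻ x, ∑ j, ‖fderiv ℝ W (x, t) (dirX j)‖ₑ ^ 2 ∂(muX R a) +
      ENNReal.ofReal (nashC₂ R a * (l ^ 6)⁻¹) * (∫⁻ x, ‖W (x, t)‖ₑ ∂(muX R a)) ^ 2 := by
  have hd : ∀ x ∈ cyl R a, ∀ y ∈ cyl R a, ‖y - x‖ ≤ 2 * (R + a) := by
    intro x hx y hy
    have := norm_sub_le y x
    have := norm_le_of_mem_cyl hx
    have := norm_le_of_mem_cyl hy
    linarith
  have hWt : ContDiff ℝ 1 fun x : Space => W (x, t) :=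
    (hW.comp (contDiff_prodMk_left t)).of_le (by norm_num)
  have h := lintegral_sq_le_of_convex (μ := volume) (convex_cyl R a) (measurableSet_cyl R a)
    (volume_cyl_ne_zero hR ha) (volume_cyl_ne_top R a) hd hWt hl hl2
  refine h.trans ?_
  have hfr : finrank ℝ Space = 3 := by simp [Space]
  rw [hfr]
  gcongr ?_ * ?_ + ?_
  -- The set `Ω` has diameter at most `d = 2(R + a)` and dimension three, so `2d²·2³ = 64(R + a)²`.
  -- The power `l⁻⁶` in the other term is the square of `l⁻³`.
  · apply le_of_eq
    congr 1
    rw [nashC₁]; ring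
  · exact lintegral_mono fun x => enorm_sq_fderiv_slice_le hW x t
  · rw [mul_pow, ← mul_assoc]
    apply mul_le_mul' _ le_rfl
    rw [nashC₂, ENNReal.ofReal_mul (by positivity), ENNReal.ofReal_div_of_pos
      (ENNReal.toReal_pos (volume_cyl_ne_zero hR ha) (volume_cyl_ne_top R a)),
      ENNReal.ofReal_toReal (volume_cyl_ne_top R a), ← ENNReal.ofReal_pow (by positivity),
      ← inv_pow, ← inv_pow, ← pow_mul, div_eq_mul_inv]
    simp

theorem lintegral_muT (R a T : ℝ) {f : SpaceTime → ℝ≥0∞} (hf : Measurable f) :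
    ∫⁻ y, f y ∂(muT R a T) = ∫⁻ t in Ioo 0 T, ∫⁻ x, f (x, t) ∂(muX R a) := by
  rw [muT_eq_prod, lintegral_prod_symm _ hf.aemeasurable]

theorem nash_smooth {R a T : ℝ} (hR : 0 < R) (ha : 0 < a) {W : SpaceTime → ℝ}
    (hW : ContDiff ℝ ∞ W) {l : ℝ} (hl : 0 < l) (hl2 : l ≤ 1 / 2) :
    ∫⁻ y, ‖W y‖ₑ ^ 2 ∂(muT R a T) ≤
      ENNReal.ofReal (nashC₁ R a * l ^ 2) *
        ∫⁻ y, ∑ j, ‖fderiv ℝ W y (dirX j)‖ₑ ^ 2 ∂(muT R a T) +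
      ENNReal.ofReal (nashC₂ R a * (l ^ 6)⁻¹) *
        ∫⁻ t in Ioo 0 T, (∫⁻ x, ‖W (x, t)‖ₑ ∂(muX R a)) ^ 2 := by
  have hWm := hW.continuous.measurable
  have hDm : ∀ j, Measurable fun y => fderiv ℝ W y (dirX j) := fun j =>
    ((hW.continuous_fderiv (by norm_num)).clm_apply continuous_const).measurable
  have hm : Measurable fun y => ∑ j, ‖fderiv ℝ W y (dirX j)‖ₑ ^ 2 := by fun_prop
  rw [lintegral_muT R a T (by fun_prop), lintegral_muT R a T hm,
    ← lintegral_const_mul' _ _ ENNReal.ofReal_ne_top,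
    ← lintegral_const_mul' _ _ ENNReal.ofReal_ne_top, ← lintegral_add_left]
  · exact lintegral_mono fun t => nash_slice hR ha hW t hl hl2
  · apply Measurable.const_mul
    exact Measurable.lintegral_prod_left' hm

theorem enorm_sq_le_two_mul (p q : ℝ) : ‖p‖ₑ ^ 2 ≤ 2 * ‖q‖ₑ ^ 2 + 2 * ‖p - q‖ₑ ^ 2 := by
  simp only [enorm_sq_eq_ofReal]
  rw [show (2 : ℝ≥0∞) = ENNReal.ofReal 2 by simp, ← ENNReal.ofReal_mul (by norm_num),
    ← ENNReal.ofReal_mul (by norm_num), ← ENNReal.ofReal_add (by positivity) (by positivity)]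
  apply ENNReal.ofReal_le_ofReal
  nlinarith [sq_nonneg (p - 2 * q)]

theorem add_sq_le_two_mul (p q : ℝ≥0∞) : (p + q) ^ 2 ≤ 2 * p ^ 2 + 2 * q ^ 2 := by
  have := ENNReal.rpow_add_le_mul_rpow_add_rpow p q (p := 2) (by norm_num)
  norm_num [mul_add] at this
  exact this

/-- Cauchy–Schwarz on the slices, which have finite volume. It makes the `L²(0,T; L¹(Ω))` term
stable, up to a factor 2, under convergence in `L²(Ω^T)`. -/
theorem lintegral_sq_lintegral_le {R a T : ℝ} {f g : SpaceTime → ℝ} (hf : Measurable f)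
    (hg : Measurable g) :
    ∫⁻ t in Ioo 0 T, (∫⁻ x, ‖f (x, t)‖ₑ ∂(muX R a)) ^ 2 ≤
      2 * (∫⁻ t in Ioo 0 T, (∫⁻ x, ‖g (x, t)‖ₑ ∂(muX R a)) ^ 2) +
      2 * volume (cyl R a) * ∫⁻ y, ‖f y - g y‖ₑ ^ 2 ∂(muT R a T) := by
  have hm : Measurable fun t : ℝ => ∫⁻ x, ‖g (x, t)‖ₑ ∂(muX R a) :=
    Measurable.lintegral_prod_left' (f := fun y : SpaceTime => ‖g y‖ₑ) (by fun_prop)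
  rw [lintegral_muT R a T (by fun_prop), ← lintegral_const_mul' _ _ (by simp),
    ← lintegral_const_mul' _ _ (ENNReal.mul_ne_top (by simp) (volume_cyl_ne_top R a)),
    ← lintegral_add_left (by fun_prop)]
  apply lintegral_mono
  intro t
  have hgt : Measurable fun x : Space => ‖g (x, t)‖ₑ := by fun_prop
  calc (∫⁻ x, ‖f (x, t)‖ₑ ∂(muX R a)) ^ 2
      ≤ (∫⁻ x, ‖g (x, t)‖ₑ ∂(muX R a) + ∫⁻ x, ‖f (x, t) - g (x, t)‖ₑ ∂(muX R a)) ^ 2 := by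
        rw [← lintegral_add_left hgt]
        gcongr with x
        have := enorm_add_le (g (x, t)) (f (x, t) - g (x, t))
        rwa [add_sub_cancel] at this
    _ ≤ 2 * (∫⁻ x, ‖g (x, t)‖ₑ ∂(muX R a)) ^ 2 +
        2 * (∫⁻ x, ‖f (x, t) - g (x, t)‖ₑ ∂(muX R a)) ^ 2 := add_sq_le_two_mul _ _
    _ ≤ _ := by
        dsimp only
        rw [mul_assoc 2 (volume (cyl R a))]
        gcongr
        have := sq_lintegral_le (muX R a) (f := fun x => ‖f (x, t) - g (x, t)‖ₑ) (by fun_prop)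
        rwa [muX, Measure.restrict_apply_univ] at this

/-- The interpolation inequality for limits of smooth functions. -/
theorem nash_of_tendsto {R a T : ℝ} (hR : 0 < R) (ha : 0 < a) {W : SpaceTime → ℝ}
    {DW : Fin 3 → SpaceTime → ℝ} (hWm : Measurable W) (hDWm : ∀ j, Measurable (DW j))
    {U : ℕ → SpaceTime → ℝ} (hU : ∀ n, ContDiff ℝ ∞ (U n))
    (hUW : Tendsto (fun n => eLpNorm (fun y => U n y - W y) 2 (muT R a T)) atTop (𝓝 0))
    (hDU : ∀ j, Tendsto (fun n => eLpNorm (fun y => fderiv ℝ (U n) y (dirX j) - DW j y) 2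
      (muT R a T)) atTop (𝓝 0))
    {l : ℝ} (hl : 0 < l) (hl2 : l ≤ 1 / 2) :
    ∫⁻ y, ‖W y‖ₑ ^ 2 ∂(muT R a T) ≤
      4 * ENNReal.ofReal (nashC₁ R a * l ^ 2) * ∫⁻ y, ∑ j, ‖DW j y‖ₑ ^ 2 ∂(muT R a T) +
      4 * ENNReal.ofReal (nashC₂ R a * (l ^ 6)⁻¹) *
        ∫⁻ t in Ioo 0 T, (∫⁻ x, ‖W (x, t)‖ₑ ∂(muX R a)) ^ 2 := by
  set A := ENNReal.ofReal (nashC₁ R a * l ^ 2)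
  set B := ENNReal.ofReal (nashC₂ R a * (l ^ 6)⁻¹)
  set V := volume (cyl R a)
  set I := ∫⁻ y, ∑ j, ‖DW j y‖ₑ ^ 2 ∂(muT R a T)
  set J := ∫⁻ t in Ioo 0 T, (∫⁻ x, ‖W (x, t)‖ₑ ∂(muX R a)) ^ 2
  have hUm : ∀ n, Measurable (U n) := fun n => (hU n).continuous.measurable
  have hDUm : ∀ n j, Measurable fun y => fderiv ℝ (U n) y (dirX j) := fun n j =>
    (((hU n).continuous_fderiv (by norm_num)).clm_apply continuous_const).measurable
  -- The factor 4 arises from using `(p+q)² ≤ 2p² + 2q²` twice, once to pass from `W` to `U n` and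
  -- once to return. The last bracket tends to zero.
  have hn : ∀ n, ∫⁻ y, ‖W y‖ₑ ^ 2 ∂(muT R a T) ≤ (4 * A * I + 4 * B * J) +
      ((2 + 4 * B * V) * eLpNorm (fun y => U n y - W y) 2 (muT R a T) ^ 2 +
      4 * A * ∑ j, eLpNorm (fun y => fderiv ℝ (U n) y (dirX j) - DW j y) 2 (muT R a T) ^ 2) := by
    intro n
    have h1 : ∫⁻ y, ‖W y‖ₑ ^ 2 ∂(muT R a T) ≤ 2 * ∫⁻ y, ‖U n y‖ₑ ^ 2 ∂(muT R a T) +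
        2 * eLpNorm (fun y => U n y - W y) 2 (muT R a T) ^ 2 := by
      rw [eLpNorm_two_sq, ← lintegral_const_mul' _ _ (by simp),
        ← lintegral_const_mul' _ _ (by simp),
        ← lintegral_add_left (by have := hUm n; fun_prop)]
      apply lintegral_mono
      intro y
      have := enorm_sq_le_two_mul (W y) (U n y)
      rwa [enorm_sub_rev] at this
    have h2 : ∫⁻ y, ∑ j, ‖fderiv ℝ (U n) y (dirX j)‖ₑ ^ 2 ∂(muT R a T) ≤ 2 * I +
        2 * ∑ j, eLpNorm (fun y => fderiv ℝ (U n) y (dirX j) - DW j y) 2 (muT R a T) ^ 2 := by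
      simp only [eLpNorm_two_sq, I]
      rw [← lintegral_finsetSum _ (by have := hDUm n; fun_prop),
        ← lintegral_const_mul' _ _ (by simp), ← lintegral_const_mul' _ _ (by simp),
        ← lintegral_add_left (by fun_prop)]
      apply lintegral_mono
      intro y
      simp only [Finset.mul_sum, ← Finset.sum_add_distrib]
      exact Finset.sum_le_sum fun j _ => enorm_sq_le_two_mul _ _
    have h3 := lintegral_sq_lintegral_le (R := R) (a := a) (T := T) (hUm n) hWm
    rw [← eLpNorm_two_sq (fun y => U n y - W y)] at h3
    calc _ ≤ 2 * ∫⁻ y, ‖U n y‖ₑ ^ 2 ∂(muT R a T) +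
          2 * eLpNorm (fun y => U n y - W y) 2 (muT R a T) ^ 2 := h1
      _ ≤ 2 * (A * ∫⁻ y, ∑ j, ‖fderiv ℝ (U n) y (dirX j)‖ₑ ^ 2 ∂(muT R a T) +
          B * ∫⁻ t in Ioo 0 T, (∫⁻ x, ‖U n (x, t)‖ₑ ∂(muX R a)) ^ 2) +
          2 * eLpNorm (fun y => U n y - W y) 2 (muT R a T) ^ 2 := by
        gcongr
        exact nash_smooth hR ha (hU n) hl hl2
      _ ≤ 2 * (A * (2 * I +
          2 * ∑ j, eLpNorm (fun y => fderiv ℝ (U n) y (dirX j) - DW j y) 2 (muT R a T) ^ 2) +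
          B * (2 * J + 2 * V * eLpNorm (fun y => U n y - W y) 2 (muT R a T) ^ 2)) +
          2 * eLpNorm (fun y => U n y - W y) 2 (muT R a T) ^ 2 := by gcongr
      _ = _ := by ring
  have hV : V ≠ ⊤ := volume_cyl_ne_top R a
  have hlim : Tendsto (fun n => (4 * A * I + 4 * B * J) +
      ((2 + 4 * B * V) * eLpNorm (fun y => U n y - W y) 2 (muT R a T) ^ 2 +
      4 * A * ∑ j, eLpNorm (fun y => fderiv ℝ (U n) y (dirX j) - DW j y) 2 (muT R a T) ^ 2))
      atTop (𝓝 ((4 * A * I + 4 * B * J) + ((2 + 4 * B * V) * 0 ^ 2 +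
        4 * A * ∑ _j : Fin 3, 0 ^ 2))) := by
    refine tendsto_const_nhds.add (Tendsto.add ?_ ?_)
    · refine ENNReal.Tendsto.const_mul (ENNReal.Tendsto.pow hUW) (Or.inr ?_)
      exact ENNReal.add_ne_top.2 ⟨by simp, ENNReal.mul_ne_top
        (ENNReal.mul_ne_top (by simp) ENNReal.ofReal_ne_top) hV⟩
    · refine ENNReal.Tendsto.const_mul (tendsto_finsetSum _ fun j _ => ENNReal.Tendsto.pow (hDU j)) (Or.inr ?_)
      exact ENNReal.mul_ne_top (by simp) ENNReal.ofReal_ne_top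
  simp only [ne_eq, OfNat.ofNat_ne_zero, not_false_eq_true, zero_pow, mul_zero,
    Finset.sum_const_zero, add_zero] at hlim
  exact ge_of_tendsto' hlim hn

end Slices

/-- Passage to the limit in `∫ cₙ aₙ b`, where `cₙ` is bounded and converges almost everywhere
and `aₙ` converges in `L²`. -/
theorem tendsto_integral_mul_mul {α : Type*} [MeasurableSpace α] {μ : Measure α}
    {c : ℕ → α → ℝ} {c' : α → ℝ} {a : ℕ → α → ℝ} {a' b : α → ℝ} {C : ℝ}
    (hc : ∀ n, AEStronglyMeasurable (c n) μ) (hcb : ∀ n, ∀ᵐ x ∂μ, |c n x| ≤ C)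
    (hcl : ∀ᵐ x ∂μ, Tendsto (fun n => c n x) atTop (𝓝 (c' x)))
    (ha : ∀ n, AEStronglyMeasurable (a n) μ) (ha' : MemLp a' 2 μ) (hb : MemLp b 2 μ)
    (hal : Tendsto (fun n => eLpNorm (fun x => a n x - a' x) 2 μ) atTop (𝓝 0)) :
    Tendsto (fun n => ∫ x, c n x * a n x * b x ∂μ) atTop (𝓝 (∫ x, c' x * a' x * b x ∂μ)) := by
  have hab : Integrable (fun x => a' x * b x) μ := ha'.integrable_mul hb
  have h1 : Tendsto (fun n => ∫ x, c n x * (a' x * b x) ∂μ) atTop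
      (𝓝 (∫ x, c' x * (a' x * b x) ∂μ)) := by
    apply tendsto_integral_of_dominated_convergence (fun x => C * ‖a' x * b x‖)
    · exact fun n => (hc n).mul hab.1
    · exact hab.norm.const_mul C
    · intro n
      filter_upwards [hcb n] with x hx
      rw [norm_mul]
      exact mul_le_mul_of_nonneg_right hx (norm_nonneg _)
    · filter_upwards [hcl] with x hx
      exact hx.mul_const _
  -- The difference `a n - a'` is known to lie in `L²` only from some index on, where its norm is
  -- below one.
  have hev : ∀ᶠ n in atTop, MemLp (fun x => a n x - a' x) 2 μ := by
    filter_upwards [hal.eventually_lt_const (u := 1) (by norm_num)] with n hn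
    exact ⟨(ha n).sub ha'.1, hn.trans (by norm_num)⟩
  have h2 : Tendsto (fun n => ∫ x, c n x * ((a n x - a' x) * b x) ∂μ) atTop (𝓝 0) := by
    rw [tendsto_zero_iff_norm_tendsto_zero]
    have hlim : Tendsto (fun n => C * ((eLpNorm (fun x => a n x - a' x) 2 μ).toReal *
        (eLpNorm b 2 μ).toReal)) atTop (𝓝 (C * (0 * (eLpNorm b 2 μ).toReal))) := by
      refine ((Tendsto.mul_const _ ?_).const_mul C)
      exact (ENNReal.tendsto_toReal ENNReal.zero_ne_top).comp hal
    simp only [zero_mul, mul_zero] at hlim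
    refine tendsto_of_tendsto_of_tendsto_of_le_of_le' tendsto_const_nhds hlim
      (.of_forall fun _ => norm_nonneg _) ?_
    filter_upwards [hev] with n hn
    have hi : Integrable (fun x => (a n x - a' x) * b x) μ := hn.integrable_mul hb
    calc ‖∫ x, c n x * ((a n x - a' x) * b x) ∂μ‖
        ≤ ∫ x, C * ‖(a n x - a' x) * b x‖ ∂μ := by
          apply norm_integral_le_of_norm_le (hi.norm.const_mul C)
          filter_upwards [hcb n] with x hx
          rw [norm_mul]
          exact mul_le_mul_of_nonneg_right hx (norm_nonneg _)
      _ = C * (eLpNorm (fun x => (a n x - a' x) * b x) 1 μ).toReal := by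
          rw [integral_const_mul, eLpNorm_one_eq_lintegral_enorm, integral_norm_eq_lintegral_enorm hi.1]
      _ ≤ _ := by
          -- The sign of `C` is read off at a point where the bound `hcb` holds; such a point exists
          -- unless `μ = 0`.
          rcases eq_or_ne μ 0 with rfl | hμ
          · simp
          have : NeBot (ae μ) := ae_neBot.2 hμ
          have hC : 0 ≤ C := by
            obtain ⟨x, hx⟩ := (hcb n).exists
            exact (abs_nonneg _).trans hx
          rw [← ENNReal.toReal_mul]
          gcongr
          · exact ENNReal.mul_ne_top hn.2.ne hb.2.ne
          · have := eLpNorm_smul_le_mul_eLpNorm (p := 2) (q := 2) (r := 1) hb.1 hn.1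
            exact this
  have h3 := h1.add h2
  rw [add_zero] at h3
  simp only [mul_assoc]
  refine h3.congr' ?_
  filter_upwards [hev] with n hn
  have hi : Integrable (fun x => (a n x - a' x) * b x) μ := hn.integrable_mul hb
  rw [← integral_add (hab.bdd_mul (hc n) (hcb n)) (hi.bdd_mul (hc n) (hcb n))]
  congr 1; ext x; ring

end AxisymNS

namespace AxisymNS

/-! ### Rotations about the axis and the angular derivative in the weak sense. -/

section Rotation

theorem rotZ_neg_rotZ (θ : ℝ) (x : Space) : rotZ (-θ) (rotZ θ x) = x := by
  have h := Real.sin_sq_add_cos_sq θ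
  ext i
  fin_cases i
  · simp [rotZ]; linear_combination (x 0) * h
  · simp [rotZ]; linear_combination (x 1) * h
  · simp [rotZ]

theorem rotZ_rotZ_neg (θ : ℝ) (x : Space) : rotZ θ (rotZ (-θ) x) = x := by
  simpa using rotZ_neg_rotZ (-θ) x

theorem cylR_rotZ (θ : ℝ) (x : Space) : cylR (rotZ θ x) = cylR x := by
  have h := Real.sin_sq_add_cos_sq θ
  unfold cylR
  congr 1
  simp [rotZ]
  linear_combination (x 0 ^ 2 + x 1 ^ 2) * h

/-- The rotation about the `x₃`-axis as a linear isometry. -/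
def rotIso (θ : ℝ) : Space ≃ₗᵢ[ℝ] Space where
  toFun := rotZ θ
  map_add' x y := by
    ext i
    fin_cases i <;> simp [rotZ] <;> ring
  map_smul' c x := by
    ext i
    fin_cases i <;> simp [rotZ] <;> ring
  invFun := rotZ (-θ)
  left_inv := rotZ_neg_rotZ θ
  right_inv := rotZ_rotZ_neg θ
  norm_map' x := by
    have h := Real.sin_sq_add_cos_sq θ
    simp only [EuclideanSpace.norm_eq, Fin.sum_univ_three, Real.norm_eq_abs, sq_abs]
    congr 1
    simp [rotZ]
    linear_combination (x 0 ^ 2 + x 1 ^ 2) * h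

/-- The rotation of the space variable as a homeomorphism of space-time. -/
def rotT (θ : ℝ) : SpaceTime ≃ₜ SpaceTime :=
  (rotIso θ).toHomeomorph.prodCongr (Homeomorph.refl ℝ)

theorem rotT_apply (θ : ℝ) (y : SpaceTime) : rotT θ y = (rotZ θ y.1, y.2) := rfl

theorem rotT_neg_rotT (θ : ℝ) (y : SpaceTime) : rotT (-θ) (rotT θ y) = y := by
  simp [rotT_apply, rotZ_neg_rotZ]

theorem rotT_rotT_neg (θ : ℝ) (y : SpaceTime) : rotT θ (rotT (-θ) y) = y := by
  simp [rotT_apply, rotZ_rotZ_neg]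

theorem rotT_mem_cylT {R a T θ : ℝ} {y : SpaceTime} : rotT θ y ∈ cylT R a T ↔ y ∈ cylT R a T := by
  have h2 : rotZ θ y.1 2 = y.1 2 := by simp [rotZ]
  simp only [rotT_apply, cylT, cyl, mem_prod, mem_ofPred_eq, cylR_rotZ, h2]

theorem measurePreserving_rotT (R a T θ : ℝ) :
    MeasurePreserving (rotT θ) (muT R a T) (muT R a T) := by
  have h1 : MeasurePreserving (rotT θ) (volume : Measure SpaceTime) volume :=
    (rotIso θ).measurePreserving.prod (MeasurePreserving.id (volume : Measure ℝ))
  have h2 := h1.restrict_preimage (measurableSet_cylT R a T)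
  have h3 : rotT θ ⁻¹' cylT R a T = cylT R a T := by ext y; exact rotT_mem_cylT
  rwa [h3] at h2

theorem integral_comp_rotT (R a T θ : ℝ) (F : SpaceTime → ℝ) :
    ∫ y in cylT R a T, F (rotT θ y) = ∫ y in cylT R a T, F y :=
  (measurePreserving_rotT R a T θ).integral_comp (rotT θ).measurableEmbedding F

theorem contDiff_rotT_neg : ContDiff ℝ ∞ fun q : ℝ × SpaceTime => rotT (-q.1) q.2 := by
  have : (fun q : ℝ × SpaceTime => rotT (-q.1) q.2) = fun q : ℝ × SpaceTime =>
      ((!₂[Real.cos q.1 * q.2.1 0 + Real.sin q.1 * q.2.1 1,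
        -(Real.sin q.1 * q.2.1 0) + Real.cos q.1 * q.2.1 1, q.2.1 2] : Space), q.2.2) := by
    ext q <;> simp [rotT_apply, rotZ]
  rw [this]
  refine ContDiff.prodMk ?_ (by fun_prop)
  rw [contDiff_euclidean]
  intro i
  fin_cases i <;> simp <;> fun_prop

theorem hasDerivAt_rotT_neg_zero (y : SpaceTime) :
    HasDerivAt (fun θ : ℝ => rotT (-θ) y) (y.1 1 • dirX 0 - y.1 0 • dirX 1) 0 := by
  have h1 : HasDerivAt (fun θ : ℝ => rotZ (-θ) y.1) (!₂[y.1 1, -y.1 0, 0] : Space) 0 := by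
    have hc : HasDerivAt (fun θ : ℝ => Real.cos (-θ)) 0 0 := by
      have := (Real.hasDerivAt_cos (0 : ℝ))
      simpa using this
    have hs : HasDerivAt (fun θ : ℝ => Real.sin (-θ)) (-1) 0 := by
      have := (Real.hasDerivAt_sin (-0 : ℝ)).comp (0 : ℝ) (hasDerivAt_neg (0 : ℝ))
      simpa [Function.comp_def] using this
    rw [hasDerivAt_iff_hasFDerivAt, ← hasFDerivWithinAt_univ, hasFDerivWithinAt_euclidean]
    intro i
    rw [hasFDerivWithinAt_univ, hasFDerivAt_iff_hasDerivAt]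
    fin_cases i
    · have := (hc.mul_const (y.1 0)).fun_sub (hs.mul_const (y.1 1))
      simpa [rotZ] using this
    · have := (hs.mul_const (y.1 0)).fun_add (hc.mul_const (y.1 1))
      simpa [rotZ] using this
    · simpa [rotZ] using hasDerivAt_const (0 : ℝ) (y.1 2)
  have h2 := h1.prodMk (hasDerivAt_const (0 : ℝ) y.2)
  convert! h2 using 1
  refine Prod.ext ?_ (by simp [dirX])
  ext i
  fin_cases i <;> simp [dirX]

/-- Since `h` is only locally integrable, dominated differentiation needs one compact set `K` that
carries all the functions `Ψ (θ, ·)` with `|θ| ≤ 1`. -/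
theorem hasDerivAt_integral_mul_of_contDiff {D K : Set SpaceTime} {h : SpaceTime → ℝ}
    (hh : LocallyIntegrableOn h D) (hK : IsCompact K) (hKD : K ⊆ D) {Ψ : ℝ × SpaceTime → ℝ}
    (hΨ : ContDiff ℝ ∞ Ψ) (hout : ∀ y ∉ K, ∀ θ ∈ Icc (-1 : ℝ) 1, Ψ (θ, y) = 0) :
    HasDerivAt (fun θ : ℝ => ∫ y in D, h y * Ψ (θ, y))
      (∫ y in D, h y * fderiv ℝ Ψ (0, y) (1, 0)) 0 := by
  set Ψ' : ℝ × SpaceTime → ℝ := fun q => fderiv ℝ Ψ q (1, 0)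
  have hΨ'c : Continuous Ψ' := (hΨ.continuous_fderiv (by norm_num)).clm_apply continuous_const
  have hΨd : ∀ θ y, HasDerivAt (fun θ => Ψ (θ, y)) (Ψ' (θ, y)) θ := by
    intro θ y
    have h1 : HasDerivAt (fun θ : ℝ => (θ, y)) ((1 : ℝ), (0 : SpaceTime)) θ :=
      (hasDerivAt_id θ).prodMk (hasDerivAt_const θ y)
    exact ((hΨ.differentiable (by norm_num)) (θ, y)).hasFDerivAt.comp_hasDerivAt θ h1
  have hout' : ∀ y ∉ K, ∀ θ ∈ Ioo (-1 : ℝ) 1, Ψ' (θ, y) = 0 := by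
    intro y hy θ hθ
    refine (hΨd θ y).unique ((hasDerivAt_const θ (0 : ℝ)).congr_of_eventuallyEq ?_)
    filter_upwards [Ioo_mem_nhds hθ.1 hθ.2] with s hs
    exact hout y hy s (Ioo_subset_Icc_self hs)
  have hprod : IsCompact (Icc (-1 : ℝ) 1 ×ˢ K) := isCompact_Icc.prod hK
  obtain ⟨M, hM⟩ := hprod.exists_bound_of_continuousOn hΨ'c.continuousOn
  obtain ⟨M', hM'⟩ := hprod.exists_bound_of_continuousOn hΨ.continuous.continuousOn
  have hhK : IntegrableOn h K := hh.integrableOn_compact_subset hKD hK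
  have hhK' : Integrable (K.indicator h) (volume.restrict D) :=
    ((integrable_indicator_iff hK.measurableSet).2 hhK).restrict
  have hhm : AEStronglyMeasurable h (volume.restrict D) := hh.aestronglyMeasurable
  have hsl : ∀ θ : ℝ, AEStronglyMeasurable (fun y => Ψ (θ, y)) (volume.restrict D) := fun θ =>
    (hΨ.continuous.comp (Continuous.prodMk_right θ)).aestronglyMeasurable
  have hsl' : AEStronglyMeasurable (fun y => Ψ' (0, y)) (volume.restrict D) :=
    (hΨ'c.comp (Continuous.prodMk_right 0)).aestronglyMeasurable
  refine (hasDerivAt_integral_of_dominated_loc_of_deriv_le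
    (μ := volume.restrict D) (x₀ := (0 : ℝ)) (s := Ioo (-1 : ℝ) 1)
    (F := fun θ y => h y * Ψ (θ, y)) (F' := fun θ y => h y * Ψ' (θ, y))
    (bound := fun y => |M| * ‖K.indicator h y‖)
    (Ioo_mem_nhds (by norm_num) (by norm_num)) (.of_forall fun θ => hhm.mul (hsl θ))
    ?_ (hhm.mul hsl') (.of_forall fun y θ hθ => ?_) (hhK'.norm.const_mul _)
    (.of_forall fun y θ _ => (hΨd θ y).const_mul (h y))).2
  · refine ((hhK'.norm.const_mul |M'|).mono' (hhm.mul (hsl 0)) (.of_forall fun y => ?_))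
    by_cases hy : y ∈ K
    · rw [norm_mul, indicator_of_mem hy, mul_comm]
      gcongr
      exact (hM' (0, y) ⟨by simp, hy⟩).trans (le_abs_self M')
    · simp [hout y hy 0 (by simp), hy]
  · by_cases hy : y ∈ K
    · rw [norm_mul, indicator_of_mem hy, mul_comm]
      gcongr
      exact (hM (θ, y) ⟨Ioo_subset_Icc_self hθ, hy⟩).trans (le_abs_self M)
    · simp [hout' y hy θ hθ, hy]

theorem rotT_zero (y : SpaceTime) : rotT 0 y = y := by
  rw [rotT_apply]
  refine Prod.ext ?_ rfl
  ext i
  fin_cases i <;> simp [rotZ]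

theorem fderiv_comp_rotT_neg {φ : SpaceTime → ℝ} (hφ : ContDiff ℝ ∞ φ) (y : SpaceTime) :
    fderiv ℝ (fun q : ℝ × SpaceTime => φ (rotT (-q.1) q.2)) (0, y) (1, 0) =
      y.1 1 * fderiv ℝ φ y (dirX 0) - y.1 0 * fderiv ℝ φ y (dirX 1) := by
  have h0 : HasDerivAt (fun θ : ℝ => (θ, y)) ((1 : ℝ), (0 : SpaceTime)) 0 :=
    (hasDerivAt_id (0 : ℝ)).prodMk (hasDerivAt_const (0 : ℝ) y)
  have h1 := (((hφ.comp contDiff_rotT_neg).differentiable (by norm_num))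
    ((0 : ℝ), y)).hasFDerivAt.comp_hasDerivAt (0 : ℝ) h0
  have h2 : HasFDerivAt φ (fderiv ℝ φ y) (rotT (-0) y) := by
    rw [neg_zero, rotT_zero]
    exact ((hφ.differentiable (by norm_num)) y).hasFDerivAt
  have h3 := h2.comp_hasDerivAt (0 : ℝ) (hasDerivAt_rotT_neg_zero y)
  rw [map_sub, map_smul, map_smul, smul_eq_mul, smul_eq_mul] at h3
  exact h1.unique h3

theorem hasDerivAt_integral_rotT {R a T : ℝ} {h : SpaceTime → ℝ}
    (hh : LocallyIntegrableOn h (cylT R a T)) {φ : SpaceTime → ℝ} (hφ : ContDiff ℝ ∞ φ)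
    (hφc : HasCompactSupport φ) (hφD : tsupport φ ⊆ cylT R a T) :
    HasDerivAt (fun θ : ℝ => ∫ y in cylT R a T, h y * φ (rotT (-θ) y))
      (∫ y in cylT R a T, h y * (y.1 1 * fderiv ℝ φ y (dirX 0) - y.1 0 * fderiv ℝ φ y (dirX 1)))
      0 := by
  have hcont : Continuous fun q : ℝ × SpaceTime => rotT (-q.1) q.2 := contDiff_rotT_neg.continuous
  -- All rotations of `supp φ` by angles in `[-1, 1]`. The set is compact, and it stays inside the
  -- cylinder because the cylinder is rotation invariant.
  have hK : IsCompact ((fun q : ℝ × SpaceTime => rotT (-q.1) q.2) '' (Icc (-1) 1 ×ˢ tsupport φ)) :=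
    (isCompact_Icc.prod hφc).image hcont
  have key := hasDerivAt_integral_mul_of_contDiff hh hK ?_ (hφ.comp contDiff_rotT_neg) ?_
  · simp only [Function.comp_def, fderiv_comp_rotT_neg hφ] at key
    exact key
  · rintro _ ⟨⟨θ, y⟩, hq, rfl⟩
    exact rotT_mem_cylT.2 (hφD hq.2)
  · intro y hy θ hθ
    by_contra h0
    refine hy ⟨(-θ, rotT (-θ) y), ⟨⟨by linarith [hθ.2], by linarith [hθ.1]⟩,
      subset_tsupport φ h0⟩, ?_⟩
    simp only [neg_neg, rotT_rotT_neg]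

/-- The angular derivative `x^⊥ · ∇h` of a function `h` whose rotations are known. -/
theorem angular_deriv_ae_eq {R a T : ℝ} {h k : SpaceTime → ℝ} {h' : Fin 3 → SpaceTime → ℝ}
    (hh : ∀ j, HasWeakDeriv (cylT R a T) (dirX j) h (h' j))
    (hk : LocallyIntegrableOn k (cylT R a T)) {c s : ℝ → ℝ} {s' : ℝ} (hc : HasDerivAt c 0 0)
    (hs : HasDerivAt s s' 0)
    (hrot : ∀ θ, ∀ᵐ y ∂(muT R a T), h (rotT θ y) = c θ * h y + s θ * k y) :
    ∀ᵐ y ∂(muT R a T), y.1 0 * h' 1 y - y.1 1 * h' 0 y = s' * k y := by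
  have hloc : ∀ {f m : SpaceTime → ℝ}, LocallyIntegrableOn f (cylT R a T) → Continuous m →
      LocallyIntegrableOn (fun y => m y * f y) (cylT R a T) := fun hf hm =>
    hf.continuousOn_mul hm.continuousOn (isOpen_cylT R a T).isLocallyClosed
  have hint : ∀ {f m : SpaceTime → ℝ}, LocallyIntegrableOn f (cylT R a T) → Continuous m →
      HasCompactSupport m → tsupport m ⊆ cylT R a T →
      Integrable (fun y => f y * m y) (volume.restrict (cylT R a T)) := by
    intro f m hf hm hmc hmD
    have h1 : IntegrableOn f (tsupport m) := hf.integrableOn_compact_subset hmD hmc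
    have h2 : Integrable ((tsupport m).indicator f) (volume.restrict (cylT R a T)) :=
      ((integrable_indicator_iff (isClosed_tsupport m).measurableSet).2 h1).restrict
    obtain ⟨M, hM⟩ := hm.bounded_above_of_compact_support hmc
    refine (h2.mul_bdd hm.aestronglyMeasurable (.of_forall hM)).congr (.of_forall fun y => ?_)
    by_cases hy : y ∈ tsupport m
    · simp [hy]
    · simp [image_eq_zero_of_notMem_tsupport hy]
  have hx : ∀ i : Fin 3, ContDiff ℝ ∞ fun y : SpaceTime => y.1 i := fun i => by fun_prop
  have hL : LocallyIntegrableOn (fun y => y.1 0 * h' 1 y - y.1 1 * h' 0 y - s' * k y)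
      (cylT R a T) :=
    ((hloc (hh 1).2.1 (hx 0).continuous).sub (hloc (hh 0).2.1 (hx 1).continuous)).sub
      (hloc hk continuous_const)
  have hmain := (isOpen_cylT R a T).ae_eq_zero_of_integral_contDiff_smul_eq_zero hL ?_
  · rw [muT, ae_restrict_iff' (measurableSet_cylT R a T)]
    filter_upwards [hmain] with y hy hyD
    linarith [hy hyD]
  intro φ hφ hφc hφD
  have hd1 := hasDerivAt_integral_rotT (hh 0).1 hφ hφc hφD
  -- Invariance of the measure moves the rotation from `φ` to `h`, where `hrot` evaluates it.
  -- Differentiating both expressions at `θ = 0` gives the claim in weak form.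
  have heq : (fun θ : ℝ => ∫ y in cylT R a T, h y * φ (rotT (-θ) y)) = fun θ =>
      c θ * (∫ y in cylT R a T, h y * φ y) + s θ * (∫ y in cylT R a T, k y * φ y) := by
    ext θ
    rw [← integral_comp_rotT R a T θ]
    simp only [rotT_neg_rotT]
    rw [← integral_const_mul, ← integral_const_mul, ← integral_add
      ((hint (hh 0).1 hφ.continuous hφc hφD).const_mul _)
      ((hint hk hφ.continuous hφc hφD).const_mul _)]
    apply integral_congr_ae
    filter_upwards [hrot θ] with y hy
    rw [hy]; ring
  rw [heq] at hd1
  have hd2 := (hc.mul_const (∫ y in cylT R a T, h y * φ y)).add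
    (hs.mul_const (∫ y in cylT R a T, k y * φ y))
  have hu := hd1.unique hd2
  -- The field `(-x₁, x₀, 0)` is divergence free: each coefficient is independent of the variable
  -- being differentiated, so it can be absorbed into the test function.
  have hdx : ∀ (i j : Fin 3), i ≠ j → ∀ y,
      fderiv ℝ (fun y : SpaceTime => y.1 i * φ y) y (dirX j) = y.1 i * fderiv ℝ φ y (dirX j) := by
    intro i j hij y
    rw [fderiv_fun_mul ((hx i).differentiable (by norm_num) y)
      (hφ.differentiable (by norm_num) y)]
    have : fderiv ℝ (fun y : SpaceTime => y.1 i) y (dirX j) = 0 := by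
      have h1 : HasFDerivAt (fun y : SpaceTime => y.1 i)
        ((EuclideanSpace.proj i : Space →L[ℝ] ℝ).comp (ContinuousLinearMap.fst ℝ Space ℝ)) y :=
        ((EuclideanSpace.proj i : Space →L[ℝ] ℝ).comp
          (ContinuousLinearMap.fst ℝ Space ℝ)).hasFDerivAt
      rw [h1.fderiv]
      simp [dirX, hij]
    simp [this]
  have hts : ∀ i : Fin 3, tsupport (fun y : SpaceTime => y.1 i * φ y) ⊆ cylT R a T := fun i =>
    (tsupport_mul_subset_right (f := fun y : SpaceTime => y.1 i) (g := φ)).trans hφD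
  have hw1 := (hh 1).2.2 (fun y => y.1 0 * φ y) ((hx 0).mul hφ) hφc.mul_left (hts 0)
  have hw0 := (hh 0).2.2 (fun y => y.1 1 * φ y) ((hx 1).mul hφ) hφc.mul_left (hts 1)
  simp only [hdx 0 1 (by decide)] at hw1
  simp only [hdx 1 0 (by decide)] at hw0
  have hcd : ∀ j : Fin 3, Continuous fun y => fderiv ℝ φ y (dirX j) := fun j =>
    (hφ.continuous_fderiv (by norm_num)).clm_apply continuous_const
  have hfs : ∀ j : Fin 3, HasCompactSupport (fun y => fderiv ℝ φ y (dirX j)) := fun j =>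
    hφc.fderiv_apply ℝ (dirX j)
  have hfD : ∀ (i j : Fin 3), tsupport (fun y : SpaceTime => y.1 i * fderiv ℝ φ y (dirX j)) ⊆
      cylT R a T := fun i j =>
    (tsupport_mul_subset_right (f := fun y : SpaceTime => y.1 i)
      (g := fun y => fderiv ℝ φ y (dirX j))).trans
      ((tsupport_fderiv_apply_subset ℝ (dirX j)).trans hφD)
  have hsplit : ∫ y in cylT R a T,
      h y * (y.1 1 * fderiv ℝ φ y (dirX 0) - y.1 0 * fderiv ℝ φ y (dirX 1)) =
      (∫ y in cylT R a T, h y * (y.1 1 * fderiv ℝ φ y (dirX 0))) -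
      ∫ y in cylT R a T, h y * (y.1 0 * fderiv ℝ φ y (dirX 1)) := by
    rw [← integral_sub]
    · simp only [mul_sub]
    · exact hint (hh 0).1 ((hx 1).continuous.mul (hcd 0)) (hfs 0).mul_left (hfD 1 0)
    · exact hint (hh 0).1 ((hx 0).continuous.mul (hcd 1)) (hfs 1).mul_left (hfD 0 1)
  rw [hsplit, hw0, hw1] at hu
  have i1 : Integrable (fun y => h' 1 y * (y.1 0 * φ y)) (volume.restrict (cylT R a T)) :=
    hint (hh 1).2.1 ((hx 0).continuous.mul hφ.continuous) hφc.mul_left (hts 0)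
  have i0 : Integrable (fun y => h' 0 y * (y.1 1 * φ y)) (volume.restrict (cylT R a T)) :=
    hint (hh 0).2.1 ((hx 1).continuous.mul hφ.continuous) hφc.mul_left (hts 1)
  have ik := (hint hk hφ.continuous hφc hφD).const_mul s'
  have hglob : ∀ F : SpaceTime → ℝ, (∀ y ∉ tsupport φ, F y = 0) →
      ∫ y, F y = ∫ y in cylT R a T, F y := by
    intro F hF
    rw [setIntegral_eq_integral_of_forall_compl_eq_zero]
    exact fun y hy => hF y fun h => hy (hφD h)
  rw [hglob _ fun y hy => by simp [image_eq_zero_of_notMem_tsupport hy]]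
  have e : ∀ y : SpaceTime, φ y • (y.1 0 * h' 1 y - y.1 1 * h' 0 y - s' * k y) =
      h' 1 y * (y.1 0 * φ y) - h' 0 y * (y.1 1 * φ y) - s' * (k y * φ y) := by
    intro y; simp only [smul_eq_mul]; ring
  simp only [e]
  have e1 := integral_sub (i1.sub i0) ik
  simp only [Pi.sub_apply] at e1
  rw [e1, integral_sub i1 i0, integral_const_mul]
  linarith

end Rotation

end AxisymNS

namespace AxisymNS

/-! ### Calculus of weak derivatives. -/

section WeakDerivatives

theorem hasFDerivAt_coord (i : Fin 3) (y : SpaceTime) :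
    HasFDerivAt (fun y : SpaceTime => y.1 i)
      ((EuclideanSpace.proj i : Space →L[ℝ] ℝ).comp (ContinuousLinearMap.fst ℝ Space ℝ)) y :=
  ((EuclideanSpace.proj i : Space →L[ℝ] ℝ).comp (ContinuousLinearMap.fst ℝ Space ℝ)).hasFDerivAt

theorem contDiff_coord (i : Fin 3) : ContDiff ℝ ∞ fun y : SpaceTime => y.1 i := by fun_prop

theorem fderiv_coord_mul (i : Fin 3) {φ : SpaceTime → ℝ} (hφ : ContDiff ℝ ∞ φ) (y e : SpaceTime) :
    fderiv ℝ (fun y : SpaceTime => y.1 i * φ y) y e =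
      y.1 i * fderiv ℝ φ y e + e.1 i * φ y := by
  rw [fderiv_fun_mul (hasFDerivAt_coord i y).differentiableAt
    (hφ.differentiable (by norm_num) y), (hasFDerivAt_coord i y).fderiv]
  simp [mul_comm]

theorem contDiff_fderiv_apply {φ : SpaceTime → ℝ} (hφ : ContDiff ℝ ∞ φ) (e : SpaceTime) :
    ContDiff ℝ ∞ fun y => fderiv ℝ φ y e :=
  (hφ.fderiv_right (by norm_num)).clm_apply contDiff_const

theorem integrable_mul_of_tsupport_subset {U : Set SpaceTime} {f m : SpaceTime → ℝ}
    (hf : LocallyIntegrableOn f U) (hm : Continuous m) (hmc : HasCompactSupport m)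
    (hmU : tsupport m ⊆ U) : Integrable (fun y => f y * m y) (volume.restrict U) := by
  have h1 : IntegrableOn f (tsupport m) := hf.integrableOn_compact_subset hmU hmc
  have h2 : Integrable ((tsupport m).indicator f) (volume.restrict U) :=
    ((integrable_indicator_iff (isClosed_tsupport m).measurableSet).2 h1).restrict
  obtain ⟨M, hM⟩ := hm.bounded_above_of_compact_support hmc
  refine (h2.mul_bdd hm.aestronglyMeasurable (.of_forall hM)).congr (.of_forall fun y => ?_)
  by_cases hy : y ∈ tsupport m
  · simp [hy]
  · simp [image_eq_zero_of_notMem_tsupport hy]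

theorem tsupport_fderiv_apply_subset' {U : Set SpaceTime} {φ : SpaceTime → ℝ}
    (hφU : tsupport φ ⊆ U) (e : SpaceTime) : tsupport (fun y => fderiv ℝ φ y e) ⊆ U :=
  (tsupport_fderiv_apply_subset ℝ e).trans hφU

theorem HasWeakDeriv.sub {U : Set SpaceTime} {e : SpaceTime} {w w' z z' : SpaceTime → ℝ}
    (hw : HasWeakDeriv U e w w') (hz : HasWeakDeriv U e z z') :
    HasWeakDeriv U e (fun y => w y - z y) (fun y => w' y - z' y) := by
  refine ⟨hw.1.sub hz.1, hw.2.1.sub hz.2.1, fun φ h1 h2 h3 => ?_⟩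
  have hd := (contDiff_fderiv_apply h1 e).continuous
  have hdc := h2.fderiv_apply ℝ e
  have hdU := tsupport_fderiv_apply_subset' h3 e
  simp only [sub_mul]
  rw [integral_sub (integrable_mul_of_tsupport_subset hw.1 hd hdc hdU)
      (integrable_mul_of_tsupport_subset hz.1 hd hdc hdU),
    integral_sub (integrable_mul_of_tsupport_subset hw.2.1 h1.continuous h2 h3)
      (integrable_mul_of_tsupport_subset hz.2.1 h1.continuous h2 h3), hw.2.2 φ h1 h2 h3,
    hz.2.2 φ h1 h2 h3]
  ring

theorem HasWeakDeriv.coord_mul {U : Set SpaceTime} (hU : IsOpen U) {e : SpaceTime}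
    {w w' : SpaceTime → ℝ} (hw : HasWeakDeriv U e w w') (i : Fin 3) :
    HasWeakDeriv U e (fun y => y.1 i * w y) (fun y => y.1 i * w' y + e.1 i * w y) := by
  have hc := (contDiff_coord i).continuous
  refine ⟨hw.1.continuousOn_mul hc.continuousOn hU.isLocallyClosed,
    (hw.2.1.continuousOn_mul hc.continuousOn hU.isLocallyClosed).add
      (hw.1.continuousOn_mul continuousOn_const hU.isLocallyClosed), fun φ h1 h2 h3 => ?_⟩
  have hts : tsupport (fun y : SpaceTime => y.1 i * φ y) ⊆ U :=
    (tsupport_mul_subset_right (f := fun y : SpaceTime => y.1 i) (g := φ)).trans h3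
  have hm : ContDiff ℝ ∞ (fun y : SpaceTime => y.1 i * φ y) := (contDiff_coord i).mul h1
  have hmc : HasCompactSupport (fun y : SpaceTime => y.1 i * φ y) :=
    h2.mul_left (f := fun y : SpaceTime => y.1 i)
  have key := hw.2.2 (fun y => y.1 i * φ y) hm hmc hts
  have i1 : Integrable (fun y => w y * fderiv ℝ (fun y : SpaceTime => y.1 i * φ y) y e)
      (volume.restrict U) :=
    integrable_mul_of_tsupport_subset hw.1 (contDiff_fderiv_apply hm e).continuous
      (hmc.fderiv_apply ℝ e) (tsupport_fderiv_apply_subset' hts e)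
  have i2 : Integrable (fun y => e.1 i * (w y * φ y)) (volume.restrict U) :=
    (integrable_mul_of_tsupport_subset hw.1 h1.continuous h2 h3).const_mul _
  have i3 : Integrable (fun y => w' y * (y.1 i * φ y)) (volume.restrict U) :=
    integrable_mul_of_tsupport_subset hw.2.1 hm.continuous hmc hts
  have e1 : ∫ y in U, y.1 i * w y * fderiv ℝ φ y e =
      (∫ y in U, w y * fderiv ℝ (fun y : SpaceTime => y.1 i * φ y) y e) -
        ∫ y in U, e.1 i * (w y * φ y) := by
    rw [← integral_sub i1 i2]
    congr 1; ext y
    rw [fderiv_coord_mul i h1]; ring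
  have e2 : ∫ y in U, (y.1 i * w' y + e.1 i * w y) * φ y =
      (∫ y in U, w' y * (y.1 i * φ y)) + ∫ y in U, e.1 i * (w y * φ y) := by
    rw [← integral_add i3 i2]
    congr 1; ext y; ring
  rw [e1, e2, key]
  ring

/-- The weak divergence of `∂_i v` is `∂_i div v`. -/
theorem sum_secondDeriv_ae_eq_zero {U : Set SpaceTime} (hU : IsOpen U) {v : Fin 3 → SpaceTime → ℝ}
    {e : Fin 3 → SpaceTime} {Dv DDv : Fin 3 → Fin 3 → SpaceTime → ℝ} {i : Fin 3}
    (h1 : ∀ k j, HasWeakDeriv U (e k) (v j) (Dv k j))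
    (h2 : ∀ j, HasWeakDeriv U (e j) (Dv i j) (DDv j j))
    (hdiv : ∀ᵐ y ∂(volume.restrict U), ∑ j, Dv j j y = 0) :
    ∀ᵐ y ∂(volume.restrict U), ∑ j, DDv j j y = 0 := by
  have hL : LocallyIntegrableOn (fun y => ∑ j, DDv j j y) U := by
    simp only [Fin.sum_univ_three]
    exact ((h2 0).2.1.add (h2 1).2.1).add (h2 2).2.1
  rw [ae_restrict_iff' hU.measurableSet]
  refine hU.ae_eq_zero_of_integral_contDiff_smul_eq_zero hL fun φ hφ hφc hφU => ?_
  have hglob : ∫ y, φ y • ∑ j, DDv j j y = ∫ y in U, φ y • ∑ j, DDv j j y := by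
    rw [setIntegral_eq_integral_of_forall_compl_eq_zero]
    intro y hy
    rw [image_eq_zero_of_notMem_tsupport fun h => hy (hφU h), zero_smul]
  have hdφ : ∀ k, ContDiff ℝ ∞ fun y => fderiv ℝ φ y (e k) := fun k =>
    contDiff_fderiv_apply hφ (e k)
  have hdφc : ∀ k, HasCompactSupport fun y => fderiv ℝ φ y (e k) := fun k =>
    hφc.fderiv_apply ℝ (e k)
  have hdφU : ∀ k, tsupport (fun y => fderiv ℝ φ y (e k)) ⊆ U := fun k =>
    tsupport_fderiv_apply_subset' hφU (e k)
  have hsymm : ∀ j k y, fderiv ℝ (fun z => fderiv ℝ φ z (e j)) y (e k) =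
      fderiv ℝ (fun z => fderiv ℝ φ z (e k)) y (e j) := by
    intro j k y
    have hd : DifferentiableAt ℝ (fderiv ℝ φ) y :=
      (hφ.fderiv_right (m := ∞) (by norm_num)).differentiable (by norm_num) y
    have hs : IsSymmSndFDerivAt ℝ φ y :=
      hφ.contDiffAt.isSymmSndFDerivAt
        (by rw [minSmoothness_of_isRCLikeNormedField]; exact WithTop.coe_le_coe.2 (le_top : (2 : ℕ∞) ≤ ⊤))
    have hh : ∀ p q, fderiv ℝ (fun z => fderiv ℝ φ z p) y q = fderiv ℝ (fderiv ℝ φ) y q p := by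
      intro p q
      have := (hd.hasFDerivAt.clm_apply (hasFDerivAt_const p y)).fderiv
      rw [this]; simp
    rw [hh, hh]
    exact hs _ _
  -- Both derivatives are moved to `φ`, interchanged there, and one is moved back: `∫ ∂_j∂_i v_j φ =
  -- ∫ v_j ∂_i∂_j φ = -∫ ∂_j v_j ∂_i φ`.
  have key : ∀ j, ∫ y in U, DDv j j y * φ y = -∫ y in U, Dv j j y * fderiv ℝ φ y (e i) := by
    intro j
    have k1 := (h2 j).2.2 φ hφ hφc hφU
    have k2 := (h1 i j).2.2 _ (hdφ j) (hdφc j) (hdφU j)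
    have k3 := (h1 j j).2.2 _ (hdφ i) (hdφc i) (hdφU i)
    simp only [hsymm j i] at k2
    linarith
  have hi : ∀ j, Integrable (fun y => DDv j j y * φ y) (volume.restrict U) := fun j =>
    integrable_mul_of_tsupport_subset (h2 j).2.1 hφ.continuous hφc hφU
  have hi' : ∀ j, Integrable (fun y => Dv j j y * fderiv ℝ φ y (e i)) (volume.restrict U) :=
    fun j => integrable_mul_of_tsupport_subset (h1 j j).2.1 (hdφ i).continuous (hdφc i) (hdφU i)
  calc ∫ y, φ y • ∑ j, DDv j j y = ∫ y in U, ∑ j, DDv j j y * φ y := by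
        rw [hglob]
        congr 1; ext y
        rw [smul_eq_mul, mul_comm, Finset.sum_mul]
    _ = ∑ j, ∫ y in U, DDv j j y * φ y := integral_finsetSum _ fun j _ => hi j
    _ = -∫ y in U, ∑ j, Dv j j y * fderiv ℝ φ y (e i) := by
        rw [integral_finsetSum _ fun j _ => hi' j, ← Finset.sum_neg_distrib]
        exact Finset.sum_congr rfl fun j _ => key j
    _ = 0 := by
        rw [neg_eq_zero]
        apply integral_eq_zero_of_ae
        filter_upwards [hdiv] with y hy
        rw [← Finset.sum_mul, hy, zero_mul, Pi.zero_apply]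

end WeakDerivatives

/-! ### Cartesian form of the swirl and of axially symmetric fields. -/

section Components

/-- The right-hand side is polynomial in the coordinates, so the product rule gives its weak
derivatives without any singularity. On the axis both sides are zero. -/
theorem swirl_eq (w : SpaceTime → Space) (y : SpaceTime) :
    swirl w y = y.1 0 * w y 1 - y.1 1 * w y 0 := by
  have h := cylR_sq y.1
  rw [swirl]
  simp only [ePhi, PiLp.inner_apply, Fin.sum_univ_three]
  rcases eq_or_ne (cylR y.1) 0 with h0 | h0
  · rw [h0] at h
    have h1 : y.1 0 = 0 := by nlinarith [sq_nonneg (y.1 0), sq_nonneg (y.1 1)]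
    have h2 : y.1 1 = 0 := by nlinarith [sq_nonneg (y.1 0), sq_nonneg (y.1 1)]
    simp [h0, h1, h2]
  · simp
    field_simp
    ring

theorem swirl₀_eq (w : Space → Space) (x : Space) :
    swirl₀ w x = x 0 * w x 1 - x 1 * w x 0 :=
  swirl_eq (fun y => w y.1) (x, 0)

/-- The axis lies in the hyperplane `x₀ = 0`, which is a null set. -/
theorem ae_cylR_ne_zero (R a T : ℝ) : ∀ᵐ y ∂(muT R a T), cylR y.1 ≠ 0 := by
  refine ae_restrict_of_ae ?_
  have h1 : (volume : Measure SpaceTime) (LinearMap.ker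
      ((EuclideanSpace.proj 0 : Space →L[ℝ] ℝ).comp
        (ContinuousLinearMap.fst ℝ Space ℝ)).toLinearMap : Set SpaceTime) = 0 := by
    apply Measure.addHaar_submodule
    intro h
    have : (dirX 0 : SpaceTime) ∈ LinearMap.ker ((EuclideanSpace.proj 0 : Space →L[ℝ] ℝ).comp
        (ContinuousLinearMap.fst ℝ Space ℝ)).toLinearMap := by rw [h]; trivial
    simp [dirX] at this
  filter_upwards [compl_mem_ae_iff.2 h1] with y hy h0
  apply hy
  have h2 := cylR_sq y.1
  rw [h0] at h2
  have : y.1 0 = 0 := by nlinarith [sq_nonneg (y.1 0), sq_nonneg (y.1 1)]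
  simpa using this

/-- The Cartesian components of an axially symmetric field rotate with the point. -/
theorem AxisymField.rotT_ae {R a T : ℝ} {w : SpaceTime → Space} (h : AxisymField R a T w) (θ : ℝ) :
    ∀ᵐ y ∂(muT R a T), w (rotT θ y) 0 = Real.cos θ * w y 0 + -Real.sin θ * w y 1 ∧
      w (rotT θ y) 1 = Real.cos θ * w y 1 + Real.sin θ * w y 0 ∧ w (rotT θ y) 2 = w y 2 := by
  filter_upwards [h.1 θ, h.2.1 θ, h.2.2 θ, ae_cylR_ne_zero R a T] with y h1 h2 h3 h0
  have hr := cylR_sq y.1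
  rw [← rotT_apply] at h1 h2 h3
  simp only [eR, ePhi, eZ, PiLp.inner_apply, Fin.sum_univ_three, rotT_apply, cylR_rotZ] at h1 h2 h3
  simp only [← rotT_apply] at h1 h2 h3
  simp [rotZ] at h1 h2 h3
  set p := w (rotT θ y) 0
  set q := w (rotT θ y) 1
  set c := Real.cos θ
  set s := Real.sin θ
  have hcs : s ^ 2 + c ^ 2 = 1 := Real.sin_sq_add_cos_sq θ
  field_simp at h1 h2
  have hr2 : cylR y.1 ^ 2 ≠ 0 := pow_ne_zero 2 h0
  refine ⟨?_, ?_, h3⟩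
  -- The frame `(e_r, e_φ)` at the rotated point is orthonormal, so the linear system `h1`, `h2` is
  -- inverted by its transpose; the factor `r²` clears the denominators.
  · apply mul_left_cancel₀ hr2
    rw [hr]
    linear_combination (c * y.1 0 - s * y.1 1) * h1 - (s * y.1 0 + c * y.1 1) * h2 -
      p * (y.1 0 ^ 2 + y.1 1 ^ 2) * hcs
  · apply mul_left_cancel₀ hr2
    rw [hr]
    linear_combination (s * y.1 0 + c * y.1 1) * h1 + (c * y.1 0 - s * y.1 1) * h2 -
      q * (y.1 0 ^ 2 + y.1 1 ^ 2) * hcs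

end Components

end AxisymNS

/-! ### The scalar problem solved by the swirl. -/

namespace AxisymNS

/-- The scalar problem that the swirl `u` solves: the transport field `v` is solenoidal and
tangent to the boundary, and the flux `Du - 2 (v₁, -v₀, 0)` has no normal component. -/
structure SwirlSystem (R a ν T : ℝ) (u ut g : SpaceTime → ℝ) (Du v : Fin 3 → SpaceTime → ℝ)
    (u₀ : Space → ℝ) : Prop where
  memLp_u : MemLp u 2 (muT R a T)
  memLp_t : MemLp ut 2 (muT R a T)
  memLp_x : ∀ j, MemLp (Du j) 2 (muT R a T)
  memLp_v : ∀ j, MemLp (v j) 2 (muT R a T)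
  memLp_g : MemLp g ⊤ (muT R a T)
  memLp_u₀ : MemLp u₀ 2 (muX R a)
  deriv_t : HasWeakDeriv (cylT R a T) dirT u ut
  deriv_x : ∀ j, HasWeakDeriv (cylT R a T) (dirX j) u (Du j)
  eq_u : ∀ y, u y = y.1 0 * v 1 y - y.1 1 * v 0 y
  angular : ∀ᵐ y ∂(muT R a T), y.1 0 * Du 1 y - y.1 1 * Du 0 y = 0
  axis_bound : ∃ m, MemLp m 2 (muT R a T) ∧ ∀ᵐ y ∂(muT R a T), |u y| ≤ cylR y.1 ^ 2 * m y
  flux : ∀ φ : SpaceTime → ℝ, ContDiff ℝ ∞ φ →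
    ∫ y, ∑ j, v j y * fderiv ℝ φ y (dirX j) ∂(muT R a T) = 0
  weak : ∀ η : SpaceTime → ℝ, ContDiff ℝ ∞ η →
    ∫ y, ((ut y + ∑ j, v j y * Du j y - g y) * η y +
      ν * ((Du 0 y - 2 * v 1 y) * fderiv ℝ η y (dirX 0) +
        (Du 1 y + 2 * v 0 y) * fderiv ℝ η y (dirX 1) +
        Du 2 y * fderiv ℝ η y (dirX 2))) ∂(muT R a T) = 0
  init : ∀ φ : SpaceTime → ℝ, ContDiff ℝ ∞ φ → HasCompactSupport φ →
    tsupport φ ⊆ cyl R a ×ˢ Iio T →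
      ∫ y, (ut y * φ y + u y * fderiv ℝ φ y dirT) ∂(muT R a T) =
        -∫ x, u₀ x * φ (x, 0) ∂(muX R a)

theorem abs_coord_le {R a : ℝ} {x : Space} (hx : x ∈ cyl R a) (i : Fin 3) : |x i| ≤ R + a :=
  (PiLp.norm_apply_le x i).trans (norm_le_of_mem_cyl hx)

theorem MemLp.coord_mul {R a T : ℝ} {p : ℝ≥0∞} {f : SpaceTime → ℝ} (hf : MemLp f p (muT R a T))
    (i : Fin 3) : MemLp (fun y => y.1 i * f y) p (muT R a T) := by
  refine hf.of_le_mul (c := R + a)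
    ((contDiff_coord i).continuous.aestronglyMeasurable.mul hf.1) ?_
  filter_upwards [ae_restrict_mem (measurableSet_cylT R a T)] with y hy
  rw [norm_mul]
  exact mul_le_mul_of_nonneg_right (abs_coord_le hy.1 i) (norm_nonneg _)

theorem MemLp.coord_mul_space {R a : ℝ} {p : ℝ≥0∞} {f : Space → ℝ} (hf : MemLp f p (muX R a))
    (i : Fin 3) : MemLp (fun x => x i * f x) p (muX R a) := by
  refine hf.of_le_mul (c := R + a)
    ((by fun_prop : Continuous fun x : Space => x i).aestronglyMeasurable.mul hf.1) ?_
  filter_upwards [ae_restrict_mem (measurableSet_cyl R a)] with x hx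
  rw [norm_mul]
  exact mul_le_mul_of_nonneg_right (abs_coord_le hx i) (norm_nonneg _)

theorem MemLp.component {α : Type*} [MeasurableSpace α] {μ : Measure α} {p : ℝ≥0∞} {w : α → Space}
    (hw : MemLp w p μ) (i : Fin 3) : MemLp (fun y => w y i) p μ := by
  refine hw.of_le_mul (c := 1)
    ((EuclideanSpace.proj i : Space →L[ℝ] ℝ).continuous.comp_aestronglyMeasurable hw.1) ?_
  filter_upwards with y
  rw [one_mul]
  exact PiLp.norm_apply_le (w y) i

theorem exists_bound_on_cylT {m : SpaceTime → ℝ} (hm : Continuous m) (R a T : ℝ) :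
    ∃ C, ∀ᵐ y ∂(muT R a T), ‖m y‖ ≤ C := by
  obtain ⟨C, hC⟩ := (isBounded_cylT R a T).isCompact_closure.exists_bound_of_continuousOn
    hm.continuousOn
  refine ⟨C, ?_⟩
  filter_upwards [ae_restrict_mem (measurableSet_cylT R a T)] with y hy
  exact hC y (subset_closure hy)

theorem integrable_mul_continuous {R a T : ℝ} {f m : SpaceTime → ℝ}
    (hf : Integrable f (muT R a T)) (hm : Continuous m) :
    Integrable (fun y => f y * m y) (muT R a T) := by
  obtain ⟨C, hC⟩ := exists_bound_on_cylT hm R a T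
  exact hf.mul_bdd hm.aestronglyMeasurable hC

/-- The vector field `η e_φ r`. -/
def swirlTest (η : SpaceTime → ℝ) (y : SpaceTime) : Space :=
  !₂[-(y.1 1 * η y), y.1 0 * η y, 0]

theorem contDiff_swirlTest {η : SpaceTime → ℝ} (hη : ContDiff ℝ ∞ η) :
    ContDiff ℝ ∞ (swirlTest η) := by
  rw [contDiff_euclidean]
  intro i
  fin_cases i
  · exact ((contDiff_coord 1).mul hη).neg
  · exact (contDiff_coord 0).mul hη
  · exact contDiff_const

theorem fderiv_swirlTest {η : SpaceTime → ℝ} (hη : ContDiff ℝ ∞ η) (y e : SpaceTime) :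
    fderiv ℝ (swirlTest η) y e 0 = -(y.1 1 * fderiv ℝ η y e + e.1 1 * η y) ∧
    fderiv ℝ (swirlTest η) y e 1 = y.1 0 * fderiv ℝ η y e + e.1 0 * η y ∧
    fderiv ℝ (swirlTest η) y e 2 = 0 := by
  have h : ∀ i, fderiv ℝ (swirlTest η) y e i = fderiv ℝ (fun y => swirlTest η y i) y e := by
    intro i
    have h1 := (EuclideanSpace.proj i : Space →L[ℝ] ℝ).hasFDerivAt.comp y
      ((contDiff_swirlTest hη).differentiable (by norm_num) y).hasFDerivAt
    have h2 : fderiv ℝ (fun y => swirlTest η y i) y = _ := h1.fderiv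
    rw [h2]; rfl
  refine ⟨?_, ?_, ?_⟩
  · rw [h, ← fderiv_coord_mul 1 hη]
    have : (fun y => swirlTest η y 0) = fun y => -(y.1 1 * η y) := by ext y; simp [swirlTest]
    rw [this, fderiv_fun_neg]; rfl
  · rw [h, ← fderiv_coord_mul 0 hη]
    have : (fun y => swirlTest η y 1) = fun y => y.1 0 * η y := by ext y; simp [swirlTest]
    rw [this]
  · rw [h]
    have : (fun y => swirlTest η y 2) = fun _ => 0 := by ext y; simp [swirlTest]
    rw [this]; simp

theorem tangentOnBoundary_swirlTest (R a : ℝ) (η : SpaceTime → ℝ) :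
    TangentOnBoundary R a (swirlTest η) := by
  refine fun t => ⟨fun x _ => ?_, fun x _ => ?_⟩
  · simp only [swirlTest, eR, PiLp.inner_apply, Fin.sum_univ_three]
    simp
    ring
  · simp [swirlTest, eZ, PiLp.inner_apply, Fin.sum_univ_three]

/-- The rotation law of the Cartesian components, differentiated at `θ = 0`: the angular derivative
of `v` is `(-v₁, v₀, 0)`. -/
theorem AxisymField.angular {R a T : ℝ} {v : SpaceTime → Space} {Dv : Fin 3 → SpaceTime → Space}
    (hD : ∀ i j, HasWeakDeriv (cylT R a T) (dirX j) (fun y => v y i) (fun y => Dv j y i))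
    (h : AxisymField R a T v) :
    ∀ᵐ y ∂(muT R a T), y.1 0 * Dv 1 y 0 - y.1 1 * Dv 0 y 0 = -v y 1 ∧
      y.1 0 * Dv 1 y 1 - y.1 1 * Dv 0 y 1 = v y 0 ∧
      y.1 0 * Dv 1 y 2 - y.1 1 * Dv 0 y 2 = 0 := by
  have hcos : HasDerivAt Real.cos 0 0 := by simpa using Real.hasDerivAt_cos 0
  have hsin : HasDerivAt Real.sin 1 0 := by simpa using Real.hasDerivAt_sin 0
  have h0 := angular_deriv_ae_eq (hD 0) (hD 1 0).1 hcos hsin.fun_neg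
    fun θ => (h.rotT_ae θ).mono fun y hy => hy.1
  have h1 := angular_deriv_ae_eq (hD 1) (hD 0 0).1 hcos hsin
    fun θ => (h.rotT_ae θ).mono fun y hy => hy.2.1
  have h2 := angular_deriv_ae_eq (hD 2) (hD 0 0).1 (hasDerivAt_const (0 : ℝ) (1 : ℝ))
    (hasDerivAt_const (0 : ℝ) (0 : ℝ))
    fun θ => (h.rotT_ae θ).mono fun y hy => by rw [hy.2.2]; ring
  filter_upwards [h0, h1, h2] with y e0 e1 e2
  exact ⟨by rw [e0]; ring, by rw [e1]; ring, by rw [e2]; ring⟩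

theorem IndepAngle.angular {R a T : ℝ} {p : SpaceTime → ℝ} {gradp : SpaceTime → Space}
    (hD : ∀ i, HasWeakDeriv (cylT R a T) (dirX i) p (fun y => gradp y i))
    (h : IndepAngle R a T p) :
    ∀ᵐ y ∂(muT R a T), y.1 0 * gradp y 1 - y.1 1 * gradp y 0 = 0 := by
  have := angular_deriv_ae_eq (h' := fun j y => gradp y j) hD (hD 0).1
    (hasDerivAt_const (0 : ℝ) (1 : ℝ)) (hasDerivAt_const (0 : ℝ) (0 : ℝ))
    fun θ => (h θ).mono fun y hy => by rw [rotT_apply, hy]; ring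
  filter_upwards [this] with y hy
  rw [hy]; ring

/-- The swirl, written in Cartesian components. -/
def cartSwirl (w : SpaceTime → Space) (y : SpaceTime) : ℝ := y.1 0 * w y 1 - y.1 1 * w y 0

/-- The derivative in the direction `x_j` of the swirl. -/
def gradSwirl (v : SpaceTime → Space) (Dv : Fin 3 → SpaceTime → Space) (j : Fin 3)
    (y : SpaceTime) : ℝ :=
  (y.1 0 * Dv j y 1 + (dirX j).1 0 * v y 1) - (y.1 1 * Dv j y 0 + (dirX j).1 1 * v y 0)

theorem dirX_fst (i j : Fin 3) : (dirX j).1 i = if i = j then 1 else 0 := by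
  simp [dirX]

theorem MemLp.cartSwirl {R a T : ℝ} {p : ℝ≥0∞} {w : SpaceTime → Space}
    (hw : MemLp w p (muT R a T)) : MemLp (cartSwirl w) p (muT R a T) :=
  (MemLp.coord_mul (MemLp.component hw 1) 0).sub (MemLp.coord_mul (MemLp.component hw 0) 1)

/-- The slip condition is tested with `η r e_φ`. One copy of `-(v₁, -v₀, 0)` in the flux comes from
the product rule in `∇u`, the other from the transposed gradient, where `∇η` meets the angular
derivative of `v`. The gradient of `r e_φ` is antisymmetric and drops out against the symmetric
`𝔻(v)`; the second-order transposed terms are `∇ div v = 0`. -/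
theorem PerfectSlip.weak_swirl {R a T : ℝ} {v vt : SpaceTime → Space}
    {Dv : Fin 3 → SpaceTime → Space} {DDv : Fin 3 → Fin 3 → SpaceTime → Space}
    (hW : MemW221 R a T v vt Dv DDv) (hdiv : ∀ᵐ y ∂(muT R a T), ∑ j, Dv j y j = 0)
    (hv : AxisymField R a T v) (h : PerfectSlip R a T Dv DDv)
    {η : SpaceTime → ℝ} (hη : ContDiff ℝ ∞ η) :
    ∫ y, ((∑ j, (y.1 0 * DDv j j y 1 - y.1 1 * DDv j j y 0)) * η y +
      ((gradSwirl v Dv 0 y - 2 * v y 1) * fderiv ℝ η y (dirX 0) +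
        (gradSwirl v Dv 1 y + 2 * v y 0) * fderiv ℝ η y (dirX 1) +
        gradSwirl v Dv 2 y * fderiv ℝ η y (dirX 2))) ∂(muT R a T) = 0 := by
  have hs := h (swirlTest η) (contDiff_swirlTest hη) (tangentOnBoundary_swirlTest R a η)
  have hdd : ∀ i, ∀ᵐ y ∂(muT R a T), ∑ j, DDv i j y j = 0 := fun i =>
    sum_secondDeriv_ae_eq_zero (isOpen_cylT R a T) (v := fun j y => v y j) (e := dirX)
      (Dv := fun k j y => Dv k y j) (DDv := fun k j y => DDv i k y j) (i := i)
      (fun k j => hW.deriv_x j k) (fun j => hW.deriv_xx j i j) hdiv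
  rw [← hs]
  apply integral_congr_ae
  filter_upwards [hdd 0, hdd 1, hv.angular hW.deriv_x] with y h0 h1 h2
  obtain ⟨a0, a1, a2⟩ := h2
  simp only [Fin.sum_univ_three] at h0 h1 ⊢
  have f0 := fderiv_swirlTest hη y (dirX 0)
  have f1 := fderiv_swirlTest hη y (dirX 1)
  have f2 := fderiv_swirlTest hη y (dirX 2)
  have t0 : swirlTest η y 0 = -(y.1 1 * η y) := by simp [swirlTest]
  have t1 : swirlTest η y 1 = y.1 0 * η y := by simp [swirlTest]
  have t2 : swirlTest η y 2 = 0 := by simp [swirlTest]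
  rw [f0.1, f0.2.1, f0.2.2, f1.1, f1.2.1, f1.2.2, f2.1, f2.2.1, f2.2.2, t0, t1, t2]
  simp only [gradSwirl, dirX_fst]
  simp only [Fin.isValue, ↓reduceIte, one_ne_zero, zero_ne_one, Fin.reduceEq]
  linear_combination (y.1 1 * η y) * h0 - (y.1 0 * η y) * h1 - fderiv ℝ η y (dirX 0) * a0 -
    fderiv ℝ η y (dirX 1) * a1 - fderiv ℝ η y (dirX 2) * a2

theorem IsAxisymSolution.swirlSystem {R a ν T : ℝ} {v : SpaceTime → Space} {p : SpaceTime → ℝ}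
    {f : SpaceTime → Space} {v₀ : Space → Space} (h : IsAxisymSolution R a ν T v p f v₀)
    (hg : MemLp (swirl f) ⊤ (muT R a T)) :
    ∃ (ut : SpaceTime → ℝ) (Du : Fin 3 → SpaceTime → ℝ),
      SwirlSystem R a ν T (swirl v) ut (swirl f) Du (fun j y => v y j) (swirl₀ v₀) := by
  obtain ⟨vt, Dv, DDv, gradp, hW, hp, hgp, hmom, hdiv, hflux, hslip, hinit, hav, hip, haf⟩ := h
  have hsw : ∀ w, swirl w = cartSwirl w := fun w => funext (swirl_eq w)
  have hu : MemLp (cartSwirl v) 2 (muT R a T) := MemLp.cartSwirl hW.memLp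
  have hut : MemLp (cartSwirl vt) 2 (muT R a T) := MemLp.cartSwirl hW.memLp_t
  have hvj : ∀ j, MemLp (fun y => v y j) 2 (muT R a T) := fun j => MemLp.component hW.memLp j
  have hDvj : ∀ j i, MemLp (fun y => Dv j y i) 2 (muT R a T) := fun j i =>
    MemLp.component (hW.memLp_x j) i
  have hDu : ∀ j, MemLp (gradSwirl v Dv j) 2 (muT R a T) := fun j =>
    ((MemLp.coord_mul (hDvj j 1) 0).add ((hvj 1).const_mul _)).sub
      ((MemLp.coord_mul (hDvj j 0) 1).add ((hvj 0).const_mul _))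
  have hang := hav.angular hW.deriv_x
  rw [hsw, hsw] at *
  refine ⟨cartSwirl vt, gradSwirl v Dv, hu, hut, hDu, hvj, hg, ?_, ?_, ?_, fun y => rfl, ?_, ?_,
    ?_, ?_, ?_⟩
  · have : swirl₀ v₀ = fun x => x 0 * v₀ x 1 - x 1 * v₀ x 0 := funext (swirl₀_eq v₀)
    rw [this]
    exact (MemLp.coord_mul_space (MemLp.component hinit.1 1) 0).sub
      (MemLp.coord_mul_space (MemLp.component hinit.1 0) 1)
  · have := ((hW.deriv_t 1).coord_mul (isOpen_cylT R a T) 0).sub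
      ((hW.deriv_t 0).coord_mul (isOpen_cylT R a T) 1)
    simp only [dirT, PiLp.zero_apply, zero_mul, add_zero] at this
    exact this
  · exact fun j => ((hW.deriv_x 1 j).coord_mul (isOpen_cylT R a T) 0).sub
      ((hW.deriv_x 0 j).coord_mul (isOpen_cylT R a T) 1)
  · filter_upwards [hang] with y hy
    obtain ⟨a0, a1, a2⟩ := hy
    simp only [gradSwirl, dirX_fst]
    simp only [Fin.isValue, ↓reduceIte, one_ne_zero, zero_ne_one]
    linear_combination y.1 0 * a1 - y.1 1 * a0
  -- The angular identities express `v₀` and `v₁` through first-order terms with coefficients of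
  -- size `r`. Hence `|v₀|` and `|v₁|` are `O(r|Dv|)`, and `|u|` is bounded by `r²` times a sum of
  -- entries of `Dv`. The factor 2 is slack.
  · refine ⟨fun y => 2 * (|Dv 1 y 0| + |Dv 0 y 0| + |Dv 1 y 1| + |Dv 0 y 1|), ?_, ?_⟩
    · exact ((((hDvj 1 0).abs.add (hDvj 0 0).abs).add (hDvj 1 1).abs).add
        (hDvj 0 1).abs).const_mul 2
    · filter_upwards [hang] with y hy
      obtain ⟨a0, a1, a2⟩ := hy
      have hr0 := cylR_nonneg y.1
      have hx : ∀ i : Fin 3, i = 0 ∨ i = 1 → |y.1 i| ≤ cylR y.1 := by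
        intro i hi
        apply Real.abs_le_sqrt
        rcases hi with rfl | rfl <;> nlinarith [sq_nonneg (y.1 0), sq_nonneg (y.1 1)]
      have hx0 := hx 0 (Or.inl rfl)
      have hx1 := hx 1 (Or.inr rfl)
      have hb : ∀ p q : ℝ, |y.1 0 * p - y.1 1 * q| ≤ cylR y.1 * (|p| + |q|) := by
        intro p q
        refine (abs_sub _ _).trans ?_
        rw [abs_mul, abs_mul, mul_add]
        gcongr
      have hv1 : |v y 1| ≤ cylR y.1 * (|Dv 1 y 0| + |Dv 0 y 0|) := by
        rw [← abs_neg, ← a0]; exact hb _ _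
      have hv0 : |v y 0| ≤ cylR y.1 * (|Dv 1 y 1| + |Dv 0 y 1|) := by
        rw [← a1]; exact hb _ _
      calc |cartSwirl v y| ≤ cylR y.1 * (|v y 1| + |v y 0|) := hb _ _
        _ ≤ cylR y.1 * (cylR y.1 * (|Dv 1 y 0| + |Dv 0 y 0|) +
            cylR y.1 * (|Dv 1 y 1| + |Dv 0 y 1|)) := by gcongr
        _ = cylR y.1 ^ 2 * (|Dv 1 y 0| + |Dv 0 y 0| + |Dv 1 y 1| + |Dv 0 y 1|) := by ring
        _ ≤ _ := by
          refine mul_le_mul_of_nonneg_left ?_ (sq_nonneg _)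
          have : 0 ≤ |Dv 1 y 0| + |Dv 0 y 0| + |Dv 1 y 1| + |Dv 0 y 1| := by positivity
          linarith
  · intro φ hφ
    rw [← hflux φ hφ]
    apply integral_congr_ae
    filter_upwards [hdiv] with y hy
    rw [hy]; ring
  · intro η hη
    have hw := hslip.weak_swirl hW hdiv hav hη
    have : ∫ y, ν * ((∑ j, (y.1 0 * DDv j j y 1 - y.1 1 * DDv j j y 0)) * η y +
      ((gradSwirl v Dv 0 y - 2 * v y 1) * fderiv ℝ η y (dirX 0) +
        (gradSwirl v Dv 1 y + 2 * v y 0) * fderiv ℝ η y (dirX 1) +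
        gradSwirl v Dv 2 y * fderiv ℝ η y (dirX 2))) ∂(muT R a T) = 0 := by
      rw [integral_const_mul, hw, mul_zero]
    rw [← this]
    apply integral_congr_ae
    filter_upwards [hmom, hip.angular hp] with y hy hpy
    have m0 := hy 0
    have m1 := hy 1
    simp only [cartSwirl, gradSwirl, dirX_fst, Fin.sum_univ_three] at m0 m1 ⊢
    simp only [Fin.isValue, ↓reduceIte, one_ne_zero, zero_ne_one, Fin.reduceEq]
    -- This is `x₀` times the second momentum equation minus `x₁` times the first. The pressure
    -- drops out by `hpy`, and the products `v₀v₁` created by the product rule in `v·∇u` cancel.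
    linear_combination (y.1 0 * η y) * m1 - (y.1 1 * η y) * m0 - η y * hpy
  · intro φ hφ hφc hφD
    have hi : ∀ i : Fin 3, tsupport (fun y : SpaceTime => y.1 i * φ y) ⊆ cyl R a ×ˢ Iio T :=
      fun i => (tsupport_mul_subset_right (f := fun y : SpaceTime => y.1 i) (g := φ)).trans hφD
    have k1 := hinit.2 1 (fun y => y.1 0 * φ y) ((contDiff_coord 0).mul hφ)
      (hφc.mul_left (f := fun y : SpaceTime => y.1 0)) (hi 0)
    have k0 := hinit.2 0 (fun y => y.1 1 * φ y) ((contDiff_coord 1).mul hφ)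
      (hφc.mul_left (f := fun y : SpaceTime => y.1 1)) (hi 1)
    simp only [fderiv_coord_mul _ hφ] at k0 k1
    have hint : ∀ i j : Fin 3, Integrable (fun y : SpaceTime => vt y i * (y.1 j * φ y) +
        v y i * (y.1 j * fderiv ℝ φ y dirT + dirT.1 j * φ y)) (muT R a T) := by
      intro i j
      refine (integrable_mul_continuous ((MemLp.component hW.memLp_t i).integrable (by norm_num))
        ((contDiff_coord j).continuous.mul hφ.continuous)).add
        (integrable_mul_continuous ((hvj i).integrable (by norm_num)) ?_)
      exact ((contDiff_coord j).continuous.mul (contDiff_fderiv_apply hφ dirT).continuous).add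
        (continuous_const.mul hφ.continuous)
    have hφ0 : Continuous fun x : Space => φ (x, 0) := hφ.continuous.comp (by fun_prop)
    have hφ0c : ∃ C, ∀ x : Space, ‖φ (x, 0)‖ ≤ C := by
      obtain ⟨C, hC⟩ := hφ.continuous.bounded_above_of_compact_support hφc
      exact ⟨C, fun x => hC _⟩
    obtain ⟨C, hC⟩ := hφ0c
    have hint0 : ∀ i j : Fin 3, Integrable (fun x : Space => v₀ x i * (x j * φ (x, 0)))
        (muX R a) := by
      intro i j
      have h1 := (MemLp.coord_mul_space (MemLp.component hinit.1 i) j).integrable (by norm_num)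
      refine (h1.mul_bdd (c := C) hφ0.aestronglyMeasurable (.of_forall hC)).congr
        (.of_forall fun x => ?_)
      simp only; ring
    have e1 : ∫ y, (cartSwirl vt y * φ y + cartSwirl v y * fderiv ℝ φ y dirT) ∂(muT R a T) =
        (∫ y, (vt y 1 * (y.1 0 * φ y) +
          v y 1 * (y.1 0 * fderiv ℝ φ y dirT + dirT.1 0 * φ y)) ∂(muT R a T)) -
        ∫ y, (vt y 0 * (y.1 1 * φ y) +
          v y 0 * (y.1 1 * fderiv ℝ φ y dirT + dirT.1 1 * φ y)) ∂(muT R a T) := by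
      rw [← integral_sub (hint 1 0) (hint 0 1)]
      congr 1; ext y
      simp only [cartSwirl, dirT, PiLp.zero_apply]
      ring
    have e2 : ∫ x, swirl₀ v₀ x * φ (x, 0) ∂(muX R a) =
        (∫ x, v₀ x 1 * (x 0 * φ (x, 0)) ∂(muX R a)) -
          ∫ x, v₀ x 0 * (x 1 * φ (x, 0)) ∂(muX R a) := by
      rw [← integral_sub (hint0 1 0) (hint0 0 1)]
      congr 1; ext x
      rw [swirl₀_eq]; ring
    rw [e1, e2]
    change (∫ y in cylT R a T, _) - (∫ y in cylT R a T, _) = -((∫ x in cyl R a, _) - ∫ x in cyl R a, _)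
    rw [k1, k0]
    ring

end AxisymNS

/-! ### Traces in time and approximating sequences. -/

namespace AxisymNS

theorem tendsto_integral_bdd_mul {α : Type*} [MeasurableSpace α] {μ : Measure α}
    {c : ℕ → α → ℝ} {c' h : α → ℝ} {C : ℝ} (hc : ∀ n, AEStronglyMeasurable (c n) μ)
    (hcb : ∀ n, ∀ᵐ x ∂μ, |c n x| ≤ C) (hcl : ∀ᵐ x ∂μ, Tendsto (fun n => c n x) atTop (𝓝 (c' x)))
    (hh : Integrable h μ) :
    Tendsto (fun n => ∫ x, c n x * h x ∂μ) atTop (𝓝 (∫ x, c' x * h x ∂μ)) := by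
  apply tendsto_integral_of_dominated_convergence (fun x => C * ‖h x‖)
  · exact fun n => (hc n).mul hh.1
  · exact hh.norm.const_mul C
  · intro n
    filter_upwards [hcb n] with x hx
    rw [norm_mul]
    exact mul_le_mul_of_nonneg_right hx (norm_nonneg _)
  · filter_upwards [hcl] with x hx
    exact hx.mul_const _

theorem fderiv_comp_mul_time {Φ ζ : ℝ → ℝ} {W : SpaceTime → ℝ} (hΦ : ContDiff ℝ ∞ Φ)
    (hW : ContDiff ℝ ∞ W) (hζ : ContDiff ℝ ∞ ζ) (y e : SpaceTime) :
    fderiv ℝ (fun y => Φ (W y) * ζ y.2) y e =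
      deriv Φ (W y) * fderiv ℝ W y e * ζ y.2 + Φ (W y) * (deriv ζ y.2 * e.2) := by
  have h1 : HasFDerivAt (fun y => Φ (W y)) (deriv Φ (W y) • fderiv ℝ W y) y :=
    (hΦ.differentiable (by norm_num) (W y)).hasDerivAt.comp_hasFDerivAt y
      (hW.differentiable (by norm_num) y).hasFDerivAt
  have h2 : HasFDerivAt (fun y : SpaceTime => ζ y.2)
      (deriv ζ y.2 • ContinuousLinearMap.snd ℝ Space ℝ) y :=
    (hζ.differentiable (by norm_num) y.2).hasDerivAt.comp_hasFDerivAt y hasFDerivAt_snd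
  rw [(h1.fun_mul h2).fderiv]
  simp
  ring

theorem contDiff_comp_mul_time {Φ ζ : ℝ → ℝ} {W : SpaceTime → ℝ} (hΦ : ContDiff ℝ ∞ Φ)
    (hW : ContDiff ℝ ∞ W) (hζ : ContDiff ℝ ∞ ζ) : ContDiff ℝ ∞ fun y => Φ (W y) * ζ y.2 :=
  (hΦ.comp hW).mul (hζ.comp contDiff_snd)

theorem integrable_of_continuous {m : SpaceTime → ℝ} (hm : Continuous m) (R a T : ℝ) :
    Integrable m (muT R a T) := by
  obtain ⟨C, hC⟩ := exists_bound_on_cylT hm R a T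
  exact Integrable.of_bound hm.aestronglyMeasurable C hC

theorem memLp_two_of_continuous {m : SpaceTime → ℝ} (hm : Continuous m) (R a T : ℝ) :
    MemLp m 2 (muT R a T) := by
  obtain ⟨C, hC⟩ := exists_bound_on_cylT hm R a T
  exact MemLp.of_bound hm.aestronglyMeasurable C hC

theorem memLp_two_of_continuous_space {m : Space → ℝ} (hm : Continuous m) (R a : ℝ) :
    MemLp m 2 (muX R a) := by
  obtain ⟨C, hC⟩ := (isBounded_cyl R a).isCompact_closure.exists_bound_of_continuousOn
    hm.continuousOn
  refine MemLp.of_bound hm.aestronglyMeasurable C ?_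
  filter_upwards [ae_restrict_mem (measurableSet_cyl R a)] with y hy
  exact hC y (subset_closure hy)

theorem hasDerivAt_time {W : SpaceTime → ℝ} (hW : ContDiff ℝ ∞ W) (x : Space) (t : ℝ) :
    HasDerivAt (fun t => W (x, t)) (fderiv ℝ W (x, t) dirT) t := by
  have h1 : HasDerivAt (fun t : ℝ => (x, t)) dirT t :=
    (hasDerivAt_const t x).prodMk (hasDerivAt_id t)
  exact (hW.differentiable (by norm_num) (x, t)).hasFDerivAt.comp_hasDerivAt t h1

theorem integral_fderiv_dirT {R a T : ℝ} (hT : 0 < T) {W : SpaceTime → ℝ} (hW : ContDiff ℝ ∞ W) :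
    ∫ y, fderiv ℝ W y dirT ∂(muT R a T) = ∫ x, (W (x, T) - W (x, 0)) ∂(muX R a) := by
  have hc := (contDiff_fderiv_apply hW dirT).continuous
  have hi := integrable_of_continuous hc R a T
  rw [muT_eq_prod] at hi ⊢
  rw [integral_prod _ hi]
  congr 1; ext x
  rw [← integral_Ioc_eq_integral_Ioo, ← intervalIntegral.integral_of_le hT.le]
  exact intervalIntegral.integral_eq_sub_of_hasDerivAt (fun t _ => hasDerivAt_time hW x t)
    ((hc.comp (by fun_prop : Continuous fun t : ℝ => (x, t))).intervalIntegrable _ _)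

/-- The trace at `t = 0` is controlled by the function and its time derivative. -/
theorem eLpNorm_trace_sq_le {R a T : ℝ} {W : SpaceTime → ℝ} (hW : ContDiff ℝ ∞ W) :
    ENNReal.ofReal T * eLpNorm (fun x => W (x, 0)) 2 (muX R a) ^ 2 ≤
      2 * eLpNorm W 2 (muT R a T) ^ 2 +
        2 * ENNReal.ofReal T ^ 2 * eLpNorm (fun y => fderiv ℝ W y dirT) 2 (muT R a T) ^ 2 := by
  have hc := (contDiff_fderiv_apply hW dirT).continuous
  have hWc := hW.continuous
  have hslice : ∀ x : Space, Continuous fun t : ℝ => fderiv ℝ W (x, t) dirT := fun x =>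
    hc.comp (by fun_prop : Continuous fun t : ℝ => (x, t))
  have hpt : ∀ x : Space, ∀ t ∈ Ioo 0 T, ‖W (x, 0)‖ₑ ^ 2 ≤ 2 * ‖W (x, t)‖ₑ ^ 2 +
      2 * (ENNReal.ofReal T * ∫⁻ s in Ioo 0 T, ‖fderiv ℝ W (x, s) dirT‖ₑ ^ 2) := by
    intro x t ht
    have hftc := intervalIntegral.integral_eq_sub_of_hasDerivAt (a := 0) (b := t)
      (fun s _ => hasDerivAt_time hW x s) ((hslice x).intervalIntegrable _ _)
    have h1 : ‖W (x, 0) - W (x, t)‖ₑ ≤ ∫⁻ s in Ioo 0 T, ‖fderiv ℝ W (x, s) dirT‖ₑ := by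
      rw [enorm_sub_rev, ← hftc, intervalIntegral.integral_of_le ht.1.le]
      refine (enorm_integral_le_lintegral_enorm _).trans (lintegral_mono_set ?_)
      exact fun s hs => ⟨hs.1, hs.2.trans_lt ht.2⟩
    have h2 := sq_lintegral_le (volume.restrict (Ioo 0 T))
      (hslice x).enorm.measurable.aemeasurable
    simp only [Measure.restrict_apply_univ, Real.volume_Ioo, sub_zero] at h2
    calc _ ≤ 2 * ‖W (x, t)‖ₑ ^ 2 + 2 * ‖W (x, 0) - W (x, t)‖ₑ ^ 2 := enorm_sq_le_two_mul _ _
      _ ≤ 2 * ‖W (x, t)‖ₑ ^ 2 +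
          2 * (∫⁻ s in Ioo 0 T, ‖fderiv ℝ W (x, s) dirT‖ₑ) ^ 2 := by gcongr
      _ ≤ _ := by gcongr
  have hint : ∀ x : Space, ENNReal.ofReal T * ‖W (x, 0)‖ₑ ^ 2 ≤
      2 * (∫⁻ t in Ioo 0 T, ‖W (x, t)‖ₑ ^ 2) +
        2 * ENNReal.ofReal T ^ 2 * ∫⁻ s in Ioo 0 T, ‖fderiv ℝ W (x, s) dirT‖ₑ ^ 2 := by
    intro x
    calc ENNReal.ofReal T * ‖W (x, 0)‖ₑ ^ 2 = ∫⁻ t in Ioo 0 T, ‖W (x, 0)‖ₑ ^ 2 := by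
          simp [mul_comm]
      _ ≤ ∫⁻ t in Ioo 0 T, (2 * ‖W (x, t)‖ₑ ^ 2 +
          2 * (ENNReal.ofReal T * ∫⁻ s in Ioo 0 T, ‖fderiv ℝ W (x, s) dirT‖ₑ ^ 2)) :=
          setLIntegral_mono' measurableSet_Ioo (hpt x)
      _ = _ := by
          rw [lintegral_add_right _ measurable_const, lintegral_const_mul' _ _ (by simp)]
          simp only [lintegral_const, Measure.restrict_apply_univ, Real.volume_Ioo, sub_zero]
          ring
  have hprod : ∀ f : SpaceTime → ℝ, Continuous f →
      eLpNorm f 2 (muT R a T) ^ 2 = ∫⁻ x, (∫⁻ t in Ioo 0 T, ‖f (x, t)‖ₑ ^ 2) ∂(muX R a) := by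
    intro f hf
    have hfm := hf.measurable
    rw [eLpNorm_two_sq, muT_eq_prod, lintegral_prod _ (by fun_prop)]
  rw [hprod W hWc, hprod _ hc, eLpNorm_two_sq, ← lintegral_const_mul' _ _ (by simp),
    ← lintegral_const_mul' _ _ (by simp), ← lintegral_const_mul' _ _
      (ENNReal.mul_ne_top (by simp) (by simp)), ← lintegral_add_left]
  · exact lintegral_mono hint
  · have hWm := hWc.measurable
    exact (Measurable.lintegral_prod_right' (f := fun y : SpaceTime => ‖W y‖ₑ ^ 2)
      (by fun_prop)).const_mul 2

variable {R a ν T : ℝ} {u ut g : SpaceTime → ℝ} {Du v : Fin 3 → SpaceTime → ℝ} {u₀ : Space → ℝ}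

/-- A sequence of smooth functions that converges to the swirl in the parabolic Sobolev norm. -/
structure ApproxSeq (R a T : ℝ) (u ut : SpaceTime → ℝ) (Du : Fin 3 → SpaceTime → ℝ)
    (U : ℕ → SpaceTime → ℝ) : Prop where
  contDiff : ∀ n, ContDiff ℝ ∞ (U n)
  tendsto : Tendsto (fun n => eLpNorm (fun y => U n y - u y) 2 (muT R a T)) atTop (𝓝 0)
  tendsto_t : Tendsto (fun n => eLpNorm (fun y => fderiv ℝ (U n) y dirT - ut y) 2 (muT R a T))
    atTop (𝓝 0)
  tendsto_x : ∀ j, Tendsto (fun n => eLpNorm (fun y => fderiv ℝ (U n) y (dirX j) - Du j y) 2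
    (muT R a T)) atTop (𝓝 0)
  ae_tendsto : ∀ᵐ y ∂(muT R a T), Tendsto (fun n => U n y) atTop (𝓝 (u y))

theorem SwirlSystem.exists_approxSeq (S : SwirlSystem R a ν T u ut g Du v u₀) (hR : 0 < R)
    (ha : 0 < a) (hT : 0 < T) : ∃ U, ApproxSeq R a T u ut Du U := by
  obtain ⟨U, h1, h2, h3, h4⟩ := exists_smooth_approx (isOpen_cylT R a T) (convex_cylT R a T)
    (isBounded_cylT R a T) (nonempty_cylT hR ha hT) (ι := Option (Fin 3))
    (fun i => i.elim dirT dirX) (Du := fun i => i.elim ut Du) S.memLp_u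
    (fun i => by cases i <;> [exact S.memLp_t; exact S.memLp_x _])
    (fun i => by cases i <;> [exact S.deriv_t; exact S.deriv_x _])
  exact ⟨U, h1, h2, h3 none, fun j => h3 (some j), h4⟩

namespace ApproxSeq

variable {U : ℕ → SpaceTime → ℝ}

theorem aesm (hU : ApproxSeq R a T u ut Du U) (n : ℕ) (e : SpaceTime) :
    AEStronglyMeasurable (fun y => fderiv ℝ (U n) y e) (muT R a T) :=
  (contDiff_fderiv_apply (hU.contDiff n) e).continuous.aestronglyMeasurable

/-- The trace inequality applied to `U m - U n` makes the traces at `t = 0` a Cauchy sequence in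
`L²(Ω)`. The limit is identified with the initial value in `trace_ae_eq`. -/
theorem tendsto_trace_sub (hU : ApproxSeq R a T u ut Du U) (hT : 0 < T)
    (hu : MemLp u 2 (muT R a T)) (hut : MemLp ut 2 (muT R a T)) :
    ∃ w : Space → ℝ, MemLp w 2 (muX R a) ∧
      Tendsto (fun n => eLpNorm (fun x => U n (x, 0) - w x) 2 (muX R a)) atTop (𝓝 0) := by
  have hmem : ∀ n, MemLp (fun x : Space => U n (x, 0)) 2 (muX R a) := fun n =>
    memLp_two_of_continuous_space ((hU.contDiff n).continuous.comp (by fun_prop)) R a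
  set δ : ℕ → ℝ≥0∞ := fun n => eLpNorm (fun y => U n y - u y) 2 (muT R a T) +
    eLpNorm (fun y => fderiv ℝ (U n) y dirT - ut y) 2 (muT R a T)
  have hδ : Tendsto δ atTop (𝓝 0) := by simpa using hU.tendsto.add hU.tendsto_t
  set K : ℝ≥0∞ := (ENNReal.ofReal T)⁻¹ * (2 + 2 * ENNReal.ofReal T ^ 2)
  have hT0 : ENNReal.ofReal T ≠ 0 := by simpa using hT
  have hKt : K ≠ ⊤ := ENNReal.mul_ne_top (by simpa using hT) (by finiteness)
  have hbound : ∀ m n, eLpNorm (fun x : Space => U m (x, 0) - U n (x, 0)) 2 (muX R a) ^ 2 ≤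
      K * (δ m + δ n) ^ 2 := by
    intro m n
    have h1 := eLpNorm_trace_sq_le (R := R) (a := a) (T := T) ((hU.contDiff m).sub (hU.contDiff n))
    have h2 : eLpNorm (U m - U n) 2 (muT R a T) ≤ δ m + δ n := by
      have : U m - U n = (fun y => U m y - u y) - (fun y => U n y - u y) := by ext y; simp
      rw [this]
      refine (eLpNorm_sub_le ((hU.contDiff m).continuous.aestronglyMeasurable.sub hu.1)
        ((hU.contDiff n).continuous.aestronglyMeasurable.sub hu.1) (by norm_num)).trans ?_
      exact add_le_add le_self_add le_self_add
    have h3 : eLpNorm (fun y => fderiv ℝ (U m - U n) y dirT) 2 (muT R a T) ≤ δ m + δ n := by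
      have : (fun y => fderiv ℝ (U m - U n) y dirT) = (fun y => fderiv ℝ (U m) y dirT - ut y) -
          (fun y => fderiv ℝ (U n) y dirT - ut y) := by
        ext y
        rw [fderiv_sub ((hU.contDiff m).differentiable (by norm_num) y)
          ((hU.contDiff n).differentiable (by norm_num) y)]
        simp
      rw [this]
      refine (eLpNorm_sub_le ((hU.aesm m _).sub hut.1) ((hU.aesm n _).sub hut.1)
        (by norm_num)).trans ?_
      exact add_le_add le_add_self le_add_self
    have h4 : ENNReal.ofReal T * eLpNorm (fun x : Space => U m (x, 0) - U n (x, 0)) 2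
        (muX R a) ^ 2 ≤ (2 + 2 * ENNReal.ofReal T ^ 2) * (δ m + δ n) ^ 2 := by
      refine h1.trans ?_
      rw [add_mul]
      gcongr
      · exact h2
      · exact h3
    calc _ = (ENNReal.ofReal T)⁻¹ * (ENNReal.ofReal T *
          eLpNorm (fun x : Space => U m (x, 0) - U n (x, 0)) 2 (muX R a) ^ 2) := by
          rw [← mul_assoc, ENNReal.inv_mul_cancel hT0 ENNReal.ofReal_ne_top, one_mul]
      _ ≤ (ENNReal.ofReal T)⁻¹ * ((2 + 2 * ENNReal.ofReal T ^ 2) * (δ m + δ n) ^ 2) := by gcongr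
      _ = _ := by rw [← mul_assoc]
  have hcauchy : CauchySeq fun n => (hmem n).toLp := by
    rw [EMetric.cauchySeq_iff]
    intro ε hε
    have hlim : Tendsto (fun p : ℕ × ℕ => K * (δ p.1 + δ p.2) ^ 2) (atTop ×ˢ atTop)
        (𝓝 (K * (0 + 0) ^ 2)) := by
      refine ENNReal.Tendsto.const_mul (ENNReal.Tendsto.pow ?_) (Or.inr hKt)
      exact (hδ.comp tendsto_fst).add (hδ.comp tendsto_snd)
    simp only [add_zero, ne_eq, OfNat.ofNat_ne_zero, not_false_eq_true, zero_pow, mul_zero] at hlim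
    have hev := hlim.eventually_lt_const (u := ε ^ 2) (ENNReal.pow_pos hε 2)
    rw [prod_atTop_atTop_eq, eventually_atTop_prod_self'] at hev
    obtain ⟨N, hN⟩ := hev
    refine ⟨N, fun m hm n hn => ?_⟩
    rw [Lp.edist_toLp_toLp]
    exact (ENNReal.pow_lt_pow_left_iff two_ne_zero).1 ((hbound m n).trans_lt (hN m hm n hn))
  obtain ⟨w, hw⟩ := cauchySeq_tendsto_of_complete hcauchy
  refine ⟨w, Lp.memLp w, ?_⟩
  rw [Lp.tendsto_Lp_iff_tendsto_eLpNorm'] at hw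
  refine hw.congr fun n => eLpNorm_congr_ae ?_
  filter_upwards [(hmem n).coeFn_toLp] with x hx
  simp [hx]

end ApproxSeq

end AxisymNS

/-! ### Testing the equation with truncations of the swirl. -/

namespace AxisymNS

theorem memLp_comp_lipschitz {α : Type*} [MeasurableSpace α] {μ : Measure α} [IsFiniteMeasure μ]
    {Φ : ℝ → ℝ} {C : ℝ} (hΦc : Continuous Φ) (hΦ : ∀ p q, |Φ p - Φ q| ≤ C * |p - q|) {f : α → ℝ}
    (hf : MemLp f 2 μ) : MemLp (fun x => Φ (f x)) 2 μ := by
  have h1 : MemLp (fun x => Φ (f x) - Φ 0) 2 μ := by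
    refine hf.of_le_mul (c := C) ((hΦc.comp_aestronglyMeasurable hf.1).sub
      aestronglyMeasurable_const) (.of_forall fun x => ?_)
    simpa using hΦ (f x) 0
  have h2 := h1.add (memLp_const (Φ 0))
  refine h2.ae_eq (.of_forall fun x => ?_)
  simp

theorem tendsto_eLpNorm_comp_lipschitz {α : Type*} [MeasurableSpace α] {μ : Measure α}
    {Φ : ℝ → ℝ} {C : ℝ} (hΦ : ∀ p q, |Φ p - Φ q| ≤ C * |p - q|) {f : ℕ → α → ℝ} {f' : α → ℝ}
    (h : Tendsto (fun n => eLpNorm (fun x => f n x - f' x) 2 μ) atTop (𝓝 0)) :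
    Tendsto (fun n => eLpNorm (fun x => Φ (f n x) - Φ (f' x)) 2 μ) atTop (𝓝 0) := by
  have h1 := ENNReal.Tendsto.const_mul (a := ENNReal.ofReal C) h (Or.inr ENNReal.ofReal_ne_top)
  rw [mul_zero] at h1
  refine tendsto_of_tendsto_of_tendsto_of_le_of_le tendsto_const_nhds h1 (fun _ => bot_le)
    fun n => ?_
  exact eLpNorm_le_mul_eLpNorm_of_ae_le_mul (.of_forall fun x => hΦ _ _) 2

theorem tendsto_integral_mul {α : Type*} [MeasurableSpace α] {μ : Measure α}
    {a : ℕ → α → ℝ} {a' b : α → ℝ} (ha : ∀ n, AEStronglyMeasurable (a n) μ) (ha' : MemLp a' 2 μ)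
    (hb : MemLp b 2 μ) (hal : Tendsto (fun n => eLpNorm (fun x => a n x - a' x) 2 μ) atTop (𝓝 0)) :
    Tendsto (fun n => ∫ x, a n x * b x ∂μ) atTop (𝓝 (∫ x, a' x * b x ∂μ)) := by
  have := tendsto_integral_mul_mul (c := fun _ _ => (1 : ℝ)) (c' := fun _ => 1) (C := 1)
    (fun _ => aestronglyMeasurable_const) (fun _ => .of_forall fun _ => by simp)
    (.of_forall fun _ => tendsto_const_nhds) ha ha' hb hal
  simpa using this

/-- `F` is a smooth bounded function with primitive `Φ`, and `G` is a primitive of `s F'(s)`. -/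
structure Truncation (C : ℝ) (F Φ G : ℝ → ℝ) : Prop where
  contDiff : ContDiff ℝ ∞ F
  contDiff_prim : ContDiff ℝ ∞ Φ
  contDiff_mom : ContDiff ℝ ∞ G
  deriv_prim : ∀ s, deriv Φ s = F s
  deriv_mom : ∀ s, deriv G s = s * deriv F s
  bound : ∀ s, |F s| ≤ C
  bound_deriv : ∀ s, |deriv F s| ≤ C
  bound_mom : ∀ s, |s * deriv F s| ≤ C
  mom_zero : G 0 = 0

theorem lipschitz_of_deriv {Φ : ℝ → ℝ} (h : ContDiff ℝ ∞ Φ) {C : ℝ} (hC : ∀ s, |deriv Φ s| ≤ C)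
    (p q : ℝ) : |Φ p - Φ q| ≤ C * |p - q| :=
  Convex.norm_image_sub_le_of_norm_deriv_le (s := univ)
    (fun s _ => h.differentiable (by norm_num) s) (fun s _ => hC s) convex_univ (mem_univ q)
    (mem_univ p)

namespace Truncation

variable {C : ℝ} {F Φ G : ℝ → ℝ}

theorem lip_prim (tr : Truncation C F Φ G) (p q : ℝ) : |Φ p - Φ q| ≤ C * |p - q| :=
  lipschitz_of_deriv tr.contDiff_prim (fun s => by rw [tr.deriv_prim]; exact tr.bound s) p q

theorem lip_mom (tr : Truncation C F Φ G) (p q : ℝ) : |G p - G q| ≤ C * |p - q| :=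
  lipschitz_of_deriv tr.contDiff_mom (fun s => by rw [tr.deriv_mom]; exact tr.bound_mom s) p q

theorem abs_mom_le (tr : Truncation C F Φ G) (s : ℝ) : |G s| ≤ C * |s| := by
  simpa [tr.mom_zero] using tr.lip_mom s 0

theorem continuous_deriv (tr : Truncation C F Φ G) : Continuous (deriv F) :=
  tr.contDiff.continuous_deriv (by norm_num)

end Truncation

variable {R a ν T : ℝ} {u ut g : SpaceTime → ℝ} {Du v : Fin 3 → SpaceTime → ℝ} {u₀ : Space → ℝ}
  {U : ℕ → SpaceTime → ℝ}

/-- The initial value is given only through an integration by parts in time. The limit trace `w`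
satisfies the same formula, so testing both with products of a function of `x` and a function of `t`
identifies them. -/
theorem trace_ae_eq (S : SwirlSystem R a ν T u ut g Du v u₀) (hU : ApproxSeq R a T u ut Du U)
    (hT : 0 < T) {w : Space → ℝ} (hw : MemLp w 2 (muX R a))
    (hUw : Tendsto (fun n => eLpNorm (fun x => U n (x, 0) - w x) 2 (muX R a)) atTop (𝓝 0)) :
    w =ᵐ[muX R a] u₀ := by
  have hloc : LocallyIntegrableOn (fun x => w x - u₀ x) (cyl R a) := by
    have : IntegrableOn (fun x => w x - u₀ x) (cyl R a) :=
      (hw.integrable (by norm_num)).sub (S.memLp_u₀.integrable (by norm_num))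
    exact this.locallyIntegrableOn
  have hmain := (isOpen_cyl R a).ae_eq_zero_of_integral_contDiff_smul_eq_zero hloc ?_
  · rw [muX, Filter.EventuallyEq, ae_restrict_iff' (measurableSet_cyl R a)]
    filter_upwards [hmain] with x hx hxD
    linarith [hx hxD]
  intro ρ hρ hρc hρD
  -- A time cutoff that is 1 near `t = 0` and vanishes for `t ≥ T/2`, so the product below is
  -- admissible in `S.init`.
  let κ : ContDiffBump (0 : ℝ) := ⟨T / 4, T / 2, by linarith, by linarith⟩
  set φ : SpaceTime → ℝ := fun y => ρ y.1 * κ y.2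
  have hφ : ContDiff ℝ ∞ φ := (hρ.comp contDiff_fst).mul (κ.contDiff.comp contDiff_snd)
  have hts : tsupport φ ⊆ tsupport ρ ×ˢ tsupport κ := by
    refine closure_minimal (fun y hy => ?_) ((isClosed_tsupport ρ).prod (isClosed_tsupport κ))
    exact ⟨subset_tsupport _ (left_ne_zero_of_mul hy), subset_tsupport _ (right_ne_zero_of_mul hy)⟩
  have hφc : HasCompactSupport φ :=
    (hρc.isCompact.prod κ.hasCompactSupport.isCompact).of_isClosed_subset (isClosed_tsupport φ) hts
  have hφD : tsupport φ ⊆ cyl R a ×ˢ Iio T := by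
    refine hts.trans (prod_mono hρD fun t ht => ?_)
    rw [κ.tsupport_eq, Real.closedBall_eq_Icc] at ht
    have := ht.2
    simp only [zero_add] at this
    exact this.trans_lt (show T / 2 < T by linarith)
  have hκ0 : κ 0 = 1 := κ.one_of_mem_closedBall (by simp [κ.rIn_pos.le])
  have hκT : κ T = 0 := κ.zero_of_le_dist (by simp [κ, abs_of_pos hT]; linarith)
  have hn : ∀ n, (∫ y, fderiv ℝ (U n) y dirT * φ y ∂(muT R a T)) +
      ∫ y, U n y * fderiv ℝ φ y dirT ∂(muT R a T) = -∫ x, U n (x, 0) * ρ x ∂(muX R a) := by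
    intro n
    have h1 := integral_fderiv_dirT (R := R) (a := a) hT ((hU.contDiff n).mul hφ)
    have h2 : ∀ y, fderiv ℝ (U n * φ) y dirT =
        fderiv ℝ (U n) y dirT * φ y + U n y * fderiv ℝ φ y dirT := by
      intro y
      rw [fderiv_mul ((hU.contDiff n).differentiable (by norm_num) y)
        (hφ.differentiable (by norm_num) y)]
      simp; ring
    change ∫ y, fderiv ℝ (U n * φ) y dirT ∂(muT R a T) = _ at h1
    simp only [h2] at h1
    have i1 : Integrable (fun y => fderiv ℝ (U n) y dirT * φ y) (muT R a T) :=
      integrable_of_continuous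
        ((contDiff_fderiv_apply (hU.contDiff n) dirT).continuous.mul hφ.continuous) R a T
    have i2 : Integrable (fun y => U n y * fderiv ℝ φ y dirT) (muT R a T) :=
      integrable_of_continuous
        ((hU.contDiff n).continuous.mul (contDiff_fderiv_apply hφ dirT).continuous) R a T
    rw [integral_add i1 i2] at h1
    rw [h1, ← integral_neg]
    congr 1; ext x
    simp [φ, hκ0, hκT]
  have hρL : MemLp ρ 2 (muX R a) := memLp_two_of_continuous_space hρ.continuous R a
  have l1 := tendsto_integral_mul (fun n => hU.aesm n dirT) S.memLp_t
    (memLp_two_of_continuous hφ.continuous R a T) hU.tendsto_t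
  have l2 := tendsto_integral_mul (fun n => (hU.contDiff n).continuous.aestronglyMeasurable)
    S.memLp_u (memLp_two_of_continuous (contDiff_fderiv_apply hφ dirT).continuous R a T) hU.tendsto
  have l3 := (tendsto_integral_mul (fun n => ((hU.contDiff n).continuous.comp (by fun_prop :
    Continuous fun x : Space => (x, (0 : ℝ)))).aestronglyMeasurable) hw hρL hUw).neg
  have l12 := l1.add l2
  simp only [hn] at l12
  have huniq := tendsto_nhds_unique l12 l3
  have hinit := S.init φ hφ hφc hφD
  rw [integral_add (integrable_mul_continuous (S.memLp_t.integrable (by norm_num)) hφ.continuous)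
    (integrable_mul_continuous (S.memLp_u.integrable (by norm_num))
      (contDiff_fderiv_apply hφ dirT).continuous), huniq] at hinit
  have e0 : ∫ x, u₀ x * φ (x, 0) ∂(muX R a) = ∫ x, u₀ x * ρ x ∂(muX R a) := by
    congr 1; ext x; simp [φ, hκ0]
  rw [e0] at hinit
  have hglob : ∫ x, ρ x • (w x - u₀ x) = ∫ x, (w x * ρ x - u₀ x * ρ x) ∂(muX R a) := by
    rw [muX, setIntegral_eq_integral_of_forall_compl_eq_zero]
    · congr 1; ext x; rw [smul_eq_mul]; ring
    · intro x hx
      rw [image_eq_zero_of_notMem_tsupport fun h => hx (hρD h)]; ring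
  have i1 : Integrable (fun x => w x * ρ x) (muX R a) := hw.integrable_mul hρL
  have i2 : Integrable (fun x => u₀ x * ρ x) (muX R a) := S.memLp_u₀.integrable_mul hρL
  rw [hglob, integral_sub i1 i2]
  linarith

/-- For the smooth approximations `F(U)U_t = ∂_t Φ(U)`. Since `ζ T = 0`, only the boundary term at
`t = 0` survives; there the convergence of traces is needed. -/
theorem time_identity (S : SwirlSystem R a ν T u ut g Du v u₀) (hU : ApproxSeq R a T u ut Du U)
    (hT : 0 < T) {C : ℝ} {F Φ G ζ : ℝ → ℝ} (tr : Truncation C F Φ G) (hζ : ContDiff ℝ ∞ ζ)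
    (hζT : ζ T = 0) :
    (∫ y, F (u y) * ut y * ζ y.2 ∂(muT R a T)) + ∫ y, Φ (u y) * deriv ζ y.2 ∂(muT R a T) =
      -(ζ 0 * ∫ x, Φ (u₀ x) ∂(muX R a)) := by
  obtain ⟨w, hw, hUw⟩ := hU.tendsto_trace_sub hT S.memLp_u S.memLp_t
  have hwu := trace_ae_eq S hU hT hw hUw
  have hζ1 : Continuous fun y : SpaceTime => ζ y.2 := hζ.continuous.comp continuous_snd
  have hζ2 : Continuous fun y : SpaceTime => deriv ζ y.2 :=
    (hζ.continuous_deriv (by norm_num)).comp continuous_snd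
  have hFU : ∀ n, Continuous fun y => F (U n y) := fun n =>
    tr.contDiff.continuous.comp (hU.contDiff n).continuous
  have hΦU : ∀ n, Continuous fun y => Φ (U n y) := fun n =>
    tr.contDiff_prim.continuous.comp (hU.contDiff n).continuous
  have htr : Continuous fun x : Space => (x, (0 : ℝ)) := by fun_prop
  have hn : ∀ n, (∫ y, F (U n y) * fderiv ℝ (U n) y dirT * ζ y.2 ∂(muT R a T)) +
      ∫ y, Φ (U n y) * deriv ζ y.2 ∂(muT R a T) =
      -(ζ 0 * ∫ x, Φ (U n (x, 0)) * 1 ∂(muX R a)) := by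
    intro n
    have h1 := integral_fderiv_dirT (R := R) (a := a) hT
      (contDiff_comp_mul_time tr.contDiff_prim (hU.contDiff n) hζ)
    simp only [fderiv_comp_mul_time tr.contDiff_prim (hU.contDiff n) hζ, tr.deriv_prim, dirT,
      mul_one] at h1
    have i1 : Integrable (fun y => F (U n y) * fderiv ℝ (U n) y dirT * ζ y.2) (muT R a T) :=
      integrable_of_continuous (((hFU n).mul
        (contDiff_fderiv_apply (hU.contDiff n) dirT).continuous).mul hζ1) R a T
    have i2 : Integrable (fun y => Φ (U n y) * deriv ζ y.2) (muT R a T) :=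
      integrable_of_continuous ((hΦU n).mul hζ2) R a T
    simp only [dirT] at i1
    rw [integral_add i1 i2] at h1
    simp only [dirT, mul_one]
    rw [h1, ← integral_const_mul, ← integral_neg]
    congr 1; ext x
    simp only [hζT]; ring
  have l1 := tendsto_integral_mul_mul (C := C) (fun n => (hFU n).aestronglyMeasurable)
    (fun n => .of_forall fun y => tr.bound (U n y))
    (hU.ae_tendsto.mono fun y hy => (tr.contDiff.continuous.tendsto _).comp hy)
    (fun n => hU.aesm n dirT) S.memLp_t (memLp_two_of_continuous hζ1 R a T) hU.tendsto_t
  have l2 := tendsto_integral_mul (fun n => (hΦU n).aestronglyMeasurable)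
    (memLp_comp_lipschitz tr.contDiff_prim.continuous tr.lip_prim S.memLp_u)
    (memLp_two_of_continuous hζ2 R a T) (tendsto_eLpNorm_comp_lipschitz tr.lip_prim hU.tendsto)
  have l3 := ((tendsto_integral_mul (fun n => ((hΦU n).comp htr).aestronglyMeasurable)
    (memLp_comp_lipschitz tr.contDiff_prim.continuous tr.lip_prim hw)
    (memLp_const (1 : ℝ)) (tendsto_eLpNorm_comp_lipschitz tr.lip_prim hUw)).const_mul (ζ 0)).neg
  have l12 := l1.add l2
  simp only [hn] at l12
  rw [tendsto_nhds_unique l12 l3]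
  congr 2
  apply integral_congr_ae
  filter_upwards [hwu] with x hx
  rw [hx, mul_one]

/-- For smooth `U`, `F(U) v·∇U = v·∇Φ(U)` integrates to zero. In the limit `F(U n)` stays bounded
and converges almost everywhere while the gradients converge in `L²`, so `v ∈ L²` suffices. -/
theorem flux_identity (S : SwirlSystem R a ν T u ut g Du v u₀) (hU : ApproxSeq R a T u ut Du U)
    {C : ℝ} {F Φ G ζ : ℝ → ℝ} (tr : Truncation C F Φ G) (hζ : ContDiff ℝ ∞ ζ) :
    ∑ j, ∫ y, F (u y) * Du j y * (v j y * ζ y.2) ∂(muT R a T) = 0 := by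
  have hζ1 : Continuous fun y : SpaceTime => ζ y.2 := hζ.continuous.comp continuous_snd
  obtain ⟨M, hM⟩ := exists_bound_on_cylT hζ1 R a T
  have hb : ∀ j, MemLp (fun y => v j y * ζ y.2) 2 (muT R a T) := fun j => by
    refine (S.memLp_v j).of_le_mul (c := M) ((S.memLp_v j).1.mul hζ1.aestronglyMeasurable) ?_
    filter_upwards [hM] with y hy
    rw [norm_mul, mul_comm]
    gcongr
  have hFU : ∀ n, Continuous fun y => F (U n y) := fun n =>
    tr.contDiff.continuous.comp (hU.contDiff n).continuous
  have l := tendsto_finsetSum Finset.univ fun j _ => tendsto_integral_mul_mul (C := C)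
    (fun n => (hFU n).aestronglyMeasurable) (fun n => .of_forall fun y => tr.bound (U n y))
    (hU.ae_tendsto.mono fun y hy => (tr.contDiff.continuous.tendsto _).comp hy)
    (fun n => hU.aesm n (dirX j)) (S.memLp_x j) (hb j) (hU.tendsto_x j)
  refine tendsto_nhds_unique l (tendsto_const_nhds.congr fun n => ?_)
  rw [← S.flux _ (contDiff_comp_mul_time tr.contDiff_prim (hU.contDiff n) hζ),
    ← integral_finsetSum]
  · congr 1; ext y
    refine Finset.sum_congr rfl fun j _ => ?_
    rw [fderiv_comp_mul_time tr.contDiff_prim (hU.contDiff n) hζ, tr.deriv_prim]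
    simp only [dirX]
    ring
  · intro j _
    have := integrable_mul_continuous ((hb j).integrable (by norm_num))
      ((hFU n).mul (contDiff_fderiv_apply (hU.contDiff n) (dirX j)).continuous)
    exact this.congr (.of_forall fun y => mul_comm _ _)

/-- The weak equation admits only smooth test functions, hence `F(U n) ζ`. The factor `ut + v·Du -
g` is merely integrable; boundedness of `F` allows dominated convergence. -/
theorem weak_identity (S : SwirlSystem R a ν T u ut g Du v u₀) (hU : ApproxSeq R a T u ut Du U)
    {C : ℝ} {F Φ G ζ : ℝ → ℝ} (tr : Truncation C F Φ G) (hζ : ContDiff ℝ ∞ ζ) :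
    (∫ y, F (u y) * ζ y.2 * (ut y + ∑ j, v j y * Du j y - g y) ∂(muT R a T)) +
      ν * ((∫ y, deriv F (u y) * ζ y.2 * Du 0 y * (Du 0 y - 2 * v 1 y) ∂(muT R a T)) +
        (∫ y, deriv F (u y) * ζ y.2 * Du 1 y * (Du 1 y + 2 * v 0 y) ∂(muT R a T)) +
        ∫ y, deriv F (u y) * ζ y.2 * Du 2 y * Du 2 y ∂(muT R a T)) = 0 := by
  have hζ1 : Continuous fun y : SpaceTime => ζ y.2 := hζ.continuous.comp continuous_snd
  obtain ⟨M, hM⟩ := exists_bound_on_cylT hζ1 R a T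
  have hFU : ∀ n, Continuous fun y => F (U n y) := fun n =>
    tr.contDiff.continuous.comp (hU.contDiff n).continuous
  have hF'U : ∀ n, Continuous fun y => deriv F (U n y) := fun n =>
    tr.continuous_deriv.comp (hU.contDiff n).continuous
  have hh : Integrable (fun y => ut y + ∑ j, v j y * Du j y - g y) (muT R a T) := by
    refine ((S.memLp_t.integrable (by norm_num)).add (integrable_finsetSum _ fun j _ =>
      (S.memLp_v j).integrable_mul (S.memLp_x j))).sub (S.memLp_g.integrable (by simp))
  have hC : 0 ≤ C := (abs_nonneg _).trans (tr.bound 0)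
  have hq0 : MemLp (fun y => Du 0 y - 2 * v 1 y) 2 (muT R a T) :=
    (S.memLp_x 0).sub ((S.memLp_v 1).const_mul 2)
  have hq1 : MemLp (fun y => Du 1 y + 2 * v 0 y) 2 (muT R a T) :=
    (S.memLp_x 1).add ((S.memLp_v 0).const_mul 2)
  have hbd : ∀ {H : ℝ → ℝ}, (∀ s, |H s| ≤ C) → ∀ n, ∀ᵐ y ∂(muT R a T),
      |H (U n y) * ζ y.2| ≤ C * M := by
    intro H hH n
    filter_upwards [hM] with y hy
    rw [abs_mul]
    exact mul_le_mul (hH _) hy (abs_nonneg _) hC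
  have l0 := tendsto_integral_bdd_mul (fun n => ((hFU n).mul hζ1).aestronglyMeasurable)
    (hbd tr.bound) (hU.ae_tendsto.mono fun y hy =>
      ((tr.contDiff.continuous.tendsto _).comp hy).mul_const (ζ y.2)) hh
  have l : ∀ (j : Fin 3) {q : SpaceTime → ℝ}, MemLp q 2 (muT R a T) → Tendsto
      (fun n => ∫ y, deriv F (U n y) * ζ y.2 * fderiv ℝ (U n) y (dirX j) * q y ∂(muT R a T)) atTop
      (𝓝 (∫ y, deriv F (u y) * ζ y.2 * Du j y * q y ∂(muT R a T))) := fun j q hq =>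
    tendsto_integral_mul_mul (fun n => ((hF'U n).mul hζ1).aestronglyMeasurable)
      (hbd tr.bound_deriv) (hU.ae_tendsto.mono fun y hy =>
      ((tr.continuous_deriv.tendsto _).comp hy).mul_const (ζ y.2))
      (fun n => hU.aesm n (dirX j)) (S.memLp_x j) hq (hU.tendsto_x j)
  have hl := l0.add ((((l 0 hq0).add (l 1 hq1)).add (l 2 (S.memLp_x 2))).const_mul ν)
  refine tendsto_nhds_unique hl (tendsto_const_nhds.congr fun n => ?_)
  have hi : ∀ (j : Fin 3) {q : SpaceTime → ℝ}, MemLp q 2 (muT R a T) → Integrable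
      (fun y => deriv F (U n y) * ζ y.2 * fderiv ℝ (U n) y (dirX j) * q y) (muT R a T) := by
    intro j q hq
    have := integrable_mul_continuous (hq.integrable (by norm_num))
      (((hF'U n).mul hζ1).mul (contDiff_fderiv_apply (hU.contDiff n) (dirX j)).continuous)
    exact this.congr (.of_forall fun y => mul_comm _ _)
  have hi0 : Integrable (fun y => F (U n y) * ζ y.2 * (ut y + ∑ j, v j y * Du j y - g y))
      (muT R a T) :=
    (integrable_mul_continuous hh ((hFU n).mul hζ1)).congr (.of_forall fun y => mul_comm _ _)
  have e1 := integral_add (hi 0 hq0) (hi 1 hq1)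
  have e2 := integral_add ((hi 0 hq0).add (hi 1 hq1)) (hi 2 (S.memLp_x 2))
  have e3 := integral_add hi0
    ((((hi 0 hq0).add (hi 1 hq1)).add (hi 2 (S.memLp_x 2))).const_mul ν)
  rw [integral_const_mul] at e3
  simp only [Pi.add_apply] at e1 e2 e3
  rw [e2, e1] at e3
  refine Eq.trans ?_ e3
  rw [← S.weak _ (contDiff_comp_mul_time tr.contDiff (hU.contDiff n) hζ)]
  congr 1; ext y
  simp only [fderiv_comp_mul_time tr.contDiff (hU.contDiff n) hζ, dirX]
  ring

end AxisymNS

/-! ### The singular term near the axis. -/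

namespace AxisymNS

/-- The square of the distance to the axis. -/
def axSq (y : SpaceTime) : ℝ := y.1 0 ^ 2 + y.1 1 ^ 2

theorem axSq_eq (y : SpaceTime) : axSq y = cylR y.1 ^ 2 := (cylR_sq y.1).symm

theorem axSq_nonneg (y : SpaceTime) : 0 ≤ axSq y := by unfold axSq; positivity

theorem contDiff_axSq : ContDiff ℝ ∞ axSq := by unfold axSq; fun_prop

theorem fderiv_axSq (y e : SpaceTime) :
    fderiv ℝ axSq y e = 2 * y.1 0 * e.1 0 + 2 * y.1 1 * e.1 1 := by
  have h := ((hasFDerivAt_coord 0 y).mul (hasFDerivAt_coord 0 y)).add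
    ((hasFDerivAt_coord 1 y).mul (hasFDerivAt_coord 1 y))
  have h' : HasFDerivAt axSq _ y := h.congr_of_eventuallyEq (.of_forall fun z => by
    simp [axSq, pow_two])
  rw [h'.fderiv]
  simp
  ring

/-- A smooth function equal to one on `s ≤ R² / 4` and to zero on `s ≥ R² / 2`. -/
def axisCutoff (R s : ℝ) : ℝ := 1 - Real.smoothTransition (4 * s / R ^ 2 - 1)

theorem contDiff_axisCutoff (R : ℝ) : ContDiff ℝ ∞ (axisCutoff R) := by
  unfold axisCutoff
  exact contDiff_const.sub (Real.smoothTransition.contDiff.comp (by fun_prop))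

theorem axisCutoff_nonneg (R s : ℝ) : 0 ≤ axisCutoff R s :=
  sub_nonneg.2 (Real.smoothTransition.le_one _)

theorem axisCutoff_le_one (R s : ℝ) : axisCutoff R s ≤ 1 :=
  sub_le_self _ (Real.smoothTransition.nonneg _)

theorem axisCutoff_of_le {R s : ℝ} (hR : 0 < R) (hs : s ≤ R ^ 2 / 4) : axisCutoff R s = 1 := by
  rw [axisCutoff, Real.smoothTransition.zero_of_nonpos, sub_zero]
  rw [sub_nonpos, div_le_one (by positivity)]
  linarith

theorem axisCutoff_of_ge {R s : ℝ} (hR : 0 < R) (hs : R ^ 2 / 2 ≤ s) : axisCutoff R s = 0 := by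
  rw [axisCutoff, Real.smoothTransition.one_of_one_le, sub_self]
  rw [le_sub_iff_add_le, le_div_iff₀ (by positivity)]
  linarith

/-- Near the lateral boundary `W` vanishes, and the remaining restriction to `|x₂| < a`, `0 < t < T`
does not change in a horizontal direction. The restricted function is thus differentiable along that
direction in the whole space, and its derivative has integral zero. -/
theorem integral_fderiv_dirX_eq_zero {R a T : ℝ} {W : SpaceTime → ℝ} (hW : ContDiff ℝ ∞ W)
    {ρ : ℝ} (hρ : ρ < R ^ 2) (hR : 0 < R) (hW0 : ∀ y, ρ ≤ axSq y → W y = 0) {j : Fin 3}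
    (hj : j ≠ 2) :
    ∫ y, fderiv ℝ W y (dirX j) ∂(muT R a T) = 0 := by
  set c : SpaceTime → ℝ := fun y => by
    classical exact if |y.1 2| < a ∧ y.2 ∈ Ioo 0 T then 1 else 0 with hc
  have hcv : ∀ (y : SpaceTime) (s : ℝ), c (y + s • dirX j) = c y := by
    intro y s
    simp [hc, dirX, hj.symm]
  have hmem : ∀ y, y ∈ cylT R a T ↔ axSq y < R ^ 2 ∧ |y.1 2| < a ∧ y.2 ∈ Ioo 0 T := by
    intro y
    rw [axSq_eq, sq_lt_sq₀ (cylR_nonneg _) hR.le]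
    simp [cylT, cyl, and_assoc]
  have hD0 : ∀ y, ρ < axSq y → fderiv ℝ W y = 0 := by
    intro y hy
    have : W =ᶠ[𝓝 y] fun _ => 0 := by
      filter_upwards [(contDiff_axSq.continuous.tendsto y).eventually (lt_mem_nhds hy)] with z hz
      exact hW0 z hz.le
    rw [this.fderiv_eq]; simp
  have hind : ∀ {Q : SpaceTime → ℝ}, (∀ y, ρ < axSq y → Q y = 0) →
      (fun y => c y * Q y) = (cylT R a T).indicator Q := by
    intro Q hQ
    funext y
    by_cases h1 : |y.1 2| < a ∧ y.2 ∈ Ioo 0 T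
    · by_cases h2 : axSq y < R ^ 2
      · rw [indicator_of_mem ((hmem y).2 ⟨h2, h1⟩)]
        simp only [hc, if_pos h1, one_mul]
      · rw [hQ y (hρ.trans_le (not_lt.1 h2)), mul_zero, indicator_of_notMem]
        exact fun h => h2 ((hmem y).1 h).1
    · rw [indicator_of_notMem (fun h => h1 ((hmem y).1 h).2)]
      simp only [hc, if_neg h1, zero_mul]
  have hint : ∀ {Q : SpaceTime → ℝ}, Continuous Q → (∀ y, ρ < axSq y → Q y = 0) →
      Integrable (fun y => c y * Q y) := by
    intro Q hQ hQ0
    rw [hind hQ0, integrable_indicator_iff (measurableSet_cylT R a T)]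
    exact integrable_of_continuous hQ R a T
  have hW0' : ∀ y, ρ < axSq y → W y = 0 := fun y hy => hW0 y hy.le
  have hDW0 : ∀ y, ρ < axSq y → fderiv ℝ W y (dirX j) = 0 := fun y hy => by simp [hD0 y hy]
  have hi1 := hint hW.continuous hW0'
  have hi2 := hint (contDiff_fderiv_apply hW (dirX j)).continuous hDW0
  have key := integral_bilinear_hasLineDerivAt_right_eq_neg_left_of_integrable
    (μ := (volume : Measure SpaceTime)) (B := ContinuousLinearMap.mul ℝ ℝ) (v := dirX j)
    (f := fun _ => (1 : ℝ)) (f' := fun _ => 0) (g := fun y => c y * W y)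
    (g' := fun y => c y * fderiv ℝ W y (dirX j)) (by simp) (by simpa using hi2) (by simpa using hi1)
    (fun y _ => by
      simpa [HasLineDerivAt] using hasDerivAt_const (0 : ℝ) (1 : ℝ))
    (fun y _ => by
      have h1 := ((hW.differentiable (by norm_num) y).hasFDerivAt.hasLineDerivAt (dirX j))
      unfold HasLineDerivAt at h1 ⊢
      simp only [hcv]
      exact h1.const_mul (c y))
  simp only [ContinuousLinearMap.mul_apply', one_mul, zero_mul, integral_zero, neg_zero] at key
  rw [hind hDW0, integral_indicator (measurableSet_cylT R a T)] at key
  exact key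

theorem axSq_lt_of_mem {R a T : ℝ} (hR : 0 < R) {y : SpaceTime} (hy : y ∈ cylT R a T) :
    axSq y < R ^ 2 := by
  rw [axSq_eq, sq_lt_sq₀ (cylR_nonneg _) hR.le]
  exact hy.1.1

theorem axSq_pos_ae (R a T : ℝ) : ∀ᵐ y ∂(muT R a T), 0 < axSq y := by
  filter_upwards [ae_cylR_ne_zero R a T] with y hy
  rw [axSq_eq]; positivity

/-- The regularized cutoff `χ(r²) / (r² + ε)`. -/
def axisWeight (R ε : ℝ) (y : SpaceTime) : ℝ := axisCutoff R (axSq y) / (axSq y + ε)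

theorem contDiff_axisWeight (R : ℝ) {ε : ℝ} (hε : 0 < ε) : ContDiff ℝ ∞ (axisWeight R ε) := by
  unfold axisWeight
  exact ((contDiff_axisCutoff R).comp contDiff_axSq).div (contDiff_axSq.add contDiff_const)
    fun y => (add_pos_of_nonneg_of_pos (axSq_nonneg y) hε).ne'

theorem fderiv_axisWeight (R : ℝ) {ε : ℝ} (hε : 0 < ε) (y e : SpaceTime) :
    fderiv ℝ (axisWeight R ε) y e = (deriv (axisCutoff R) (axSq y) / (axSq y + ε) -
      axisCutoff R (axSq y) / (axSq y + ε) ^ 2) * fderiv ℝ axSq y e := by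
  have hne : axSq y + ε ≠ 0 := (add_pos_of_nonneg_of_pos (axSq_nonneg y) hε).ne'
  have h1 : HasDerivAt (fun s => axisCutoff R s / (s + ε)) (deriv (axisCutoff R) (axSq y) /
      (axSq y + ε) - axisCutoff R (axSq y) / (axSq y + ε) ^ 2) (axSq y) := by
    have := ((contDiff_axisCutoff R).differentiable (by norm_num) (axSq y)).hasDerivAt.fun_div
      ((hasDerivAt_id (axSq y)).add_const ε) hne
    refine this.congr_deriv ?_
    simp only [id]
    field_simp
  have h2 := h1.comp_hasFDerivAt y (contDiff_axSq.differentiable (by norm_num) y).hasFDerivAt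
  have h3 : HasFDerivAt (axisWeight R ε) _ y := h2
  rw [h3.fderiv]
  simp

/-- The divergence of `χ(r²) / (r² + ε) (x₁, x₂, 0)`. -/
def axisDiv (R ε : ℝ) (y : SpaceTime) : ℝ :=
  2 * (axisCutoff R (axSq y) * ε / (axSq y + ε) ^ 2 +
    deriv (axisCutoff R) (axSq y) * (axSq y / (axSq y + ε)))

variable {R a ν T : ℝ} {u ut g : SpaceTime → ℝ} {Du v : Fin 3 → SpaceTime → ℝ} {u₀ : Space → ℝ}
  {U : ℕ → SpaceTime → ℝ}

theorem sum_fderiv_coord_mul_axisWeight (R : ℝ) {ε : ℝ} (hε : 0 < ε) (y : SpaceTime) :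
    fderiv ℝ (fun y : SpaceTime => y.1 0 * axisWeight R ε y) y (dirX 0) +
      fderiv ℝ (fun y : SpaceTime => y.1 1 * axisWeight R ε y) y (dirX 1) = axisDiv R ε y := by
  have hne : axSq y + ε ≠ 0 := (add_pos_of_nonneg_of_pos (axSq_nonneg y) hε).ne'
  rw [fderiv_coord_mul _ (contDiff_axisWeight R hε), fderiv_coord_mul _ (contDiff_axisWeight R hε),
    fderiv_axisWeight R hε, fderiv_axisWeight R hε, fderiv_axSq, fderiv_axSq, axisWeight, axisDiv]
  simp only [dirX, PiLp.single_apply]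
  simp only [axSq] at hne ⊢
  simp
  field_simp
  ring

/-- Split the horizontal gradient into radial and angular parts. The field `(v₁, -v₀)` has radial
component `v_φ = u/r`; its angular component meets the vanishing angular derivative of `u`. -/
theorem axSq_mul_eq (S : SwirlSystem R a ν T u ut g Du v u₀) :
    ∀ᵐ y ∂(muT R a T), axSq y * (v 1 y * Du 0 y - v 0 y * Du 1 y) =
      u y * (y.1 0 * Du 0 y + y.1 1 * Du 1 y) := by
  filter_upwards [S.angular] with y hy
  rw [S.eq_u, axSq]
  linear_combination (-(y.1 1) * v 1 y - y.1 0 * v 0 y) * hy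

/-- Since `u F'(u)∇u = ∇G(u)`, this is an integration by parts against the smooth field `χ(r²)(r² +
ε)⁻¹ (x₀, x₁, 0)`, which vanishes near the lateral boundary. -/
theorem integral_mul_axisWeight (S : SwirlSystem R a ν T u ut g Du v u₀)
    (hU : ApproxSeq R a T u ut Du U) (hR : 0 < R) {C : ℝ} {F Φ G ζ : ℝ → ℝ}
    (tr : Truncation C F Φ G) (hζ : ContDiff ℝ ∞ ζ) {ε : ℝ} (hε : 0 < ε) :
    ∫ y, (u y * deriv F (u y)) * (y.1 0 * Du 0 y + y.1 1 * Du 1 y) * axisWeight R ε y * ζ y.2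
      ∂(muT R a T) = -∫ y, G (u y) * (axisDiv R ε y * ζ y.2) ∂(muT R a T) := by
  have hζ1 : Continuous fun y : SpaceTime => ζ y.2 := hζ.continuous.comp continuous_snd
  have hζ2 : ContDiff ℝ ∞ fun y : SpaceTime => ζ y.2 := hζ.comp contDiff_snd
  have hw := contDiff_axisWeight R hε
  have hH : Continuous fun s => s * deriv F s := continuous_id.mul tr.continuous_deriv
  have hP : ∀ j, ContDiff ℝ ∞ fun y : SpaceTime => y.1 j * axisWeight R ε y := fun j =>
    (contDiff_coord j).mul hw
  have hHU : ∀ n, Continuous fun y => U n y * deriv F (U n y) := fun n =>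
    hH.comp (hU.contDiff n).continuous
  have hGU : ∀ n, ContDiff ℝ ∞ fun y => G (U n y) := fun n => tr.contDiff_mom.comp (hU.contDiff n)
  have hcoef : ∀ j : Fin 3, Continuous fun y : SpaceTime => y.1 j * axisWeight R ε y * ζ y.2 :=
    fun j => (hP j).continuous.mul hζ1
  have hcoef' : ∀ j : Fin 3, Continuous fun y : SpaceTime =>
      fderiv ℝ (fun y : SpaceTime => y.1 j * axisWeight R ε y) y (dirX j) * ζ y.2 :=
    fun j => (contDiff_fderiv_apply (hP j) (dirX j)).continuous.mul hζ1
  have hHa : ∀ᵐ y ∂(muT R a T), Tendsto (fun n => U n y * deriv F (U n y)) atTop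
      (𝓝 (u y * deriv F (u y))) := hU.ae_tendsto.mono fun y hy => (hH.tendsto _).comp hy
  have hGu : MemLp (fun y => G (u y)) 2 (muT R a T) :=
    memLp_comp_lipschitz tr.contDiff_mom.continuous tr.lip_mom S.memLp_u
  have main : ∀ j : Fin 3, j ≠ 2 →
      (∫ y, u y * deriv F (u y) * Du j y * (y.1 j * axisWeight R ε y * ζ y.2) ∂(muT R a T)) +
      ∫ y, G (u y) * (fderiv ℝ (fun y : SpaceTime => y.1 j * axisWeight R ε y) y (dirX j) * ζ y.2)
        ∂(muT R a T) = 0 := by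
    intro j hj
    have l1 := tendsto_integral_mul_mul (C := C) (fun n => (hHU n).aestronglyMeasurable)
      (fun n => .of_forall fun y => tr.bound_mom (U n y)) hHa (fun n => hU.aesm n (dirX j))
      (S.memLp_x j) (memLp_two_of_continuous (hcoef j) R a T) (hU.tendsto_x j)
    have l2 := tendsto_integral_mul (fun n => (hGU n).continuous.aestronglyMeasurable) hGu
      (memLp_two_of_continuous (hcoef' j) R a T)
      (tendsto_eLpNorm_comp_lipschitz tr.lip_mom hU.tendsto)
    refine tendsto_nhds_unique (l1.add l2) (tendsto_const_nhds.congr fun n => ?_)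
    have hW : ContDiff ℝ ∞ fun y => G (U n y) * (y.1 j * axisWeight R ε y) * ζ y.2 :=
      ((hGU n).mul (hP j)).mul hζ2
    have h0 := integral_fderiv_dirX_eq_zero (a := a) (T := T) hW (ρ := R ^ 2 / 2)
      (by nlinarith) hR (fun y hy => by simp [axisWeight, axisCutoff_of_ge hR hy]) hj
    have i1 : Integrable (fun y => U n y * deriv F (U n y) * fderiv ℝ (U n) y (dirX j) *
        (y.1 j * axisWeight R ε y * ζ y.2)) (muT R a T) := integrable_of_continuous
      (((hHU n).mul (contDiff_fderiv_apply (hU.contDiff n) (dirX j)).continuous).mul (hcoef j)) R a T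
    have i2 : Integrable (fun y => G (U n y) *
        (fderiv ℝ (fun y : SpaceTime => y.1 j * axisWeight R ε y) y (dirX j) * ζ y.2))
        (muT R a T) := integrable_of_continuous ((hGU n).continuous.mul (hcoef' j)) R a T
    rw [← integral_add i1 i2, ← h0]
    congr 1; ext y
    have d1 : HasFDerivAt (fun y => G (U n y)) _ y :=
      (tr.contDiff_mom.differentiable (by norm_num) (U n y)).hasDerivAt.comp_hasFDerivAt y
        ((hU.contDiff n).differentiable (by norm_num) y).hasFDerivAt
    have d2 := ((hP j).differentiable (by norm_num) y).hasFDerivAt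
    have d3 : HasFDerivAt (fun y : SpaceTime => ζ y.2) _ y :=
      (hζ.differentiable (by norm_num) y.2).hasDerivAt.comp_hasFDerivAt y
        (hasFDerivAt_snd (𝕜 := ℝ) (E := Space) (F := ℝ))
    rw [((d1.fun_mul d2).fun_mul d3).fderiv]
    simp [dirX, tr.deriv_mom]
    ring
  have m0 := main 0 (by decide)
  have m1 := main 1 (by decide)
  have hI : ∀ j : Fin 3, Integrable (fun y => u y * deriv F (u y) * Du j y *
      (y.1 j * axisWeight R ε y * ζ y.2)) (muT R a T) := by
    intro j
    have h1 := integrable_mul_continuous ((S.memLp_x j).integrable (by norm_num)) (hcoef j)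
    refine (h1.bdd_mul (c := C) (hH.comp_aestronglyMeasurable S.memLp_u.1)
      (.of_forall fun y => tr.bound_mom (u y))).congr (.of_forall fun y => ?_)
    simp only; ring
  have hJ : ∀ j : Fin 3, Integrable (fun y => G (u y) *
      (fderiv ℝ (fun y : SpaceTime => y.1 j * axisWeight R ε y) y (dirX j) * ζ y.2))
      (muT R a T) := fun j => integrable_mul_continuous (hGu.integrable (by norm_num)) (hcoef' j)
  have e1 := integral_add (hI 0) (hI 1)
  have e2 := integral_add (hJ 0) (hJ 1)
  have f1 : ∫ y, (u y * deriv F (u y)) * (y.1 0 * Du 0 y + y.1 1 * Du 1 y) * axisWeight R ε y *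
      ζ y.2 ∂(muT R a T) = _ := Eq.trans (by congr 1; ext y; ring) e1
  have f2 : ∫ y, G (u y) * (axisDiv R ε y * ζ y.2) ∂(muT R a T) = _ := Eq.trans (by
    congr 1; ext y; rw [← sum_fderiv_coord_mul_axisWeight R hε]; ring) e2
  rw [f1, f2]
  linarith

/-- The limit `ε → 0` of the regularized identity. The part `ε/(r² + ε)²` of the divergence
approximates a point mass on the axis; its contribution vanishes because `u` is of order `r²` there.
-/
theorem axis_identity (S : SwirlSystem R a ν T u ut g Du v u₀)
    (hU : ApproxSeq R a T u ut Du U) (hR : 0 < R) {C : ℝ} {F Φ G ζ : ℝ → ℝ}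
    (tr : Truncation C F Φ G) (hζ : ContDiff ℝ ∞ ζ) :
    ∫ y, deriv F (u y) * axisCutoff R (axSq y) * (v 1 y * Du 0 y - v 0 y * Du 1 y) * ζ y.2
      ∂(muT R a T) = -∫ y, G (u y) * (2 * deriv (axisCutoff R) (axSq y) * ζ y.2) ∂(muT R a T) := by
  have hζ1 : Continuous fun y : SpaceTime => ζ y.2 := hζ.continuous.comp continuous_snd
  obtain ⟨M, hM⟩ := exists_bound_on_cylT hζ1 R a T
  have hχ' : Continuous fun y => deriv (axisCutoff R) (axSq y) :=
    ((contDiff_axisCutoff R).continuous_deriv (by norm_num)).comp contDiff_axSq.continuous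
  obtain ⟨K, hK⟩ := exists_bound_on_cylT hχ' R a T
  obtain ⟨m, hm, hum⟩ := S.axis_bound
  have hC : 0 ≤ C := (abs_nonneg _).trans (tr.bound 0)
  set ε : ℕ → ℝ := fun n => 1 / ((n : ℝ) + 1)
  have hε : ∀ n, 0 < ε n := fun n => by positivity
  have hεl : Tendsto ε atTop (𝓝 0) := tendsto_one_div_add_atTop_nhds_zero_nat
  have hβ : Integrable (fun y => v 1 y * Du 0 y - v 0 y * Du 1 y) (muT R a T) :=
    ((S.memLp_v 1).integrable_mul (S.memLp_x 0)).sub ((S.memLp_v 0).integrable_mul (S.memLp_x 1))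
  have hratio : ∀ n y, 0 ≤ axSq y / (axSq y + ε n) ∧ axSq y / (axSq y + ε n) ≤ 1 := fun n y =>
    ⟨div_nonneg (axSq_nonneg y) (add_pos_of_nonneg_of_pos (axSq_nonneg y) (hε n)).le,
      div_le_one_of_le₀ (le_add_of_nonneg_right (hε n).le)
        (add_pos_of_nonneg_of_pos (axSq_nonneg y) (hε n)).le⟩
  have hratiol : ∀ y, 0 < axSq y →
      Tendsto (fun n => axSq y / (axSq y + ε n)) atTop (𝓝 1) := by
    intro y hy
    have := (tendsto_const_nhds (x := axSq y)).div (hεl.const_add (axSq y)) (by simpa using hy.ne')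
    rw [add_zero, div_self hy.ne'] at this
    exact this
  have hH : Continuous fun s => s * deriv F s := continuous_id.mul tr.continuous_deriv
  have hL : Tendsto (fun n => ∫ y, (u y * deriv F (u y)) * (y.1 0 * Du 0 y + y.1 1 * Du 1 y) *
      axisWeight R (ε n) y * ζ y.2 ∂(muT R a T)) atTop (𝓝 (∫ y, deriv F (u y) *
        axisCutoff R (axSq y) * (v 1 y * Du 0 y - v 0 y * Du 1 y) * ζ y.2 ∂(muT R a T))) := by
    refine tendsto_integral_of_dominated_convergence
      (fun y => C * 1 * |v 1 y * Du 0 y - v 0 y * Du 1 y| * M) ?_ ?_ ?_ ?_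
    · intro n
      refine AEStronglyMeasurable.mul (.mul (.mul ?_ ?_) ?_) hζ1.aestronglyMeasurable
      · exact hH.comp_aestronglyMeasurable S.memLp_u.1
      · exact ((contDiff_coord 0).continuous.aestronglyMeasurable.mul (S.memLp_x 0).1).add
          ((contDiff_coord 1).continuous.aestronglyMeasurable.mul (S.memLp_x 1).1)
      · exact (contDiff_axisWeight R (hε n)).continuous.aestronglyMeasurable
    · exact (hβ.abs.const_mul _).mul_const _
    · intro n
      filter_upwards [axSq_mul_eq S, hM] with y hy hMy
      have e : (u y * deriv F (u y)) * (y.1 0 * Du 0 y + y.1 1 * Du 1 y) *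
          axisWeight R (ε n) y * ζ y.2 = deriv F (u y) * (axisCutoff R (axSq y) *
          (axSq y / (axSq y + ε n))) * (v 1 y * Du 0 y - v 0 y * Du 1 y) * ζ y.2 := by
        rw [axisWeight]
        linear_combination (-deriv F (u y) * (axisCutoff R (axSq y) / (axSq y + ε n)) * ζ y.2) * hy
      rw [e, Real.norm_eq_abs, abs_mul, abs_mul, abs_mul]
      have h1 : |axisCutoff R (axSq y) * (axSq y / (axSq y + ε n))| ≤ 1 := by
        rw [abs_of_nonneg (mul_nonneg (axisCutoff_nonneg _ _) (hratio n y).1)]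
        exact mul_le_one₀ (axisCutoff_le_one _ _) (hratio n y).1 (hratio n y).2
      have hMy' : |ζ y.2| ≤ M := hMy
      gcongr
      exact tr.bound_deriv _
    · filter_upwards [axSq_mul_eq S, axSq_pos_ae R a T] with y hy hy0
      have h1 := ((((hratiol y hy0).const_mul (axisCutoff R (axSq y))).const_mul
        (deriv F (u y))).mul_const (v 1 y * Du 0 y - v 0 y * Du 1 y)).mul_const (ζ y.2)
      rw [mul_one] at h1
      refine h1.congr fun n => ?_
      rw [axisWeight]
      linear_combination (deriv F (u y) * (axisCutoff R (axSq y) / (axSq y + ε n)) * ζ y.2) * hy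
  have hRt : Tendsto (fun n => ∫ y, G (u y) * (axisDiv R (ε n) y * ζ y.2) ∂(muT R a T)) atTop
      (𝓝 (∫ y, G (u y) * (2 * deriv (axisCutoff R) (axSq y) * ζ y.2) ∂(muT R a T))) := by
    refine tendsto_integral_of_dominated_convergence
      (fun y => 2 * C * M * |m y| + 2 * C * K * M * |u y|) ?_ ?_ ?_ ?_
    · intro n
      refine (tr.contDiff_mom.continuous.comp_aestronglyMeasurable S.memLp_u.1).mul
        (AEStronglyMeasurable.mul ?_ hζ1.aestronglyMeasurable)
      have : Continuous (axisDiv R (ε n)) := by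
        unfold axisDiv
        have hA := contDiff_axSq.continuous
        have hne : ∀ y, axSq y + ε n ≠ 0 := fun y =>
          (add_pos_of_nonneg_of_pos (axSq_nonneg y) (hε n)).ne'
        have hχ : Continuous fun y => axisCutoff R (axSq y) :=
          (contDiff_axisCutoff R).continuous.comp hA
        exact continuous_const.mul (((hχ.mul continuous_const).div ((hA.add continuous_const).pow 2)
          fun y => pow_ne_zero 2 (hne y)).add (hχ'.mul (hA.div (hA.add continuous_const) hne)))
      exact this.aestronglyMeasurable
    · exact ((hm.integrable (by norm_num)).abs.const_mul _).add
        ((S.memLp_u.integrable (by norm_num)).abs.const_mul _)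
    · intro n
      filter_upwards [hM, hK, hum, axSq_pos_ae R a T] with y hMy hKy hmy hy0
      rw [← axSq_eq] at hmy
      have hMy' : |ζ y.2| ≤ M := hMy
      have hKy' : |deriv (axisCutoff R) (axSq y)| ≤ K := hKy
      have hM0 : 0 ≤ M := (abs_nonneg _).trans hMy'
      have hK0 : 0 ≤ K := (abs_nonneg _).trans hKy'
      have hG := tr.abs_mom_le (u y)
      have hmm : |u y| ≤ axSq y * |m y| := hmy.trans (by gcongr; exact le_abs_self _)
      have hs : 0 < axSq y + ε n := add_pos hy0 (hε n)
      -- From `|G(u)| ≤ C|u| ≤ C r²|m|` and `r²ε ≤ (r² + ε)²` one gets a majorant that does not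
      -- depend on `ε`.
      have a1 : |G (u y)| * |axisCutoff R (axSq y) * ε n / (axSq y + ε n) ^ 2| ≤ C * |m y| := by
        rw [abs_of_nonneg (div_nonneg (mul_nonneg (axisCutoff_nonneg _ _) (hε n).le) (sq_nonneg _)),
          ← mul_div_assoc, div_le_iff₀ (by positivity)]
        have t1 : |G (u y)| * (axisCutoff R (axSq y) * ε n) ≤
            (C * (axSq y * |m y|)) * (1 * ε n) := by
          have := axisCutoff_le_one R (axSq y)
          have := axisCutoff_nonneg R (axSq y)
          have := (hε n).le
          refine mul_le_mul (hG.trans (by gcongr)) (by gcongr) (by positivity) (by positivity)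
        refine t1.trans ?_
        have t2 : 0 ≤ C * |m y| := by positivity
        have t3 : 0 ≤ (axSq y + ε n) ^ 2 - axSq y * ε n := by
          nlinarith [sq_nonneg (axSq y), sq_nonneg (ε n), mul_pos hy0 (hε n)]
        nlinarith [mul_nonneg t2 t3]
      have a2 : |G (u y)| * |deriv (axisCutoff R) (axSq y) * (axSq y / (axSq y + ε n))| ≤
          C * |u y| * K := by
        have h1 : |deriv (axisCutoff R) (axSq y) * (axSq y / (axSq y + ε n))| ≤ K * 1 := by
          rw [abs_mul, abs_of_nonneg (hratio n y).1]
          exact mul_le_mul hKy' (hratio n y).2 (hratio n y).1 hK0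
        rw [mul_one] at h1
        exact mul_le_mul hG h1 (abs_nonneg _) (by positivity)
      rw [Real.norm_eq_abs, abs_mul, abs_mul, axisDiv, abs_mul, abs_two]
      calc |G (u y)| * (2 * |axisCutoff R (axSq y) * ε n / (axSq y + ε n) ^ 2 +
            deriv (axisCutoff R) (axSq y) * (axSq y / (axSq y + ε n))| * |ζ y.2|)
          ≤ |G (u y)| * (2 * (|axisCutoff R (axSq y) * ε n / (axSq y + ε n) ^ 2| +
            |deriv (axisCutoff R) (axSq y) * (axSq y / (axSq y + ε n))|) * M) := by
            gcongr
            exact abs_add_le _ _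
        _ = 2 * M * (|G (u y)| * |axisCutoff R (axSq y) * ε n / (axSq y + ε n) ^ 2| +
            |G (u y)| * |deriv (axisCutoff R) (axSq y) * (axSq y / (axSq y + ε n))|) := by ring
        _ ≤ 2 * M * (C * |m y| + C * |u y| * K) := by gcongr
        _ = _ := by ring
    · filter_upwards [axSq_pos_ae R a T] with y hy0
      refine Tendsto.const_mul _ (Tendsto.mul_const _ ?_)
      have h1 := (hratiol y hy0).const_mul (deriv (axisCutoff R) (axSq y))
      have h2 : Tendsto (fun n => axisCutoff R (axSq y) * ε n / (axSq y + ε n) ^ 2) atTop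
          (𝓝 0) := by
        have := (hεl.const_mul (axisCutoff R (axSq y))).div ((hεl.const_add (axSq y)).pow 2)
          (by simpa using hy0.ne')
        rw [mul_zero, zero_div] at this
        exact this
      have := (h2.add h1).const_mul 2
      simpa [axisDiv] using this
  have := tendsto_nhds_unique hL (hRt.neg.congr fun n =>
    (integral_mul_axisWeight S hU hR tr hζ (hε n)).symm)
  exact this

end AxisymNS

/-! ### The energy balance for truncations. -/

namespace AxisymNS

/-- The coefficient `(1 - χ(r²)) / r²`, which vanishes near the axis. -/
def axisCoef (R : ℝ) (y : SpaceTime) : ℝ := (1 - axisCutoff R (axSq y)) / axSq y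

theorem measurable_axisCoef (R : ℝ) : Measurable (axisCoef R) :=
  (measurable_const.sub ((contDiff_axisCutoff R).continuous.comp
    contDiff_axSq.continuous).measurable).div contDiff_axSq.continuous.measurable

theorem axisCoef_nonneg (R : ℝ) (y : SpaceTime) : 0 ≤ axisCoef R y :=
  div_nonneg (sub_nonneg.2 (axisCutoff_le_one _ _)) (axSq_nonneg y)

theorem axisCoef_le {R : ℝ} (hR : 0 < R) (y : SpaceTime) : axisCoef R y ≤ 4 / R ^ 2 := by
  unfold axisCoef
  rcases le_total (axSq y) (R ^ 2 / 4) with h | h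
  · rw [axisCutoff_of_le hR h, sub_self, zero_div]
    positivity
  · calc (1 - axisCutoff R (axSq y)) / axSq y ≤ 1 / (R ^ 2 / 4) :=
        div_le_div₀ zero_le_one (sub_le_self _ (axisCutoff_nonneg _ _)) (by positivity) h
      _ = 4 / R ^ 2 := by field_simp

theorem integrable_bdd_mul_mul {α : Type*} [MeasurableSpace α] {μ : Measure α} {c p q : α → ℝ}
    {C : ℝ} (hc : AEStronglyMeasurable c μ) (hcb : ∀ᵐ x ∂μ, |c x| ≤ C) (hp : MemLp p 2 μ)
    (hq : MemLp q 2 μ) : Integrable (fun x => c x * p x * q x) μ := by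
  have h : Integrable (fun x => c x * (p x * q x)) μ := (hp.integrable_mul hq).bdd_mul hc hcb
  exact h.congr (.of_forall fun x => (mul_assoc _ _ _).symm)

/-- The right-hand side of the balance of `∫ Φ(u)`. -/
def energyRate (R ν : ℝ) (F G : ℝ → ℝ) (u g : SpaceTime → ℝ) (Du : Fin 3 → SpaceTime → ℝ)
    (y : SpaceTime) : ℝ :=
  F (u y) * g y - ν * (deriv F (u y) * ∑ j, Du j y ^ 2) +
    2 * ν * (deriv F (u y) * (axisCoef R y * u y * (y.1 0 * Du 0 y + y.1 1 * Du 1 y)) -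
      G (u y) * (2 * deriv (axisCutoff R) (axSq y)))

/-- The consequences of the equation for the swirl on which the bound rests. -/
structure EnergySystem (R a ν T : ℝ) (u g : SpaceTime → ℝ) (Du : Fin 3 → SpaceTime → ℝ)
    (u₀ : Space → ℝ) : Prop where
  meas_u : Measurable u
  meas_x : ∀ j, Measurable (Du j)
  memLp_u : MemLp u 2 (muT R a T)
  memLp_x : ∀ j, MemLp (Du j) 2 (muT R a T)
  memLp_g : MemLp g ⊤ (muT R a T)
  memLp_u₀ : MemLp u₀ 2 (muX R a)
  energy : ∀ {C : ℝ} {F Φ G ζ : ℝ → ℝ}, Truncation C F Φ G → ContDiff ℝ ∞ ζ → ζ T = 0 →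
    (∫ y, Φ (u y) * deriv ζ y.2 ∂(muT R a T)) + ζ 0 * (∫ x, Φ (u₀ x) ∂(muX R a)) +
      (∫ y, energyRate R ν F G u g Du y * ζ y.2 ∂(muT R a T)) = 0
  nash : ∀ {C : ℝ} {F Φ G : ℝ → ℝ}, Truncation C F Φ G → ∀ {l : ℝ}, 0 < l → l ≤ 1 / 2 →
    ∫⁻ y, ‖F (u y)‖ₑ ^ 2 ∂(muT R a T) ≤
      4 * ENNReal.ofReal (nashC₁ R a * l ^ 2) *
        (∫⁻ y, ∑ j, ‖deriv F (u y) * Du j y‖ₑ ^ 2 ∂(muT R a T)) +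
      4 * ENNReal.ofReal (nashC₂ R a * (l ^ 6)⁻¹) *
        ∫⁻ t in Ioo 0 T, (∫⁻ x, ‖F (u (x, t))‖ₑ ∂(muX R a)) ^ 2

variable {R a ν T : ℝ} {u ut g : SpaceTime → ℝ} {Du v : Fin 3 → SpaceTime → ℝ} {u₀ : Space → ℝ}
  {U : ℕ → SpaceTime → ℝ}

theorem integrable_energyRate (hR : 0 < R) {C : ℝ} {F Φ G : ℝ → ℝ} (tr : Truncation C F Φ G)
    (hu : MemLp u 2 (muT R a T)) (hDu : ∀ j, MemLp (Du j) 2 (muT R a T))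
    (hg : MemLp g ⊤ (muT R a T)) : Integrable (energyRate R ν F G u g Du) (muT R a T) := by
  have hF' : AEStronglyMeasurable (fun y => deriv F (u y)) (muT R a T) :=
    tr.continuous_deriv.comp_aestronglyMeasurable hu.1
  have hχ' : Continuous fun y => 2 * deriv (axisCutoff R) (axSq y) := continuous_const.mul
    (((contDiff_axisCutoff R).continuous_deriv (by norm_num)).comp contDiff_axSq.continuous)
  have i1 : Integrable (fun y => F (u y) * g y) (muT R a T) :=
    (hg.integrable (by simp)).bdd_mul (tr.contDiff.continuous.comp_aestronglyMeasurable hu.1)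
      (.of_forall fun y => tr.bound (u y))
  have i2 : Integrable (fun y => deriv F (u y) * ∑ j, Du j y ^ 2) (muT R a T) :=
    (integrable_finsetSum _ fun j _ => (hDu j).integrable_sq).bdd_mul hF'
      (.of_forall fun y => tr.bound_deriv (u y))
  have hC : 0 ≤ C := (abs_nonneg _).trans (tr.bound 0)
  have i3 : Integrable (fun y => (deriv F (u y) * axisCoef R y) * u y *
      (y.1 0 * Du 0 y + y.1 1 * Du 1 y)) (muT R a T) := by
    refine integrable_bdd_mul_mul (C := C * (4 / R ^ 2))
      (hF'.mul (measurable_axisCoef R).aestronglyMeasurable) (.of_forall fun y => ?_) hu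
      ((MemLp.coord_mul (hDu 0) 0).add (MemLp.coord_mul (hDu 1) 1))
    rw [abs_mul, abs_of_nonneg (axisCoef_nonneg R y)]
    exact mul_le_mul (tr.bound_deriv _) (axisCoef_le hR y) (axisCoef_nonneg R y) hC
  have i4 : Integrable (fun y => G (u y) * (2 * deriv (axisCutoff R) (axSq y))) (muT R a T) :=
    integrable_mul_continuous ((memLp_comp_lipschitz tr.contDiff_mom.continuous tr.lip_mom
      hu).integrable (by norm_num)) hχ'
  have i3' : Integrable (fun y => deriv F (u y) * (axisCoef R y * u y *
      (y.1 0 * Du 0 y + y.1 1 * Du 1 y))) (muT R a T) :=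
    i3.congr (.of_forall fun y => by simp only; ring)
  exact (i1.sub (i2.const_mul ν)).add ((i3'.sub i4).const_mul (2 * ν))

/-- The term `2νF'(u)(v₁∂₀u - v₀∂₁u)` is split by `χ + (1 - χ)`. The first part is traded for a
`G(u)` term by `axis_identity`, the second is rewritten by `axSq_mul_eq` with the bounded
coefficient `(1 - χ)/r²`. The velocity no longer appears apart from `u`. -/
theorem energy_identity (S : SwirlSystem R a ν T u ut g Du v u₀) (hU : ApproxSeq R a T u ut Du U)
    (hR : 0 < R) (hT : 0 < T) {C : ℝ} {F Φ G ζ : ℝ → ℝ} (tr : Truncation C F Φ G)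
    (hζ : ContDiff ℝ ∞ ζ) (hζT : ζ T = 0) :
    (∫ y, Φ (u y) * deriv ζ y.2 ∂(muT R a T)) + ζ 0 * (∫ x, Φ (u₀ x) ∂(muX R a)) +
      (∫ y, energyRate R ν F G u g Du y * ζ y.2 ∂(muT R a T)) = 0 := by
  have hζ1 : Continuous fun y : SpaceTime => ζ y.2 := hζ.continuous.comp continuous_snd
  obtain ⟨M, hM⟩ := exists_bound_on_cylT hζ1 R a T
  have hC : 0 ≤ C := (abs_nonneg _).trans (tr.bound 0)
  have hFζ : AEStronglyMeasurable (fun y => F (u y) * ζ y.2) (muT R a T) :=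
    (tr.contDiff.continuous.comp_aestronglyMeasurable S.memLp_u.1).mul hζ1.aestronglyMeasurable
  have hF'ζ : AEStronglyMeasurable (fun y => deriv F (u y) * ζ y.2) (muT R a T) :=
    (tr.continuous_deriv.comp_aestronglyMeasurable S.memLp_u.1).mul hζ1.aestronglyMeasurable
  have hbd : ∀ {H : ℝ → ℝ}, (∀ s, |H s| ≤ C) → ∀ᵐ y ∂(muT R a T), |H (u y) * ζ y.2| ≤ C * M := by
    intro H hH
    filter_upwards [hM] with y hy
    rw [abs_mul]
    exact mul_le_mul (hH _) hy (abs_nonneg _) hC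
  have hh : Integrable (fun y => ut y + ∑ j, v j y * Du j y - g y) (muT R a T) :=
    ((S.memLp_t.integrable (by norm_num)).add (integrable_finsetSum _ fun j _ =>
      (S.memLp_v j).integrable_mul (S.memLp_x j))).sub (S.memLp_g.integrable (by simp))
  have r0 : Integrable (fun y => energyRate R ν F G u g Du y * ζ y.2) (muT R a T) :=
    integrable_mul_continuous (integrable_energyRate hR tr S.memLp_u S.memLp_x S.memLp_g) hζ1
  have w0 : Integrable (fun y => F (u y) * ζ y.2 * (ut y + ∑ j, v j y * Du j y - g y))
    (muT R a T) := hh.bdd_mul hFζ (hbd tr.bound)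
  have w1 : Integrable (fun y => deriv F (u y) * ζ y.2 * Du 0 y * (Du 0 y - 2 * v 1 y))
    (muT R a T) := integrable_bdd_mul_mul hF'ζ (hbd tr.bound_deriv) (S.memLp_x 0)
      ((S.memLp_x 0).sub ((S.memLp_v 1).const_mul 2))
  have w2 : Integrable (fun y => deriv F (u y) * ζ y.2 * Du 1 y * (Du 1 y + 2 * v 0 y))
    (muT R a T) := integrable_bdd_mul_mul hF'ζ (hbd tr.bound_deriv) (S.memLp_x 1)
      ((S.memLp_x 1).add ((S.memLp_v 0).const_mul 2))
  have w3 : Integrable (fun y => deriv F (u y) * ζ y.2 * Du 2 y * Du 2 y) (muT R a T) :=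
    integrable_bdd_mul_mul hF'ζ (hbd tr.bound_deriv) (S.memLp_x 2) (S.memLp_x 2)
  have t0 : Integrable (fun y => F (u y) * ut y * ζ y.2) (muT R a T) :=
    integrable_mul_continuous ((S.memLp_t.integrable (by norm_num)).bdd_mul
      (tr.contDiff.continuous.comp_aestronglyMeasurable S.memLp_u.1)
      (.of_forall fun y => tr.bound (u y))) hζ1
  have f0 : ∀ j, Integrable (fun y => F (u y) * Du j y * (v j y * ζ y.2)) (muT R a T) := by
    intro j
    refine (integrable_mul_continuous (integrable_bdd_mul_mul
      (tr.contDiff.continuous.comp_aestronglyMeasurable S.memLp_u.1)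
      (.of_forall fun y => tr.bound (u y)) (S.memLp_x j) (S.memLp_v j)) hζ1).congr
      (.of_forall fun y => ?_)
    simp only; ring
  have b0 : Integrable (fun y => deriv F (u y) * axisCutoff R (axSq y) *
      (v 1 y * Du 0 y - v 0 y * Du 1 y) * ζ y.2) (muT R a T) := by
    refine integrable_mul_continuous (Integrable.bdd_mul (c := C * 1)
      (((S.memLp_v 1).integrable_mul (S.memLp_x 0)).sub
        ((S.memLp_v 0).integrable_mul (S.memLp_x 1)))
      ((tr.continuous_deriv.comp_aestronglyMeasurable S.memLp_u.1).mul
        ((contDiff_axisCutoff R).continuous.comp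
          contDiff_axSq.continuous).aestronglyMeasurable) (.of_forall fun y => ?_)) hζ1
    rw [norm_mul]
    refine mul_le_mul (tr.bound_deriv _) ?_ (norm_nonneg _) hC
    rw [Real.norm_of_nonneg (axisCutoff_nonneg _ _)]
    exact axisCutoff_le_one _ _
  have hχ' : Continuous fun y => 2 * deriv (axisCutoff R) (axSq y) := continuous_const.mul
    (((contDiff_axisCutoff R).continuous_deriv (by norm_num)).comp contDiff_axSq.continuous)
  have g0 : Integrable (fun y => G (u y) * (2 * deriv (axisCutoff R) (axSq y) * ζ y.2))
      (muT R a T) := integrable_mul_continuous ((memLp_comp_lipschitz tr.contDiff_mom.continuous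
        tr.lip_mom S.memLp_u).integrable (by norm_num)) (hχ'.mul hζ1)
  have hw := weak_identity S hU tr hζ
  have ht := time_identity S hU hT tr hζ hζT
  have hf := flux_identity S hU tr hζ
  have hax := axis_identity S hU hR tr hζ
  rw [Fin.sum_univ_three] at hf
  -- Once the integrals are merged this is a pointwise identity. The four groups of integrals
  -- besides the rate and the time term vanish or cancel by the identities above.
  have key : (∫ y, energyRate R ν F G u g Du y * ζ y.2 ∂(muT R a T)) +
      ((∫ y, F (u y) * ζ y.2 * (ut y + ∑ j, v j y * Du j y - g y) ∂(muT R a T)) +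
      ν * ((∫ y, deriv F (u y) * ζ y.2 * Du 0 y * (Du 0 y - 2 * v 1 y) ∂(muT R a T)) +
        (∫ y, deriv F (u y) * ζ y.2 * Du 1 y * (Du 1 y + 2 * v 0 y) ∂(muT R a T)) +
        ∫ y, deriv F (u y) * ζ y.2 * Du 2 y * Du 2 y ∂(muT R a T))) =
      (∫ y, F (u y) * ut y * ζ y.2 ∂(muT R a T)) +
      ((∫ y, F (u y) * Du 0 y * (v 0 y * ζ y.2) ∂(muT R a T)) +
      (∫ y, F (u y) * Du 1 y * (v 1 y * ζ y.2) ∂(muT R a T)) +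
      (∫ y, F (u y) * Du 2 y * (v 2 y * ζ y.2) ∂(muT R a T))) +
      (-2 * ν) * ((∫ y, deriv F (u y) * axisCutoff R (axSq y) *
        (v 1 y * Du 0 y - v 0 y * Du 1 y) * ζ y.2 ∂(muT R a T)) +
      ∫ y, G (u y) * (2 * deriv (axisCutoff R) (axSq y) * ζ y.2) ∂(muT R a T)) := by
    have w4 := ((w1.add w2).add w3).const_mul ν
    have f4 := ((f0 0).add (f0 1)).add (f0 2)
    rw [← (integral_add' w1 w2), ← (integral_add' (w1.add w2) w3), ← integral_add' (f0 0) (f0 1),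
      ← integral_add' ((f0 0).add (f0 1)) (f0 2), ← integral_add' t0 f4, ← integral_add' b0 g0]
    refine Eq.trans (congrArg _ (congrArg _ (integral_const_mul ν _).symm)) ?_
    refine Eq.trans (congrArg _ (integral_add' w0 w4).symm) ?_
    refine Eq.trans (integral_add' r0 (w0.add w4)).symm ?_
    refine Eq.trans ?_ (congrArg _ (integral_const_mul (-2 * ν) _))
    refine Eq.trans ?_ (integral_add' (t0.add f4) ((b0.add g0).const_mul (-2 * ν)))
    apply integral_congr_ae
    filter_upwards [axSq_mul_eq S, axSq_pos_ae R a T] with y hy hy0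
    have e : axisCoef R y * u y * (y.1 0 * Du 0 y + y.1 1 * Du 1 y) =
        (1 - axisCutoff R (axSq y)) * (v 1 y * Du 0 y - v 0 y * Du 1 y) := by
      rw [mul_assoc, ← hy, axisCoef]
      field_simp
    simp only [energyRate, e, Pi.add_apply, Fin.sum_univ_three]
    ring

  rw [hw, hf, hax] at key
  linarith

end AxisymNS

/-! ### Measurable representatives, reflection, and weak derivatives in time. -/

namespace AxisymNS

/-- Write the difference as `cₙ(pₙ - p') + (cₙ - c')p'`; the second summand is treated by dominated
convergence. -/
theorem tendsto_eLpNorm_bdd_mul {α : Type*} [MeasurableSpace α] {μ : Measure α}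
    {c : ℕ → α → ℝ} {c' : α → ℝ} {p : ℕ → α → ℝ} {p' : α → ℝ} {C : ℝ}
    (hc : ∀ n, AEStronglyMeasurable (c n) μ) (hc' : AEStronglyMeasurable c' μ)
    (hcb : ∀ n x, |c n x| ≤ C) (hcb' : ∀ x, |c' x| ≤ C)
    (hcl : ∀ᵐ x ∂μ, Tendsto (fun n => c n x) atTop (𝓝 (c' x)))
    (hp : ∀ n, AEStronglyMeasurable (p n) μ) (hp' : MemLp p' 2 μ)
    (hpl : Tendsto (fun n => eLpNorm (fun x => p n x - p' x) 2 μ) atTop (𝓝 0)) :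
    Tendsto (fun n => eLpNorm (fun x => c n x * p n x - c' x * p' x) 2 μ) atTop (𝓝 0) := by
  have h2 : Tendsto (fun n => eLpNorm (fun x => (c n x - c' x) * p' x) 2 μ ^ 2) atTop (𝓝 0) := by
    simp only [eLpNorm_two_sq]
    have := tendsto_lintegral_of_dominated_convergence' (μ := μ)
      (F := fun n x => ‖(c n x - c' x) * p' x‖ₑ ^ 2) (f := fun _ => 0)
      (fun x => ENNReal.ofReal ((2 * C) ^ 2) * ‖p' x‖ₑ ^ 2)
      (fun n => ((((hc n).sub hc').mul hp'.1).enorm.pow_const 2))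
      (fun n => .of_forall fun x => ?_) ?_ ?_
    · simpa using this
    · simp only [enorm_sq_eq_ofReal]
      rw [← ENNReal.ofReal_mul (by positivity)]
      apply ENNReal.ofReal_le_ofReal
      rw [mul_pow]
      refine mul_le_mul_of_nonneg_right ?_ (sq_nonneg _)
      rw [← sq_abs]
      refine pow_le_pow_left₀ (abs_nonneg _) ?_ 2
      have := abs_sub (c n x) (c' x)
      linarith [hcb n x, hcb' x]
    · rw [lintegral_const_mul' _ _ ENNReal.ofReal_ne_top, ← eLpNorm_two_sq]
      exact ENNReal.mul_ne_top ENNReal.ofReal_ne_top (ENNReal.pow_ne_top hp'.2.ne)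
    · filter_upwards [hcl] with x hx
      have h1 : Tendsto (fun n => (c n x - c' x) * p' x) atTop (𝓝 0) := by
        simpa using (hx.sub_const (c' x)).mul_const (p' x)
      have h3 := ENNReal.Tendsto.pow (n := 2) ((continuous_enorm.tendsto (0 : ℝ)).comp h1)
      simpa using h3
  have h2' : Tendsto (fun n => eLpNorm (fun x => (c n x - c' x) * p' x) 2 μ) atTop (𝓝 0) := by
    have := (ENNReal.continuous_rpow_const (y := 1 / 2)).tendsto 0 |>.comp h2
    simp only [Function.comp_def, ← ENNReal.rpow_two, ← ENNReal.rpow_mul] at this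
    norm_num at this
    simpa using this
  have h1 := ENNReal.Tendsto.const_mul (a := ENNReal.ofReal C) hpl (Or.inr ENNReal.ofReal_ne_top)
  have h12 := h1.add h2'
  rw [mul_zero, add_zero] at h12
  refine tendsto_of_tendsto_of_tendsto_of_le_of_le tendsto_const_nhds h12 (fun _ => bot_le)
    fun n => ?_
  have e : (fun x => c n x * p n x - c' x * p' x) =
      (fun x => c n x * (p n x - p' x)) + fun x => (c n x - c' x) * p' x := by
    funext x; simp only [Pi.add_apply]; ring
  simp only
  rw [e]
  refine (eLpNorm_add_le ((hc n).mul ((hp n).sub hp'.1)) (((hc n).sub hc').mul hp'.1)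
    (by norm_num)).trans (add_le_add ?_ le_rfl)
  exact eLpNorm_le_mul_eLpNorm_of_ae_le_mul (.of_forall fun x => by
    rw [Pi.mul_apply, norm_mul]
    exact mul_le_mul_of_nonneg_right (hcb n x) (norm_nonneg _)) 2

variable {R a ν T : ℝ} {u ut g : SpaceTime → ℝ} {Du v : Fin 3 → SpaceTime → ℝ} {u₀ : Space → ℝ}
  {U : ℕ → SpaceTime → ℝ}

theorem Truncation.lip {C : ℝ} {F Φ G : ℝ → ℝ} (tr : Truncation C F Φ G) (p q : ℝ) :
    |F p - F q| ≤ C * |p - q| :=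
  lipschitz_of_deriv tr.contDiff tr.bound_deriv p q

theorem nash_truncation (hR : 0 < R) (ha : 0 < a) (hU : ApproxSeq R a T u ut Du U)
    (hum : Measurable u) (hDum : ∀ j, Measurable (Du j)) (hDu : ∀ j, MemLp (Du j) 2 (muT R a T))
    {C : ℝ} {F Φ G : ℝ → ℝ} (tr : Truncation C F Φ G) {l : ℝ} (hl : 0 < l) (hl2 : l ≤ 1 / 2) :
    ∫⁻ y, ‖F (u y)‖ₑ ^ 2 ∂(muT R a T) ≤
      4 * ENNReal.ofReal (nashC₁ R a * l ^ 2) *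
        (∫⁻ y, ∑ j, ‖deriv F (u y) * Du j y‖ₑ ^ 2 ∂(muT R a T)) +
      4 * ENNReal.ofReal (nashC₂ R a * (l ^ 6)⁻¹) *
        ∫⁻ t in Ioo 0 T, (∫⁻ x, ‖F (u (x, t))‖ₑ ∂(muX R a)) ^ 2 := by
  refine nash_of_tendsto hR ha (W := fun y => F (u y)) (DW := fun j y => deriv F (u y) * Du j y)
    (U := fun n y => F (U n y)) (tr.contDiff.continuous.measurable.comp hum)
    (fun j => (tr.continuous_deriv.measurable.comp hum).mul (hDum j))
    (fun n => tr.contDiff.comp (hU.contDiff n)) (tendsto_eLpNorm_comp_lipschitz tr.lip hU.tendsto)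
    (fun j => ?_) hl hl2
  have e : ∀ n y, fderiv ℝ (fun y => F (U n y)) y (dirX j) =
      deriv F (U n y) * fderiv ℝ (U n) y (dirX j) := by
    intro n y
    have d1 : HasFDerivAt (fun y => F (U n y)) _ y :=
      (tr.contDiff.differentiable (by norm_num) (U n y)).hasDerivAt.comp_hasFDerivAt y
        ((hU.contDiff n).differentiable (by norm_num) y).hasFDerivAt
    rw [d1.fderiv]
    simp
  simp only [e]
  exact tendsto_eLpNorm_bdd_mul (C := C)
    (fun n => (tr.continuous_deriv.comp (hU.contDiff n).continuous).aestronglyMeasurable)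
    (tr.continuous_deriv.measurable.comp hum).aestronglyMeasurable
    (fun n y => tr.bound_deriv _) (fun y => tr.bound_deriv _)
    (hU.ae_tendsto.mono fun y hy => (tr.continuous_deriv.tendsto _).comp hy)
    (fun n => hU.aesm n _) (hDu j) (hU.tendsto_x j)

theorem ApproxSeq.congr (hU : ApproxSeq R a T u ut Du U) {u' : SpaceTime → ℝ}
    {Du' : Fin 3 → SpaceTime → ℝ} (hu : u =ᵐ[muT R a T] u')
    (hDu : ∀ j, Du j =ᵐ[muT R a T] Du' j) : ApproxSeq R a T u' ut Du' U where
  contDiff := hU.contDiff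
  tendsto := by
    refine hU.tendsto.congr fun n => eLpNorm_congr_ae ?_
    filter_upwards [hu] with y hy
    rw [hy]
  tendsto_t := hU.tendsto_t
  tendsto_x j := by
    refine (hU.tendsto_x j).congr fun n => eLpNorm_congr_ae ?_
    filter_upwards [hDu j] with y hy
    rw [hy]
  ae_tendsto := by
    filter_upwards [hu, hU.ae_tendsto] with y hy h
    rwa [← hy]

/-- Representatives that are measurable everywhere make all time slices and level sets measurable.
-/
theorem SwirlSystem.exists_energySystem (S : SwirlSystem R a ν T u ut g Du v u₀) (hR : 0 < R)
    (ha : 0 < a) (hT : 0 < T) :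
    ∃ u' Du', u =ᵐ[muT R a T] u' ∧ EnergySystem R a ν T u' g Du' u₀ := by
  obtain ⟨U, hU⟩ := S.exists_approxSeq hR ha hT
  have hu := S.memLp_u.1.ae_eq_mk
  have hDu := fun j => (S.memLp_x j).1.ae_eq_mk
  refine ⟨_, fun j => (S.memLp_x j).1.mk (Du j), hu, ?_⟩
  have hU' := hU.congr hu hDu
  have hm := S.memLp_u.1.stronglyMeasurable_mk.measurable
  have hDm := fun j => (S.memLp_x j).1.stronglyMeasurable_mk.measurable
  have hD2 := fun j => (S.memLp_x j).ae_eq (hDu j)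
  refine ⟨hm, hDm, S.memLp_u.ae_eq hu, hD2, S.memLp_g, S.memLp_u₀, ?_, ?_⟩
  · intro C F Φ G ζ tr hζ hζT
    have h := energy_identity S hU hR hT tr hζ hζT
    refine Eq.trans ?_ h
    refine congrArg₂ _ (congrArg₂ _ ?_ rfl) ?_
    · apply integral_congr_ae
      filter_upwards [hu] with y hy
      rw [← hy]
    · apply integral_congr_ae
      filter_upwards [hu, ae_all_iff.2 hDu] with y hy hDy
      simp only [energyRate, ← hy, ← hDy]
  · exact fun tr _ hl hl2 => nash_truncation hR ha hU' hm hDm hD2 tr hl hl2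

theorem Truncation.deriv_reflect (F : ℝ → ℝ) (s : ℝ) :
    deriv (fun s => -F (-s)) s = deriv F (-s) := by
  rw [deriv.fun_neg, deriv_comp_neg, neg_neg]

/-- The reflected truncations transfer every estimate from `u` to `-u`, so upper bounds alone have
to be proved. -/
theorem Truncation.reflect {C : ℝ} {F Φ G : ℝ → ℝ} (tr : Truncation C F Φ G) :
    Truncation C (fun s => -F (-s)) (fun s => Φ (-s)) (fun s => G (-s)) where
  contDiff := (tr.contDiff.comp contDiff_neg).neg
  contDiff_prim := tr.contDiff_prim.comp contDiff_neg
  contDiff_mom := tr.contDiff_mom.comp contDiff_neg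
  deriv_prim s := by rw [deriv_comp_neg, tr.deriv_prim]
  deriv_mom s := by rw [Truncation.deriv_reflect, deriv_comp_neg, tr.deriv_mom]; ring
  bound s := by rw [abs_neg]; exact tr.bound _
  bound_deriv s := by rw [Truncation.deriv_reflect]; exact tr.bound_deriv _
  bound_mom s := by
    rw [Truncation.deriv_reflect]
    have := tr.bound_mom (-s)
    rwa [neg_mul, abs_neg] at this
  mom_zero := by rw [neg_zero, tr.mom_zero]

theorem EnergySystem.neg (S : EnergySystem R a ν T u g Du u₀) :
    EnergySystem R a ν T (fun y => -u y) (fun y => -g y) (fun j y => -Du j y)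
      (fun x => -u₀ x) where
  meas_u := S.meas_u.neg
  meas_x j := (S.meas_x j).neg
  memLp_u := S.memLp_u.neg
  memLp_x j := (S.memLp_x j).neg
  memLp_g := S.memLp_g.neg
  memLp_u₀ := S.memLp_u₀.neg
  energy {C F Φ G ζ} tr hζ hζT := by
    have h := S.energy tr.reflect hζ hζT
    refine Eq.trans ?_ h
    congr 3
    ext y
    simp only [energyRate, Truncation.deriv_reflect, neg_sq]
    ring
  nash {C F Φ G} tr l hl hl2 := by
    have h := S.nash tr.reflect hl hl2
    simp only [Truncation.deriv_reflect, enorm_neg, mul_neg] at h ⊢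
    exact h

/-- A function whose weak derivative is integrable is the primitive of this derivative. -/
theorem ae_eq_integral_of_weak_deriv {y q : ℝ → ℝ} {y₀ : ℝ} (hT : 0 < T)
    (hy : IntegrableOn y (Ioo 0 T)) (hq : IntegrableOn q (Ioo 0 T))
    (h : ∀ ζ : ℝ → ℝ, ContDiff ℝ ∞ ζ → ζ T = 0 →
      (∫ t in Ioo 0 T, y t * deriv ζ t) + ζ 0 * y₀ + (∫ t in Ioo 0 T, q t * ζ t) = 0) :
    ∀ᵐ t ∂(volume.restrict (Ioo 0 T)), y t = y₀ + ∫ s in Ioo 0 t, q s := by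
  have hI : ∀ t, 0 ≤ t → (∫ s in Ioo 0 t, q s) = ∫ s in (0 : ℝ)..t, q s := fun t ht => by
    rw [intervalIntegral.integral_of_le ht, integral_Ioc_eq_integral_Ioo]
  have hqi : IntervalIntegrable q volume 0 T := by
    rwa [intervalIntegrable_iff_integrableOn_Ioo_of_le hT.le]
  have hPc : ContinuousOn (fun t => ∫ s in (0 : ℝ)..t, q s) (uIcc 0 T) :=
    intervalIntegral.continuousOn_primitive_interval'
      hqi left_mem_uIcc
  rw [uIcc_of_le hT.le] at hPc
  set P : ℝ → ℝ := fun t => ∫ s in (0 : ℝ)..t, q s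
  have hPi : IntegrableOn P (Ioo 0 T) :=
    (hPc.integrableOn_Icc).mono_set Ioo_subset_Icc_self
  have hloc : LocallyIntegrableOn (fun t => y t - (y₀ + P t)) (Ioo 0 T) := by
    have : IntegrableOn (fun t => y t - (y₀ + P t)) (Ioo 0 T) :=
      hy.sub ((integrableOn_const (by simp)).add hPi)
    exact this.locallyIntegrableOn
  have hmain := isOpen_Ioo.ae_eq_zero_of_integral_contDiff_smul_eq_zero hloc ?_
  · rw [ae_restrict_iff' measurableSet_Ioo]
    filter_upwards [hmain] with t ht htI
    rw [hI t htI.1.le]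
    linarith [ht htI]
  intro ψ hψ hψc hψI
  have hψT : ∀ t, t ∉ Ioo 0 T → ψ t = 0 := fun t ht =>
    image_eq_zero_of_notMem_tsupport fun h => ht (hψI h)
  -- The primitive is normalised at `T`, which makes `ζ` admissible; its value `-∫ψ` at `0` carries
  -- the initial datum.
  set ζ : ℝ → ℝ := fun t => ∫ s in T..t, ψ s
  have hζd : ∀ t, HasDerivAt ζ (ψ t) t := fun t =>
    intervalIntegral.integral_hasDerivAt_right (hψ.continuous.intervalIntegrable _ _)
      (hψ.continuous.stronglyMeasurableAtFilter _ _) hψ.continuous.continuousAt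
  have hζ' : deriv ζ = ψ := funext fun t => (hζd t).deriv
  have hζ : ContDiff ℝ ∞ ζ := contDiff_infty_iff_deriv.2
    ⟨fun t => (hζd t).differentiableAt, by rwa [hζ']⟩
  have hζT : ζ T = 0 := intervalIntegral.integral_same
  have hmain := h ζ hζ hζT
  rw [hζ'] at hmain
  have hparts : (∫ t in Ioo 0 T, q t * ζ t) = -∫ t in Ioo 0 T, P t * ψ t := by
    have hζa : AbsolutelyContinuousOnInterval ζ 0 T :=
      (hζ.of_le (by simp)).contDiffOn.absolutelyContinuousOnInterval
    have hPa : AbsolutelyContinuousOnInterval P 0 T :=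
      hqi.absolutelyContinuousOnInterval_intervalIntegral left_mem_uIcc
    have e := hPa.integral_mul_deriv_eq_deriv_mul hζa
    have e' : ∫ t in (0 : ℝ)..T, deriv P t * ζ t = ∫ t in (0 : ℝ)..T, q t * ζ t := by
      apply intervalIntegral.integral_congr_ae
      filter_upwards [hqi.ae_hasDerivAt_integral] with t ht htI
      rw [(ht (uIoc_subset_uIcc htI) 0 left_mem_uIcc).deriv]
    have hP0 : P 0 = 0 := intervalIntegral.integral_same
    rw [hζT, e', hζ', hP0, intervalIntegral.integral_of_le hT.le,
      intervalIntegral.integral_of_le hT.le, integral_Ioc_eq_integral_Ioo,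
      integral_Ioc_eq_integral_Ioo] at e
    rw [e]
    ring
  have hζ0 : ζ 0 = -∫ t in Ioo 0 T, ψ t := by
    simp only [ζ]
    rw [intervalIntegral.integral_symm, intervalIntegral.integral_of_le hT.le,
      integral_Ioc_eq_integral_Ioo]
  obtain ⟨K, hK⟩ := hψc.exists_bound_of_continuous hψ.continuous
  have hb : ∀ {f : ℝ → ℝ}, IntegrableOn f (Ioo 0 T) → IntegrableOn (fun t => f t * ψ t) (Ioo 0 T) :=
    fun hf => hf.mul_bdd hψ.continuous.aestronglyMeasurable (.of_forall hK)
  have hψi : IntegrableOn ψ (Ioo 0 T) := (hψ.continuous.integrable_of_hasCompactSupport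
    hψc).integrableOn
  have e1 : ∫ t, ψ t • (y t - (y₀ + P t)) =
      ∫ t in Ioo 0 T, (y t * ψ t - (y₀ * ψ t + P t * ψ t)) := by
    rw [setIntegral_eq_integral_of_forall_compl_eq_zero]
    · congr 1; ext t; rw [smul_eq_mul]; ring
    · intro t ht; rw [hψT t ht]; ring
  have i2 : IntegrableOn (fun t => y₀ * ψ t) (Ioo 0 T) := hψi.const_mul y₀
  have e2 := integral_sub (hb hy) (i2.add (hb hPi))
  have e3 := integral_add i2 (hb hPi)
  rw [integral_const_mul] at e3
  rw [e1]
  refine e2.trans ?_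
  simp only [Pi.add_apply]
  rw [hζ0, hparts] at hmain
  rw [e3]
  linarith

end AxisymNS

/-! ### Smooth truncations at level `k` and the pointwise bound of the energy rate. -/

namespace AxisymNS

theorem hasDerivAt_primitive {f : ℝ → ℝ} (hf : Continuous f) (k s : ℝ) :
    HasDerivAt (fun s => ∫ r in k..s, f r) (f s) s :=
  intervalIntegral.integral_hasDerivAt_right (hf.intervalIntegrable _ _)
    (hf.stronglyMeasurableAtFilter _ _) hf.continuousAt

theorem deriv_primitive {f : ℝ → ℝ} (hf : Continuous f) (k : ℝ) :
    deriv (fun s => ∫ r in k..s, f r) = f :=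
  funext fun s => (hasDerivAt_primitive hf k s).deriv

theorem contDiff_primitive {f : ℝ → ℝ} (hf : ContDiff ℝ ∞ f) (k : ℝ) :
    ContDiff ℝ ∞ fun s => ∫ r in k..s, f r :=
  contDiff_infty_iff_deriv.2 ⟨fun s => (hasDerivAt_primitive hf.continuous k s).differentiableAt,
    by rwa [deriv_primitive hf.continuous]⟩

theorem integral_eq_zero_of_le {f : ℝ → ℝ} {k s : ℝ} (hf : ∀ r ≤ k, f r = 0) (hs : s ≤ k) :
    ∫ r in k..s, f r = 0 := by
  rw [intervalIntegral.integral_congr (g := fun _ => 0), intervalIntegral.integral_zero]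
  intro r hr
  rw [uIcc_of_ge hs] at hr
  exact hf r hr.2

/-- A smooth compactly supported approximation of the indicator function of `(k, ∞)`. -/
def cut (k : ℝ) (m : ℕ) (s : ℝ) : ℝ :=
  Real.smoothTransition (m * (s - k)) * (1 - Real.smoothTransition (s - k - m))

/-- A smooth bounded approximation of `(s - k)₊`. -/
def cutF (k : ℝ) (m : ℕ) (s : ℝ) : ℝ := ∫ r in k..s, cut k m r

/-- The primitive of `cutF`. -/
def cutPrim (k : ℝ) (m : ℕ) (s : ℝ) : ℝ := ∫ r in k..s, cutF k m r

/-- The primitive of `s * cut k m s`. -/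
def cutMom (k : ℝ) (m : ℕ) (s : ℝ) : ℝ := ∫ r in k..s, r * cut k m r

section Cut

variable {k : ℝ} {m : ℕ} {s : ℝ}

theorem contDiff_cut (k : ℝ) (m : ℕ) : ContDiff ℝ ∞ (cut k m) := by
  unfold cut
  exact (Real.smoothTransition.contDiff.comp (by fun_prop)).mul
    (contDiff_const.sub (Real.smoothTransition.contDiff.comp (by fun_prop)))

theorem cut_nonneg (k : ℝ) (m : ℕ) (s : ℝ) : 0 ≤ cut k m s :=
  mul_nonneg (Real.smoothTransition.nonneg _) (sub_nonneg.2 (Real.smoothTransition.le_one _))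

theorem cut_le_one (k : ℝ) (m : ℕ) (s : ℝ) : cut k m s ≤ 1 :=
  mul_le_one₀ (Real.smoothTransition.le_one _) (sub_nonneg.2 (Real.smoothTransition.le_one _))
    (sub_le_self _ (Real.smoothTransition.nonneg _))

theorem cut_of_le (m : ℕ) (hs : s ≤ k) : cut k m s = 0 := by
  rw [cut, Real.smoothTransition.zero_of_nonpos, zero_mul]
  exact mul_nonpos_of_nonneg_of_nonpos m.cast_nonneg (sub_nonpos.2 hs)

theorem cut_of_ge (hs : k + m + 1 ≤ s) : cut k m s = 0 := by
  rw [cut, Real.smoothTransition.one_of_one_le (x := s - k - m) (by linarith), sub_self, mul_zero]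

theorem tendsto_cut (hs : k < s) : Tendsto (fun m => cut k m s) atTop (𝓝 1) := by
  refine tendsto_const_nhds.congr' ?_
  have h1 : ∀ᶠ m : ℕ in atTop, 1 / (s - k) ≤ m := tendsto_natCast_atTop_atTop.eventually_ge_atTop _
  have h2 : ∀ᶠ m : ℕ in atTop, s - k ≤ m := tendsto_natCast_atTop_atTop.eventually_ge_atTop _
  filter_upwards [h1, h2] with m hm1 hm2
  rw [div_le_iff₀ (by linarith)] at hm1
  rw [cut, Real.smoothTransition.one_of_one_le hm1, Real.smoothTransition.zero_of_nonpos
    (by linarith)]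
  norm_num

theorem deriv_cutF (k : ℝ) (m : ℕ) : deriv (cutF k m) = cut k m :=
  deriv_primitive (contDiff_cut k m).continuous k

theorem contDiff_cutF (k : ℝ) (m : ℕ) : ContDiff ℝ ∞ (cutF k m) :=
  contDiff_primitive (contDiff_cut k m) k

theorem cutF_of_le (m : ℕ) (hs : s ≤ k) : cutF k m s = 0 :=
  integral_eq_zero_of_le (fun _ hr => cut_of_le m hr) hs

theorem cutF_nonneg (k : ℝ) (m : ℕ) (s : ℝ) : 0 ≤ cutF k m s := by
  rcases le_total s k with h | h
  · rw [cutF_of_le m h]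
  · exact intervalIntegral.integral_nonneg h fun r _ => cut_nonneg k m r

theorem cutF_le_sub (m : ℕ) (hs : k ≤ s) : cutF k m s ≤ s - k := by
  have := intervalIntegral.integral_mono_on hs
    ((contDiff_cut k m).continuous.intervalIntegrable (μ := volume) _ _)
    ((continuous_const (y := (1 : ℝ))).intervalIntegrable _ _) fun r _ => cut_le_one k m r
  simpa [cutF] using this

theorem cutF_le (k : ℝ) (m : ℕ) (s : ℝ) : cutF k m s ≤ max (s - k) 0 := by
  rcases le_total s k with h | h
  · rw [cutF_of_le m h]; exact le_max_right _ _
  · exact (cutF_le_sub m h).trans (le_max_left _ _)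

theorem abs_cutF_le (k : ℝ) (m : ℕ) (s : ℝ) : |cutF k m s| ≤ m + 1 := by
  rw [abs_of_nonneg (cutF_nonneg k m s)]
  rcases le_total s (k + m + 1) with h | h
  · refine (cutF_le k m s).trans (max_le (by linarith) (by positivity))
  · have hc := (contDiff_cut k m).continuous
    have e : cutF k m s = cutF k m (k + m + 1) + ∫ r in (k + m + 1)..s, cut k m r :=
      (intervalIntegral.integral_add_adjacent_intervals (hc.intervalIntegrable _ _)
        (hc.intervalIntegrable _ _)).symm
    have e0 : ∫ r in (k + m + 1)..s, cut k m r = 0 := by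
      rw [intervalIntegral.integral_congr (g := fun _ => 0), intervalIntegral.integral_zero]
      intro r hr
      rw [uIcc_of_le h] at hr
      exact cut_of_ge hr.1
    rw [e, e0, add_zero]
    refine (cutF_le_sub m (by linarith [m.cast_nonneg (α := ℝ)])).trans (by linarith)

theorem tendsto_cutF (k s : ℝ) : Tendsto (fun m => cutF k m s) atTop (𝓝 (max (s - k) 0)) := by
  rcases le_total s k with h | h
  · simp only [cutF_of_le _ h, max_eq_right (sub_nonpos.2 h)]
    exact tendsto_const_nhds
  · rw [max_eq_left (sub_nonneg.2 h)]
    have e : ∫ _ in k..s, (1 : ℝ) = s - k := by simp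
    rw [← e]
    refine intervalIntegral.tendsto_integral_filter_of_dominated_convergence (fun _ => 1)
      (.of_forall fun m => (contDiff_cut k m).continuous.aestronglyMeasurable)
      (.of_forall fun m => .of_forall fun r _ => ?_) (by simp) (.of_forall fun r hr => ?_)
    · rw [Real.norm_of_nonneg (cut_nonneg k m r)]; exact cut_le_one k m r
    · rw [uIoc_of_le h] at hr
      exact tendsto_cut hr.1

theorem cutPrim_of_le (m : ℕ) (hs : s ≤ k) : cutPrim k m s = 0 :=
  integral_eq_zero_of_le (fun _ hr => cutF_of_le m hr) hs

theorem cutPrim_nonneg (k : ℝ) (m : ℕ) (s : ℝ) : 0 ≤ cutPrim k m s := by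
  rcases le_total s k with h | h
  · rw [cutPrim_of_le m h]
  · exact intervalIntegral.integral_nonneg h fun r _ => cutF_nonneg k m r

theorem tendsto_cutPrim (k s : ℝ) :
    Tendsto (fun m => cutPrim k m s) atTop (𝓝 (max (s - k) 0 ^ 2 / 2)) := by
  rcases le_total s k with h | h
  · simp only [cutPrim_of_le _ h, max_eq_right (sub_nonpos.2 h)]
    simp
  · rw [max_eq_left (sub_nonneg.2 h)]
    have e : ∫ r in k..s, (r - k) = (s - k) ^ 2 / 2 := by
      rw [intervalIntegral.integral_comp_sub_right (fun r => r), integral_id]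
      ring
    rw [← e]
    refine intervalIntegral.tendsto_integral_filter_of_dominated_convergence (fun r => |r - k|)
      (.of_forall fun m => (contDiff_cutF k m).continuous.aestronglyMeasurable)
      (.of_forall fun m => .of_forall fun r hr => ?_)
      ((by fun_prop : Continuous fun r => |r - k|).intervalIntegrable _ _)
      (.of_forall fun r hr => ?_)
    · rw [uIoc_of_le h] at hr
      rw [Real.norm_of_nonneg (cutF_nonneg k m r)]
      exact (cutF_le_sub m hr.1.le).trans (le_abs_self _)
    · rw [uIoc_of_le h] at hr
      have := tendsto_cutF k r
      rwa [max_eq_left (sub_nonneg.2 hr.1.le)] at this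

theorem cutMom_of_le (m : ℕ) (hs : s ≤ k) : cutMom k m s = 0 :=
  integral_eq_zero_of_le (fun r hr => by rw [cut_of_le m hr, mul_zero]) hs

/-- The bound is `∫_k^s r dr = (s² - k²)/2`, which is below the right-hand side by `(s - 2k)²/2 +
k²/2`. -/
theorem abs_cutMom_le (m : ℕ) (hk : 0 ≤ k) (hs : k ≤ s) :
    |cutMom k m s| ≤ k ^ 2 + (s - k) ^ 2 := by
  have hc := (contDiff_cut k m).continuous
  have h0 : 0 ≤ cutMom k m s := intervalIntegral.integral_nonneg hs fun r hr =>
    mul_nonneg (hk.trans hr.1) (cut_nonneg k m r)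
  have h1 : cutMom k m s ≤ ∫ r in k..s, r := intervalIntegral.integral_mono_on hs
    ((continuous_id.mul hc).intervalIntegrable _ _) (continuous_id.intervalIntegrable _ _)
    fun r hr => mul_le_of_le_one_right (hk.trans hr.1) (cut_le_one k m r)
  rw [integral_id] at h1
  rw [abs_of_nonneg h0]
  nlinarith [sq_nonneg (s - 2 * k)]

/-- The constant is the right end of the interval carrying `cut k m`, as needed for `s F'(s)`. It
grows with `m` harmlessly: it serves only the passages to the limit and does not enter the energy
balance. -/
theorem truncation_cut (hk : 0 ≤ k) (m : ℕ) :
    Truncation (k + m + 1) (cutF k m) (cutPrim k m) (cutMom k m) where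
  contDiff := contDiff_cutF k m
  contDiff_prim := contDiff_primitive (contDiff_cutF k m) k
  contDiff_mom := contDiff_primitive (contDiff_id.mul (contDiff_cut k m)) k
  deriv_prim s := congrFun (deriv_primitive (contDiff_cutF k m).continuous k) s
  deriv_mom s := by
    rw [deriv_cutF]
    exact congrFun (deriv_primitive (continuous_id.mul (contDiff_cut k m).continuous) k) s
  bound s := (abs_cutF_le k m s).trans (by linarith)
  bound_deriv s := by
    rw [deriv_cutF, abs_of_nonneg (cut_nonneg k m s)]
    exact (cut_le_one k m s).trans (by linarith [m.cast_nonneg (α := ℝ)])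
  bound_mom s := by
    rw [deriv_cutF]
    have hm := m.cast_nonneg (α := ℝ)
    by_cases h : k < s ∧ s < k + m + 1
    · rw [abs_of_nonneg (mul_nonneg (by linarith) (cut_nonneg k m s))]
      exact (mul_le_of_le_one_right (by linarith) (cut_le_one k m s)).trans h.2.le
    · have : cut k m s = 0 := by
        rcases not_and_or.1 h with h | h
        · exact cut_of_le m (not_lt.1 h)
        · exact cut_of_ge (not_lt.1 h)
      rw [this, mul_zero, abs_zero]
      positivity
  mom_zero := cutMom_of_le m hk

end Cut

/-- The density `1_{s > k} (k² + (s - k)²)`. -/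
def levelDensity (k s : ℝ) : ℝ := (Ioi k).indicator (fun s => k ^ 2 + (s - k) ^ 2) s

theorem levelDensity_nonneg (k s : ℝ) : 0 ≤ levelDensity k s :=
  indicator_nonneg (fun s _ => by positivity) s

theorem measurable_levelDensity (k : ℝ) : Measurable (levelDensity k) :=
  Measurable.indicator (by fun_prop) measurableSet_Ioi

theorem levelDensity_le (k s : ℝ) : levelDensity k s ≤ 3 * k ^ 2 + 2 * s ^ 2 := by
  by_cases h : k < s
  · rw [levelDensity, indicator_of_mem (mem_Ioi.2 h)]
    nlinarith [sq_nonneg (s + k)]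
  · rw [levelDensity, indicator_of_notMem (by simpa using h)]
    positivity

variable {R a ν T : ℝ} {u g : SpaceTime → ℝ} {Du : Fin 3 → SpaceTime → ℝ} {u₀ : Space → ℝ}

/-- The force is harmless because `|g| ≤ k` gives `F g ≤ (u-k)k`. In the off-axis term Young's
inequality spends `2ν · 1/4 = ν/2` of the dissipation, so `ν/2` is left. The constants are `2ν ·
64/R²` from that term and `2ν · 2K` from the `G` term. -/
theorem energyRate_le (hR : 0 < R) (hν : 0 < ν) {K : ℝ} {k : ℝ} (hk : 0 < k) (m : ℕ)
    {y : SpaceTime} (hy : y ∈ cylT R a T) (hK : |deriv (axisCutoff R) (axSq y)| ≤ K)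
    (hg : |g y| ≤ k) :
    energyRate R ν (cutF k m) (cutMom k m) u g Du y ≤
      (1 + 128 * ν / R ^ 2 + 4 * ν * K) * levelDensity k (u y) -
        ν / 2 * (cut k m (u y) * ∑ j, Du j y ^ 2) := by
  have hK0 : 0 ≤ K := (abs_nonneg _).trans hK
  rw [energyRate, deriv_cutF]
  rcases le_or_gt (u y) k with h | h
  · rw [cutF_of_le m h, cut_of_le m h, cutMom_of_le m h]
    have := levelDensity_nonneg k (u y)
    have : 0 ≤ (1 + 128 * ν / R ^ 2 + 4 * ν * K) * levelDensity k (u y) := by positivity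
    simpa using this
  have e : levelDensity k (u y) = k ^ 2 + (u y - k) ^ 2 := indicator_of_mem h _
  have hc0 := cut_nonneg k m (u y)
  have hc1 := cut_le_one k m (u y)
  have t1 : cutF k m (u y) * g y ≤ levelDensity k (u y) := by
    have := cutF_nonneg k m (u y)
    have h1 := cutF_le_sub m h.le
    rw [e]
    calc cutF k m (u y) * g y ≤ (u y - k) * k :=
        (mul_le_mul_of_nonneg_left ((le_abs_self _).trans hg) this).trans
          (mul_le_mul_of_nonneg_right h1 hk.le)
      _ ≤ _ := by nlinarith [sq_nonneg (u y - k - k)]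
  have t2 : -(cutMom k m (u y) * (2 * deriv (axisCutoff R) (axSq y))) ≤
      2 * K * levelDensity k (u y) := by
    rw [e]
    refine (neg_le_abs _).trans ?_
    rw [abs_mul, abs_mul, abs_two]
    calc _ ≤ (k ^ 2 + (u y - k) ^ 2) * (2 * K) :=
          mul_le_mul (abs_cutMom_le m hk.le h.le) (by gcongr) (by positivity) (by positivity)
      _ = _ := by ring
  have hx : ∀ i : Fin 3, i ≠ 2 → |y.1 i| ≤ R := by
    intro i hi
    refine abs_le_of_sq_le_sq ?_ hR.le
    have h1 := axSq_lt_of_mem hR hy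
    unfold axSq at h1
    fin_cases i
    · simp; nlinarith [sq_nonneg (y.1 1)]
    · simp; nlinarith [sq_nonneg (y.1 0)]
    · exact absurd rfl hi
  have t3 : axisCoef R y * u y * (y.1 0 * Du 0 y + y.1 1 * Du 1 y) ≤
      1 / 4 * ∑ j, Du j y ^ 2 + 64 / R ^ 2 * levelDensity k (u y) := by
    have hu : 0 < u y := hk.trans h
    have c0 := axisCoef_nonneg R y
    have hb : |y.1 0 * Du 0 y + y.1 1 * Du 1 y| ≤ R * |Du 0 y| + R * |Du 1 y| := by
      refine (abs_add_le _ _).trans ?_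
      rw [abs_mul, abs_mul]
      gcongr
      · exact hx 0 (by decide)
      · exact hx 1 (by decide)
    calc axisCoef R y * u y * (y.1 0 * Du 0 y + y.1 1 * Du 1 y)
        ≤ axisCoef R y * u y * (R * |Du 0 y| + R * |Du 1 y|) := by
          exact mul_le_mul_of_nonneg_left ((le_abs_self _).trans hb) (by positivity)
      _ ≤ 4 / R ^ 2 * u y * (R * |Du 0 y| + R * |Du 1 y|) := by
          gcongr
          exact axisCoef_le hR y
      _ = 4 * (u y / R) * |Du 0 y| + 4 * (u y / R) * |Du 1 y| := by field_simp
      -- With `c = u/R`, `4cd ≤ d²/4 + 16c²` for each of the two derivatives; next, `u² ≤ 2(k² +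
      -- (u-k)²)` turns 32 into 64.
      _ ≤ 1 / 4 * (|Du 0 y| ^ 2 + |Du 1 y| ^ 2) + 32 * (u y / R) ^ 2 := by
          nlinarith [sq_nonneg (|Du 0 y| - 8 * (u y / R)), sq_nonneg (|Du 1 y| - 8 * (u y / R))]
      _ ≤ 1 / 4 * ∑ j, Du j y ^ 2 + 64 / R ^ 2 * levelDensity k (u y) := by
          rw [Fin.sum_univ_three, sq_abs, sq_abs, e]
          have : 32 * (u y / R) ^ 2 ≤ 64 / R ^ 2 * (k ^ 2 + (u y - k) ^ 2) := by
            rw [div_pow, ← mul_div_assoc, div_mul_eq_mul_div]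
            refine div_le_div_of_nonneg_right ?_ (sq_nonneg _)
            nlinarith [sq_nonneg (u y - 2 * k)]
          nlinarith [sq_nonneg (Du 2 y)]
  have t4 : cut k m (u y) * (axisCoef R y * u y * (y.1 0 * Du 0 y + y.1 1 * Du 1 y)) ≤
      1 / 4 * (cut k m (u y) * ∑ j, Du j y ^ 2) + 64 / R ^ 2 * levelDensity k (u y) := by
    have h1 := mul_le_mul_of_nonneg_left t3 hc0
    have h2 : cut k m (u y) * (64 / R ^ 2 * levelDensity k (u y)) ≤
        64 / R ^ 2 * levelDensity k (u y) := mul_le_of_le_one_left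
      (mul_nonneg (by positivity) (levelDensity_nonneg _ _)) hc1
    linarith
  have t5 := mul_le_mul_of_nonneg_left (add_le_add t4 t2) (by positivity : 0 ≤ 2 * ν)
  calc _ ≤ levelDensity k (u y) - ν * (cut k m (u y) * ∑ j, Du j y ^ 2) +
        2 * ν * (1 / 4 * (cut k m (u y) * ∑ j, Du j y ^ 2) + 64 / R ^ 2 * levelDensity k (u y) +
        2 * K * levelDensity k (u y)) := by linarith
    _ = _ := by ring

end AxisymNS

/-! ### The energy inequality on level sets. -/

namespace AxisymNS

variable {R a ν T : ℝ} {u g : SpaceTime → ℝ} {Du : Fin 3 → SpaceTime → ℝ} {u₀ : Space → ℝ}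

theorem muT_le {t : ℝ} (ht : t ≤ T) : muT R a t ≤ muT R a T :=
  Measure.restrict_mono (prod_mono Subset.rfl (Ioo_subset_Ioo_right ht)) le_rfl

/-- By Fubini the energy balance is a weak differential equation for `t ↦ ∫ Φ(u(·, t))`, so this
function is a primitive of the rate, for almost every `t`. -/
theorem EnergySystem.slice_identity (S : EnergySystem R a ν T u g Du u₀) (hR : 0 < R) (hT : 0 < T)
    {C : ℝ} {F Φ G : ℝ → ℝ} (tr : Truncation C F Φ G) :
    ∀ᵐ t ∂(volume.restrict (Ioo 0 T)), ∫ x, Φ (u (x, t)) ∂(muX R a) =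
      (∫ x, Φ (u₀ x) ∂(muX R a)) + ∫ y, energyRate R ν F G u g Du y ∂(muT R a t) := by
  have hΦ : Integrable (fun y => Φ (u y)) (muT R a T) :=
    (memLp_comp_lipschitz tr.contDiff_prim.continuous tr.lip_prim S.memLp_u).integrable
      (by norm_num)
  have hr := integrable_energyRate (ν := ν) hR tr S.memLp_u S.memLp_x S.memLp_g
  have hΦ' := hΦ
  have hr' := hr
  rw [muT_eq_prod] at hΦ' hr'
  have hprod : ∀ {f : SpaceTime → ℝ} {ζ : ℝ → ℝ}, Integrable f (muT R a T) → Continuous ζ →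
      ∫ y, f y * ζ y.2 ∂(muT R a T) = ∫ t in Ioo 0 T, (∫ x, f (x, t) ∂(muX R a)) * ζ t := by
    intro f ζ hf hζ
    have : Integrable (fun y => f y * ζ y.2) (muT R a T) :=
      integrable_mul_continuous hf (hζ.comp continuous_snd)
    rw [muT_eq_prod] at this ⊢
    rw [integral_prod_symm _ this]
    simp only [integral_mul_const]
  have key := ae_eq_integral_of_weak_deriv (y := fun t => ∫ x, Φ (u (x, t)) ∂(muX R a))
    (q := fun t => ∫ x, energyRate R ν F G u g Du (x, t) ∂(muX R a))
    (y₀ := ∫ x, Φ (u₀ x) ∂(muX R a)) hT hΦ'.integral_prod_right hr'.integral_prod_right ?_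
  · filter_upwards [key, ae_restrict_mem measurableSet_Ioo] with t ht htI
    rw [ht]
    have := hr.mono_measure (muT_le htI.2.le)
    rw [muT_eq_prod] at this ⊢
    rw [integral_prod_symm _ this]
  · intro ζ hζ hζT
    rw [← hprod hΦ (hζ.continuous_deriv (by norm_num)), ← hprod hr hζ.continuous]
    exact S.energy tr hζ hζT

/-- The constant in the energy inequality. -/
def levelConst (R ν K : ℝ) : ℝ := 1 + 128 * ν / R ^ 2 + 4 * ν * K

/-- The integral of the level density. -/
def levelMass (R a : ℝ) (u : SpaceTime → ℝ) (k t : ℝ) : ℝ≥0∞ :=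
  ∫⁻ y, ENNReal.ofReal (levelDensity k (u y)) ∂(muT R a t)

theorem integrable_levelDensity (hu : MemLp u 2 (muT R a T)) (hum : Measurable u) (k : ℝ) :
    Integrable (fun y => levelDensity k (u y)) (muT R a T) := by
  refine ((integrable_const (3 * k ^ 2)).add (hu.integrable_sq.const_mul 2)).mono'
    ((measurable_levelDensity k).comp hum).aestronglyMeasurable (.of_forall fun y => ?_)
  rw [Real.norm_of_nonneg (levelDensity_nonneg _ _)]
  exact levelDensity_le _ _

theorem EnergySystem.energy_le_of_cut (S : EnergySystem R a ν T u g Du u₀) (hR : 0 < R)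
    (hν : 0 < ν) (hT : 0 < T) {K : ℝ} (hK : ∀ᵐ y ∂(muT R a T), |deriv (axisCutoff R) (axSq y)| ≤ K)
    (hK0 : 0 ≤ K) {k : ℝ} (hk : 0 < k) (hu₀ : ∀ᵐ x ∂(muX R a), u₀ x ≤ k)
    (hg : ∀ᵐ y ∂(muT R a T), |g y| ≤ k) (m : ℕ) :
    ∀ᵐ t ∂(volume.restrict (Ioo 0 T)),
      (∫⁻ x, ENNReal.ofReal (cutPrim k m (u (x, t))) ∂(muX R a)) + ENNReal.ofReal (ν / 2) *
        (∫⁻ y, ENNReal.ofReal (cut k m (u y) * ∑ j, Du j y ^ 2) ∂(muT R a t)) ≤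
      ENNReal.ofReal (levelConst R ν K) * levelMass R a u k t := by
  have tr := truncation_cut hk.le m
  have hΦ : Integrable (fun y => cutPrim k m (u y)) (muT R a T) :=
    (memLp_comp_lipschitz tr.contDiff_prim.continuous tr.lip_prim S.memLp_u).integrable
      (by norm_num)
  have hΦ0 : ∫ x, cutPrim k m (u₀ x) ∂(muX R a) = 0 := by
    rw [integral_congr_ae (g := fun _ => 0), integral_zero]
    filter_upwards [hu₀] with x hx
    exact cutPrim_of_le m hx
  have hr := integrable_energyRate (ν := ν) hR tr S.memLp_u S.memLp_x S.memLp_g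
  have hD : Integrable (fun y => cut k m (u y) * ∑ j, Du j y ^ 2) (muT R a T) :=
    (integrable_finsetSum _ fun j _ => (S.memLp_x j).integrable_sq).bdd_mul (c := 1)
      ((contDiff_cut k m).continuous.comp_aestronglyMeasurable S.memLp_u.1)
      (.of_forall fun y => by
        rw [Real.norm_of_nonneg (cut_nonneg _ _ _)]; exact cut_le_one _ _ _)
  have hD0 : ∀ y, 0 ≤ cut k m (u y) * ∑ j, Du j y ^ 2 := fun y =>
    mul_nonneg (cut_nonneg _ _ _) (Finset.sum_nonneg fun j _ => sq_nonneg _)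
  have hL := integrable_levelDensity S.memLp_u S.meas_u k
  have hC0 : 0 ≤ levelConst R ν K := by unfold levelConst; positivity
  have hle : ∀ᵐ y ∂(muT R a T), energyRate R ν (cutF k m) (cutMom k m) u g Du y ≤
      levelConst R ν K * levelDensity k (u y) - ν / 2 * (cut k m (u y) * ∑ j, Du j y ^ 2) := by
    filter_upwards [hK, hg, ae_restrict_mem (measurableSet_cylT R a T)] with y h1 h2 h3
    exact energyRate_le hR hν hk m h3 h1 h2
  have hΦs : ∀ᵐ t ∂(volume.restrict (Ioo 0 T)),
      Integrable (fun x => cutPrim k m (u (x, t))) (muX R a) := by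
    rw [muT_eq_prod] at hΦ
    exact hΦ.prod_left_ae
  filter_upwards [S.slice_identity hR hT tr, hΦs, ae_restrict_mem measurableSet_Ioo]
    with t ht hΦt htI
  have hmono := muT_le (R := R) (a := a) htI.2.le
  have hLt := hL.mono_measure hmono
  have hDt := hD.mono_measure hmono
  have h1 := integral_mono_ae (hr.mono_measure hmono)
    ((hLt.const_mul (levelConst R ν K)).sub (hDt.const_mul (ν / 2))) (ae_mono hmono hle)
  have h2 := integral_sub (hLt.const_mul (levelConst R ν K)) (hDt.const_mul (ν / 2))
  rw [integral_const_mul, integral_const_mul] at h2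
  have h3 := h1.trans_eq h2
  rw [hΦ0, zero_add] at ht
  rw [← ht] at h3
  have hp1 : 0 ≤ ∫ x, cutPrim k m (u (x, t)) ∂(muX R a) :=
    integral_nonneg fun x => cutPrim_nonneg _ _ _
  have hp2 : 0 ≤ ∫ y, cut k m (u y) * ∑ j, Du j y ^ 2 ∂(muT R a t) := integral_nonneg hD0
  rw [levelMass, ← ofReal_integral_eq_lintegral_ofReal hΦt (.of_forall fun x => cutPrim_nonneg _ _ _),
    ← ofReal_integral_eq_lintegral_ofReal hDt (.of_forall hD0),
    ← ofReal_integral_eq_lintegral_ofReal hLt (.of_forall fun y => levelDensity_nonneg _ _),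
    ← ENNReal.ofReal_mul (by positivity), ← ENNReal.ofReal_mul hC0,
    ← ENNReal.ofReal_add hp1 (by positivity)]
  apply ENNReal.ofReal_le_ofReal
  linarith

/-- The energy of the gradient on the level set `{u > k}`. -/
def levelEnergy (R a : ℝ) (u : SpaceTime → ℝ) (Du : Fin 3 → SpaceTime → ℝ) (k t : ℝ) : ℝ≥0∞ :=
  ∫⁻ y, (u ⁻¹' Ioi k).indicator (fun y => ENNReal.ofReal (∑ j, Du j y ^ 2)) y ∂(muT R a t)

/-- Fatou's lemma as `m → ∞`. Both summands on the left of `energy_le_of_cut` are nonnegative, so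
each is bounded separately. -/
theorem EnergySystem.energy_le (S : EnergySystem R a ν T u g Du u₀) (hR : 0 < R)
    (hν : 0 < ν) (hT : 0 < T) {K : ℝ} (hK : ∀ᵐ y ∂(muT R a T), |deriv (axisCutoff R) (axSq y)| ≤ K)
    (hK0 : 0 ≤ K) {k : ℝ} (hk : 0 < k) (hu₀ : ∀ᵐ x ∂(muX R a), u₀ x ≤ k)
    (hg : ∀ᵐ y ∂(muT R a T), |g y| ≤ k) :
    ∀ᵐ t ∂(volume.restrict (Ioo 0 T)),
      ∫⁻ x, ENNReal.ofReal (max (u (x, t) - k) 0 ^ 2 / 2) ∂(muX R a) ≤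
        ENNReal.ofReal (levelConst R ν K) * levelMass R a u k t ∧
      ENNReal.ofReal (ν / 2) * levelEnergy R a u Du k t ≤
        ENNReal.ofReal (levelConst R ν K) * levelMass R a u k t := by
  have hall := ae_all_iff.2 fun m => S.energy_le_of_cut hR hν hT hK hK0 hk hu₀ hg m
  have hDm := S.meas_x
  have hum := S.meas_u
  filter_upwards [hall] with t ht
  have hm1 : ∀ m, Measurable fun x : Space => ENNReal.ofReal (cutPrim k m (u (x, t))) := fun m =>
    ENNReal.measurable_ofReal.comp ((truncation_cut hk.le m).contDiff_prim.continuous.measurable.comp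
      (hum.comp (by fun_prop)))
  have hm2 : ∀ m, Measurable fun y => ENNReal.ofReal (cut k m (u y) * ∑ j, Du j y ^ 2) := fun m => by
    have := (contDiff_cut k m).continuous.measurable.comp hum
    have : Measurable fun y => cut k m (u y) := this
    fun_prop
  have f1 : (∫⁻ x, ENNReal.ofReal (max (u (x, t) - k) 0 ^ 2 / 2) ∂(muX R a)) ≤
      liminf (fun m => ∫⁻ x, ENNReal.ofReal (cutPrim k m (u (x, t))) ∂(muX R a)) atTop := by
    refine le_trans (lintegral_mono fun x => ?_) (lintegral_liminf_le hm1)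
    exact ((ENNReal.continuous_ofReal.tendsto _).comp (tendsto_cutPrim k (u (x, t)))).liminf_eq.ge
  have f2 : levelEnergy R a u Du k t ≤ liminf (fun m =>
      ∫⁻ y, ENNReal.ofReal (cut k m (u y) * ∑ j, Du j y ^ 2) ∂(muT R a t)) atTop := by
    refine le_trans (lintegral_mono fun y => ?_) (lintegral_liminf_le hm2)
    by_cases h : k < u y
    · rw [indicator_of_mem (show y ∈ u ⁻¹' Ioi k from h)]
      have := ((ENNReal.continuous_ofReal.tendsto _).comp
        ((tendsto_cut h).mul_const (∑ j, Du j y ^ 2))).liminf_eq.ge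
      rwa [one_mul] at this
    · rw [indicator_of_notMem (show y ∉ u ⁻¹' Ioi k from h)]
      exact bot_le
  have f2' : ENNReal.ofReal (ν / 2) * levelEnergy R a u Du k t ≤ liminf (fun m =>
      ENNReal.ofReal (ν / 2) *
        ∫⁻ y, ENNReal.ofReal (cut k m (u y) * ∑ j, Du j y ^ 2) ∂(muT R a t)) atTop := by
    rw [ENNReal.liminf_const_mul_of_ne_top ENNReal.ofReal_ne_top]
    gcongr
  exact ⟨f1.trans (liminf_le_of_frequently_le' (.of_forall fun m => (le_add_right le_rfl).trans
    (ht m))), f2'.trans (liminf_le_of_frequently_le' (.of_forall fun m =>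
      (le_add_left le_rfl).trans (ht m)))⟩

/-- The inequality is known only for almost every `t < T`; both sides are monotone in `t`, and the
cylinder is an increasing union of shorter ones. -/
theorem EnergySystem.levelEnergy_le (S : EnergySystem R a ν T u g Du u₀) (hR : 0 < R)
    (hν : 0 < ν) (hT : 0 < T) {K : ℝ} (hK : ∀ᵐ y ∂(muT R a T), |deriv (axisCutoff R) (axSq y)| ≤ K)
    (hK0 : 0 ≤ K) {k : ℝ} (hk : 0 < k) (hu₀ : ∀ᵐ x ∂(muX R a), u₀ x ≤ k)
    (hg : ∀ᵐ y ∂(muT R a T), |g y| ≤ k) :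
    ENNReal.ofReal (ν / 2) * levelEnergy R a u Du k T ≤
      ENNReal.ofReal (levelConst R ν K) * levelMass R a u k T := by
  have hae := S.energy_le hR hν hT hK hK0 hk hu₀ hg
  have hlt : ∀ s < T, ENNReal.ofReal (ν / 2) * levelEnergy R a u Du k s ≤
      ENNReal.ofReal (levelConst R ν K) * levelMass R a u k T := by
    intro s hs
    have hne : (volume.restrict (Ioo 0 T)) (Ioo (max s 0) T) ≠ 0 := by
      rw [Measure.restrict_apply measurableSet_Ioo, inter_eq_left.2
        (Ioo_subset_Ioo_left (le_max_right _ _)), Real.volume_Ioo]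
      simp [hs, hT]
    obtain ⟨t, htI, ht⟩ : ∃ t ∈ Ioo (max s 0) T, _ :=
      ((frequently_ae_iff.2 hne).and_eventually hae).exists
    have hst : s ≤ t := (le_max_left _ _).trans htI.1.le
    calc _ ≤ ENNReal.ofReal (ν / 2) * levelEnergy R a u Du k t := by
          gcongr
          exact lintegral_mono' (muT_le hst) le_rfl
      _ ≤ _ := ht.2
      _ ≤ _ := by
          gcongr
          exact lintegral_mono' (muT_le htI.2.le) le_rfl
  have hun : cylT R a T = ⋃ n : ℕ, cylT R a (T - 1 / ((n : ℝ) + 1)) := by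
    ext y
    simp only [cylT, mem_iUnion, mem_prod, mem_Ioo]
    constructor
    · rintro ⟨h1, h2, h3⟩
      obtain ⟨n, hn⟩ := exists_nat_one_div_lt (sub_pos.2 h3)
      exact ⟨n, h1, h2, by linarith⟩
    · rintro ⟨n, h1, h2, h3⟩
      exact ⟨h1, h2, h3.trans (sub_lt_self _ (by positivity))⟩
  have hdir : Directed (· ⊆ ·) fun n : ℕ => cylT R a (T - 1 / ((n : ℝ) + 1)) := by
    refine Monotone.directed_le (fun n m hnm => prod_mono Subset.rfl (Ioo_subset_Ioo_right ?_))
    have := Nat.one_div_le_one_div (α := ℝ) hnm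
    linarith
  have hsup : levelEnergy R a u Du k T =
      ⨆ n : ℕ, levelEnergy R a u Du k (T - 1 / ((n : ℝ) + 1)) := by
    rw [levelEnergy, muT, hun, setLIntegral_iUnion_of_directed _ hdir]
    rfl
  rw [hsup, ENNReal.mul_iSup]
  exact iSup_le fun n => hlt _ (sub_lt_self _ (by positivity))

end AxisymNS

/-! ### One step of the level set iteration. -/

namespace AxisymNS

variable {R a ν T : ℝ} {u g : SpaceTime → ℝ} {Du : Fin 3 → SpaceTime → ℝ} {u₀ : Space → ℝ}

/-- The integral of `(u - k)₊²`. -/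
def levelSq (R a : ℝ) (u : SpaceTime → ℝ) (k t : ℝ) : ℝ≥0∞ :=
  ∫⁻ y, ENNReal.ofReal (max (u y - k) 0 ^ 2) ∂(muT R a t)

/-- Fatou on the left; on the right `cut² ≤ 1_{u>k}` and `cutF ≤ (u-k)₊` are bounds uniform in `m`.
-/
theorem EnergySystem.nash_level (S : EnergySystem R a ν T u g Du u₀) {k : ℝ} (hk : 0 ≤ k) {l : ℝ}
    (hl : 0 < l) (hl2 : l ≤ 1 / 2) :
    levelSq R a u k T ≤
      4 * ENNReal.ofReal (nashC₁ R a * l ^ 2) * levelEnergy R a u Du k T +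
      4 * ENNReal.ofReal (nashC₂ R a * (l ^ 6)⁻¹) *
        ∫⁻ t in Ioo 0 T, (∫⁻ x, ENNReal.ofReal (max (u (x, t) - k) 0) ∂(muX R a)) ^ 2 := by
  have hn : ∀ m : ℕ, ∫⁻ y, ENNReal.ofReal (cutF k m (u y) ^ 2) ∂(muT R a T) ≤ _ := fun m => by
    have h := S.nash (truncation_cut hk m) hl hl2
    simp only [enorm_sq_eq_ofReal, deriv_cutF] at h
    exact h
  have hFm : ∀ m, Measurable fun y => cutF k m (u y) := fun m =>
    (contDiff_cutF k m).continuous.measurable.comp S.meas_u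
  have f1 : levelSq R a u k T ≤ liminf (fun m : ℕ =>
      ∫⁻ y, ENNReal.ofReal (cutF k m (u y) ^ 2) ∂(muT R a T)) atTop := by
    refine le_trans (lintegral_mono fun y => ?_) (lintegral_liminf_le fun m => ?_)
    · exact ((ENNReal.continuous_ofReal.tendsto _).comp
        ((tendsto_cutF k (u y)).pow 2)).liminf_eq.ge
    · have := hFm m
      fun_prop
  refine f1.trans (liminf_le_of_frequently_le' (.of_forall fun m => (hn m).trans ?_))
  gcongr with t x
  · refine lintegral_mono fun y => ?_
    by_cases h : k < u y
    · rw [indicator_of_mem (show y ∈ u ⁻¹' Ioi k from h),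
        ← ENNReal.ofReal_sum_of_nonneg fun j _ => sq_nonneg _]
      apply ENNReal.ofReal_le_ofReal
      refine Finset.sum_le_sum fun j _ => ?_
      rw [mul_pow]
      exact mul_le_of_le_one_left (sq_nonneg _)
        (pow_le_one₀ (cut_nonneg _ _ _) (cut_le_one _ _ _))
    · simp [cut_of_le m (not_lt.1 h)]
  · rw [Real.enorm_of_nonneg (cutF_nonneg _ _ _)]
    exact ENNReal.ofReal_le_ofReal (cutF_le _ _ _)

/-- Chebyshev's argument: where `s > h` one has `s - k > h - k`, so `(s-k)²` pays for the constant
`h²`. -/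
theorem levelDensity_le_of_lt {k h : ℝ} (hkh : k < h) (s : ℝ) :
    levelDensity h s ≤ (h ^ 2 / (h - k) ^ 2 + 1) * max (s - k) 0 ^ 2 := by
  by_cases hs : h < s
  · rw [levelDensity, indicator_of_mem (mem_Ioi.2 hs), max_eq_left (by linarith), add_mul, one_mul]
    have h1 : 0 < h - k := sub_pos.2 hkh
    have h2 : 0 ≤ h ^ 2 / (h - k) ^ 2 := by positivity
    have h3 : h ^ 2 / (h - k) ^ 2 * (h - k) ^ 2 = h ^ 2 := by field_simp
    have h4 : (h - k) ^ 2 ≤ (s - k) ^ 2 := by gcongr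
    have h5 : (s - h) ^ 2 ≤ (s - k) ^ 2 := by gcongr
    have h6 := mul_le_mul_of_nonneg_left h4 h2
    linarith
  · rw [levelDensity, indicator_of_notMem (by simpa using hs)]
    positivity

theorem levelDensity_le_add (k s : ℝ) : levelDensity k s ≤ k ^ 2 + max (s - k) 0 ^ 2 := by
  by_cases hs : k < s
  · rw [levelDensity, indicator_of_mem (mem_Ioi.2 hs), max_eq_left (by linarith)]
  · rw [levelDensity, indicator_of_notMem (by simpa using hs)]
    positivity

theorem levelMass_le {k h : ℝ} (hkh : k < h) (t : ℝ) :
    levelMass R a u h t ≤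
      ENNReal.ofReal (h ^ 2 / (h - k) ^ 2 + 1) * levelSq R a u k t := by
  rw [levelSq, ← lintegral_const_mul' _ _ ENNReal.ofReal_ne_top]
  refine lintegral_mono fun y => ?_
  rw [← ENNReal.ofReal_mul (by positivity)]
  exact ENNReal.ofReal_le_ofReal (levelDensity_le_of_lt hkh _)

theorem max_sub_le_sq_div {k h : ℝ} (hkh : k < h) (s : ℝ) :
    max (s - h) 0 ≤ 2 / (h - k) * (max (s - k) 0 ^ 2 / 2) := by
  have h1 : 0 < h - k := sub_pos.2 hkh
  rcases le_total s h with hs | hs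
  · rw [max_eq_right (by linarith)]; positivity
  · rw [max_eq_left (by linarith), max_eq_left (by linarith), div_mul_div_comm, mul_comm (h - k),
      mul_div_mul_left _ _ two_ne_zero, le_div_iff₀ h1]
    nlinarith

/-- The hypotheses under which the level `k` is admissible in the energy inequality. -/
structure LevelBound (R a T : ℝ) (g : SpaceTime → ℝ) (u₀ : Space → ℝ) (K : ℝ) : Prop where
  pos : 0 < K
  init : ∀ᵐ x ∂(muX R a), u₀ x ≤ K
  force : ∀ᵐ y ∂(muT R a T), |g y| ≤ K

theorem LevelBound.mono {K k : ℝ} (h : LevelBound R a T g u₀ K) (hk : K ≤ k) :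
    LevelBound R a T g u₀ k :=
  ⟨h.pos.trans_le hk, h.init.mono fun _ hx => hx.trans hk, h.force.mono fun _ hx => hx.trans hk⟩

/-- The gradient term at level `h'` costs one power of `A_k`. For the `L¹` term, `(u-h')₊` is
bounded by `(u-h)₊²/(h'-h)`, whose integral over almost every slice is at most a multiple of `A_k`
by the energy inequality at the intermediate level `h`. The square of this is the superlinear gain.
-/
theorem EnergySystem.levelSq_le (S : EnergySystem R a ν T u g Du u₀) (hR : 0 < R)
    (hν : 0 < ν) (hT : 0 < T) {K : ℝ} (hK : ∀ᵐ y ∂(muT R a T), |deriv (axisCutoff R) (axSq y)| ≤ K)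
    (hK0 : 0 ≤ K) {k h h' : ℝ} (hB : LevelBound R a T g u₀ k) (hkh : k < h) (hhh : h < h') {l : ℝ}
    (hl : 0 < l) (hl2 : l ≤ 1 / 2) :
    levelSq R a u h' T ≤
      ENNReal.ofReal (4 * (nashC₁ R a * l ^ 2) * (2 / ν * levelConst R ν K *
        (h' ^ 2 / (h' - k) ^ 2 + 1))) * levelSq R a u k T +
      ENNReal.ofReal (4 * (nashC₂ R a * (l ^ 6)⁻¹) * (T * (2 / (h' - h) * (levelConst R ν K *
        (h ^ 2 / (h - k) ^ 2 + 1))) ^ 2)) * levelSq R a u k T ^ 2 := by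
  have hC : 0 ≤ levelConst R ν K := by unfold levelConst; positivity
  have hC₁ : 0 ≤ nashC₁ R a := by unfold nashC₁; positivity
  have hC₂ : 0 ≤ nashC₂ R a := by unfold nashC₂; positivity
  have hBh := hB.mono hkh.le
  have hBh' := hBh.mono hhh.le
  have hE : levelEnergy R a u Du h' T ≤ ENNReal.ofReal (2 / ν * levelConst R ν K *
      (h' ^ 2 / (h' - k) ^ 2 + 1)) * levelSq R a u k T := by
    have h1 := S.levelEnergy_le hR hν hT hK hK0 hBh'.pos hBh'.init hBh'.force
    calc levelEnergy R a u Du h' T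
        = ENNReal.ofReal (2 / ν) * (ENNReal.ofReal (ν / 2) * levelEnergy R a u Du h' T) := by
          rw [← mul_assoc, ← ENNReal.ofReal_mul (by positivity)]
          have : 2 / ν * (ν / 2) = 1 := by field_simp
          rw [this, ENNReal.ofReal_one, one_mul]
      _ ≤ ENNReal.ofReal (2 / ν) * (ENNReal.ofReal (levelConst R ν K) *
          (ENNReal.ofReal (h' ^ 2 / (h' - k) ^ 2 + 1) * levelSq R a u k T)) := by
          refine mul_le_mul_right (h1.trans ?_) _
          gcongr
          exact levelMass_le (hkh.trans hhh) T
      _ = _ := by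
          rw [ENNReal.ofReal_mul (by positivity), ENNReal.ofReal_mul (by positivity)]
          ring
  have hY : ∀ᵐ t ∂(volume.restrict (Ioo 0 T)),
      (∫⁻ x, ENNReal.ofReal (max (u (x, t) - h') 0) ∂(muX R a)) ^ 2 ≤
      (ENNReal.ofReal (2 / (h' - h) * (levelConst R ν K * (h ^ 2 / (h - k) ^ 2 + 1))) *
        levelSq R a u k T) ^ 2 := by
    filter_upwards [S.energy_le hR hν hT hK hK0 hBh.pos hBh.init hBh.force,
      ae_restrict_mem measurableSet_Ioo] with t ht htI
    gcongr
    have hd : 0 ≤ 2 / (h' - h) := div_nonneg zero_le_two (sub_pos.2 hhh).le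
    calc ∫⁻ x, ENNReal.ofReal (max (u (x, t) - h') 0) ∂(muX R a)
        ≤ ∫⁻ x, ENNReal.ofReal (2 / (h' - h)) *
            ENNReal.ofReal (max (u (x, t) - h) 0 ^ 2 / 2) ∂(muX R a) := by
          refine lintegral_mono fun x => ?_
          rw [← ENNReal.ofReal_mul hd]
          exact ENNReal.ofReal_le_ofReal (max_sub_le_sq_div hhh _)
      _ = ENNReal.ofReal (2 / (h' - h)) *
            ∫⁻ x, ENNReal.ofReal (max (u (x, t) - h) 0 ^ 2 / 2) ∂(muX R a) :=
          lintegral_const_mul' _ _ ENNReal.ofReal_ne_top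
      _ ≤ ENNReal.ofReal (2 / (h' - h)) * (ENNReal.ofReal (levelConst R ν K) *
          (ENNReal.ofReal (h ^ 2 / (h - k) ^ 2 + 1) * levelSq R a u k T)) := by
          gcongr
          refine ht.1.trans ?_
          gcongr
          refine (levelMass_le hkh t).trans ?_
          gcongr
          exact lintegral_mono' (muT_le htI.2.le) le_rfl
      _ = _ := by
          rw [ENNReal.ofReal_mul hd, ENNReal.ofReal_mul hC]
          ring
  have hY' : ∫⁻ t in Ioo 0 T, (∫⁻ x, ENNReal.ofReal (max (u (x, t) - h') 0) ∂(muX R a)) ^ 2 ≤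
      ENNReal.ofReal (T * (2 / (h' - h) * (levelConst R ν K * (h ^ 2 / (h - k) ^ 2 + 1))) ^ 2) *
        levelSq R a u k T ^ 2 := by
    refine (lintegral_mono_ae hY).trans ?_
    rw [lintegral_const, Measure.restrict_apply_univ, Real.volume_Ioo, sub_zero, mul_pow,
      ENNReal.ofReal_mul hT.le, ENNReal.ofReal_pow (by
        have := sub_pos.2 hhh
        positivity)]
    apply le_of_eq
    ring
  have e4 : (4 : ℝ≥0∞) = ENNReal.ofReal 4 := by simp
  calc levelSq R a u h' T ≤ _ := S.nash_level hBh'.pos.le hl hl2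
    _ ≤ 4 * ENNReal.ofReal (nashC₁ R a * l ^ 2) * (ENNReal.ofReal (2 / ν * levelConst R ν K *
      (h' ^ 2 / (h' - k) ^ 2 + 1)) * levelSq R a u k T) +
      4 * ENNReal.ofReal (nashC₂ R a * (l ^ 6)⁻¹) *
      (ENNReal.ofReal (T * (2 / (h' - h) * (levelConst R ν K * (h ^ 2 / (h - k) ^ 2 + 1))) ^ 2) *
        levelSq R a u k T ^ 2) := by gcongr
    _ = _ := by
      rw [e4, ← mul_assoc, ← mul_assoc, ENNReal.ofReal_mul (p := 4 * (nashC₁ R a * l ^ 2))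
        (by positivity), ENNReal.ofReal_mul (p := 4 * (nashC₂ R a * (l ^ 6)⁻¹)) (by positivity),
        ENNReal.ofReal_mul (p := 4) (q := nashC₁ R a * l ^ 2) (by norm_num),
        ENNReal.ofReal_mul (p := 4) (q := nashC₂ R a * (l ^ 6)⁻¹) (by norm_num)]

end AxisymNS

/-! ### Convergence of the iteration and the upper bound. -/

namespace AxisymNS

/-- Fast geometric convergence for the recursion of the level set method. -/
theorem exists_tendsto_zero_of_recursion {c : ℝ} (hc : 2 ≤ c) :
    ∃ δ > 0, ∀ b : ℕ → ℝ, (∀ n, 0 ≤ b n) → (∀ n l, 0 < l → l ≤ 1 / 2 →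
      b (n + 1) ≤ c * l ^ 2 * 4 ^ n * b n + c * (l ^ 6)⁻¹ * 64 ^ n * b n ^ 2) → b 0 ≤ δ →
      Tendsto b atTop (𝓝 0) := by
  -- With `l = l₀/2ⁿ` the quadratic coefficient grows like `64ⁿ · 2⁶ⁿ = 4096ⁿ`; decay of `b n` like
  -- `qⁿ` just compensates this.
  set q : ℝ := 1 / 4096 with hq
  have hq0 : 0 < q := by norm_num [hq]
  have hc0 : 0 < c := by linarith
  -- This choice gives `c l₀² = q/2`, and the factor `4ⁿ` cancels against `l² = l₀²/4ⁿ`.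
  set l₀ : ℝ := Real.sqrt (q / (2 * c)) with hl₀
  have hl0 : 0 < l₀ := Real.sqrt_pos.2 (by positivity)
  have hl2 : l₀ ^ 2 = q / (2 * c) := Real.sq_sqrt (by positivity)
  have hlh : l₀ ≤ 1 / 2 := by
    refine abs_le_of_sq_le_sq' ?_ (by norm_num) |>.2
    rw [hl2, div_le_iff₀ (by positivity)]
    norm_num [hq]; linarith
  -- The threshold satisfies `c l₀⁻⁶ δ = q/2`, so each of the two terms contributes half of the
  -- factor `q`.
  refine ⟨q * l₀ ^ 6 / (2 * c), by positivity, fun b hb hrec h0 => ?_⟩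
  set δ := q * l₀ ^ 6 / (2 * c) with hδ
  have hδ0 : 0 < δ := by positivity
  have hclaim : ∀ n, b n ≤ δ * q ^ n := by
    intro n
    induction n with
    | zero => simpa using h0
    | succ n ih =>
      have h1 := hrec n (l₀ / 2 ^ n) (by positivity)
        ((div_le_self hl0.le (one_le_pow₀ one_le_two)).trans hlh)
      have e1 : c * (l₀ / 2 ^ n) ^ 2 * 4 ^ n = q / 2 := by
        rw [div_pow, hl2, ← pow_mul, mul_comm n 2, pow_mul]
        norm_num
        field_simp
        norm_num
      have e2 : c * ((l₀ / 2 ^ n) ^ 6)⁻¹ * 64 ^ n = c * (l₀ ^ 6)⁻¹ * 4096 ^ n := by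
        rw [div_pow, ← pow_mul, mul_comm n 6, pow_mul, inv_div,
          show (4096 : ℝ) = 2 ^ 6 * 64 by norm_num, mul_pow]
        field_simp
      rw [e1, e2] at h1
      have e3 : c * (l₀ ^ 6)⁻¹ * 4096 ^ n * (δ * q ^ n) ^ 2 = q / 2 * (δ * q ^ n) := by
        have e4 : (4096 : ℝ) ^ n * q ^ n = 1 := by rw [← mul_pow]; norm_num [hq]
        have e5 : c * (l₀ ^ 6)⁻¹ * δ = q / 2 := by rw [hδ]; field_simp
        calc _ = (c * (l₀ ^ 6)⁻¹ * δ) * (4096 ^ n * q ^ n) * (δ * q ^ n) := by ring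
          _ = _ := by rw [e4, e5, mul_one]
      have h2 : c * (l₀ ^ 6)⁻¹ * 4096 ^ n * b n ^ 2 ≤ q / 2 * (δ * q ^ n) := by
        rw [← e3]
        have := hb n
        gcongr
      calc b (n + 1) ≤ q / 2 * b n + c * (l₀ ^ 6)⁻¹ * 4096 ^ n * b n ^ 2 := h1
        _ ≤ q / 2 * (δ * q ^ n) + q / 2 * (δ * q ^ n) := by gcongr
        _ = δ * q ^ (n + 1) := by ring
  have hlim : Tendsto (fun n => δ * q ^ n) atTop (𝓝 0) := by
    have := (tendsto_pow_atTop_nhds_zero_of_lt_one hq0.le (by norm_num [hq])).const_mul δ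
    simpa using this
  exact squeeze_zero hb hclaim hlim

/-- Since `Y` is only integrable, the differential form of Gronwall's inequality is applied to the
continuously differentiable majorant `V(t) = ∫₀ᵗ (α + γZ)` of `Z = ∫₀ᵗ Y`. -/
theorem integral_le_of_gronwall {Y : ℝ → ℝ} {T α γ : ℝ} (hT : 0 < T) (hY : Integrable Y)
    (hY0 : ∀ t, 0 ≤ Y t) (hα : 0 ≤ α) (hγ : 0 < γ)
    (h : ∀ᵐ t ∂(volume.restrict (Ioo 0 T)), Y t ≤ α + γ * ∫ s in (0 : ℝ)..t, Y s) :
    ∫ s in (0 : ℝ)..T, Y s ≤ α / γ * (Real.exp (γ * T) - 1) := by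
  have hYi : ∀ p q, IntervalIntegrable Y volume p q := fun p q => hY.intervalIntegrable
  have hZc : Continuous fun t => ∫ s in (0 : ℝ)..t, Y s :=
    intervalIntegral.continuous_primitive hYi 0
  set Z : ℝ → ℝ := fun t => ∫ s in (0 : ℝ)..t, Y s with hZ
  have hfc : Continuous fun t => α + γ * Z t := by fun_prop
  have hZ0 : ∀ t, 0 ≤ t → 0 ≤ Z t := fun t ht =>
    intervalIntegral.integral_nonneg ht fun s _ => hY0 s
  have hZV : ∀ t ∈ Icc 0 T, Z t ≤ ∫ s in (0 : ℝ)..t, (α + γ * Z s) := by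
    intro t ht
    refine intervalIntegral.integral_mono_ae_restrict ht.1 (hYi _ _) (hfc.intervalIntegrable _ _) ?_
    rw [← restrict_Ioo_eq_restrict_Icc]
    exact ae_mono (Measure.restrict_mono (Ioo_subset_Ioo_right ht.2) le_rfl) h
  set V : ℝ → ℝ := fun t => ∫ s in (0 : ℝ)..t, (α + γ * Z s) with hV
  have hV' : ∀ t, HasDerivAt V (α + γ * Z t) t := hasDerivAt_primitive hfc 0
  have key := norm_le_gronwallBound_of_norm_deriv_right_le (f := V) (f' := fun t => α + γ * Z t)
    (δ := 0) (K := γ) (ε := α) (a := 0) (b := T)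
    (fun t _ => (hV' t).continuousAt.continuousWithinAt)
    (fun t _ => (hV' t).hasDerivWithinAt) (by simp [hV]) ?_ T ⟨hT.le, le_rfl⟩
  · rw [gronwallBound_of_K_ne_0 hγ.ne'] at key
    simp only [zero_mul, sub_zero, zero_add] at key
    exact (hZV T ⟨hT.le, le_rfl⟩).trans ((le_abs_self _).trans key)
  · intro t ht
    have h1 := hZ0 t ht.1
    have h2 := hZV t ⟨ht.1, ht.2.le⟩
    rw [Real.norm_of_nonneg (by positivity)]
    have h3 : Z t ≤ ‖V t‖ := h2.trans (le_abs_self _)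
    nlinarith

variable {R a ν T : ℝ} {u g : SpaceTime → ℝ} {Du : Fin 3 → SpaceTime → ℝ} {u₀ : Space → ℝ}

theorem integrable_max_sq (hu : MemLp u 2 (muT R a T)) (k : ℝ) :
    Integrable (fun y => max (u y - k) 0 ^ 2) (muT R a T) := by
  refine (memLp_comp_lipschitz (Φ := fun s => max (s - k) 0) (C := 1) (by fun_prop)
    (fun p q => ?_) hu).integrable_sq
  have := abs_max_sub_max_le_abs (p - k) (q - k) 0
  simpa using this

/-- At a single level the density is at most `k² + (u-k)₊²`, so the energy inequality closes by
Gronwall. The bound is a multiple of `k²`, and this homogeneity is what allows the iteration to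
start. -/
theorem EnergySystem.levelSq_le_base (S : EnergySystem R a ν T u g Du u₀) (hR : 0 < R)
    (hν : 0 < ν) (hT : 0 < T) {K : ℝ} (hK : ∀ᵐ y ∂(muT R a T), |deriv (axisCutoff R) (axSq y)| ≤ K)
    (hK0 : 0 ≤ K) {k : ℝ} (hB : LevelBound R a T g u₀ k) :
    levelSq R a u k T ≤ ENNReal.ofReal ((muT R a T).real univ *
      (Real.exp (2 * levelConst R ν K * T) - 1) * k ^ 2) := by
  have hC : 0 < levelConst R ν K := by unfold levelConst; positivity
  set V := (muT R a T).real univ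
  have hV : 0 ≤ V := measureReal_nonneg
  have hW := integrable_max_sq S.memLp_u k
  set W : SpaceTime → ℝ := fun y => max (u y - k) 0 ^ 2 with hWdef
  have hW0 : ∀ y, 0 ≤ W y := fun y => sq_nonneg _
  have hWs : ∀ᵐ t ∂(volume.restrict (Ioo 0 T)), Integrable (fun x => W (x, t)) (muX R a) := by
    have := hW
    rw [muT_eq_prod] at this
    exact this.prod_left_ae
  have hYi : IntegrableOn (fun t => ∫ x, W (x, t) ∂(muX R a)) (Ioo 0 T) := by
    have := hW
    rw [muT_eq_prod] at this
    exact this.integral_prod_right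
  set Y : ℝ → ℝ := (Ioo 0 T).indicator fun t => ∫ x, W (x, t) ∂(muX R a) with hYdef
  have hY : Integrable Y := (integrable_indicator_iff measurableSet_Ioo).2 hYi
  have hY0 : ∀ t, 0 ≤ Y t := indicator_nonneg fun t _ => integral_nonneg fun x => hW0 _
  have hZ : ∀ t, 0 ≤ t → t ≤ T → ∫ y, W y ∂(muT R a t) = ∫ s in (0 : ℝ)..t, Y s := by
    intro t ht0 ht
    have := hW.mono_measure (muT_le ht)
    rw [muT_eq_prod] at this ⊢
    rw [integral_prod_symm _ this, intervalIntegral.integral_of_le ht0,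
      integral_Ioc_eq_integral_Ioo]
    refine setIntegral_congr_fun measurableSet_Ioo fun s hs => ?_
    rw [hYdef, indicator_of_mem (show s ∈ Ioo 0 T from ⟨hs.1, hs.2.trans_le ht⟩)]
  have hae : ∀ᵐ t ∂(volume.restrict (Ioo 0 T)), Y t ≤ 2 * levelConst R ν K * (V * k ^ 2) +
      2 * levelConst R ν K * ∫ s in (0 : ℝ)..t, Y s := by
    filter_upwards [S.energy_le hR hν hT hK hK0 hB.pos hB.init hB.force, hWs,
      ae_restrict_mem measurableSet_Ioo] with t ht hWt htI
    have hmono := muT_le (R := R) (a := a) htI.2.le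
    have hLt := (integrable_levelDensity S.memLp_u S.meas_u k).mono_measure hmono
    have h1 := ht.1
    rw [levelMass, ← ofReal_integral_eq_lintegral_ofReal hLt
      (.of_forall fun y => levelDensity_nonneg _ _), ← ENNReal.ofReal_mul hC.le,
      ← ofReal_integral_eq_lintegral_ofReal (hWt.div_const 2)
        (.of_forall fun x => by positivity), ENNReal.ofReal_le_ofReal_iff
        (mul_nonneg hC.le (integral_nonneg fun y => levelDensity_nonneg _ _)),
      integral_div] at h1
    have h2 : ∫ y, levelDensity k (u y) ∂(muT R a t) ≤ V * k ^ 2 + ∫ s in (0 : ℝ)..t, Y s := by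
      have hWt' := hW.mono_measure hmono
      refine (integral_mono hLt ((integrable_const (k ^ 2)).add hWt') fun y =>
        levelDensity_le_add k (u y)).trans ?_
      have h3 := integral_add (integrable_const (k ^ 2) (μ := muT R a t)) hWt'
      refine h3.le.trans ?_
      rw [integral_const, hZ t htI.1.le htI.2.le, smul_eq_mul]
      gcongr
      exact ENNReal.toReal_mono (measure_ne_top _ _) (hmono univ)
    rw [hYdef, indicator_of_mem htI]
    have h4 := mul_le_mul_of_nonneg_left h2 hC.le
    have h5 : (∫ x, W (x, t) ∂(muX R a)) / 2 ≤ _ := h1.trans h4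
    linarith
  have key := integral_le_of_gronwall hT hY hY0 (by positivity) (by positivity) hae
  rw [levelSq, ← ofReal_integral_eq_lintegral_ofReal hW (.of_forall hW0), hZ T hT.le le_rfl]
  apply ENNReal.ofReal_le_ofReal
  refine key.trans_eq ?_
  field_simp

theorem levelSq_mono {k h : ℝ} (hkh : k ≤ h) (t : ℝ) :
    levelSq R a u h t ≤ levelSq R a u k t := by
  refine lintegral_mono fun y => ENNReal.ofReal_le_ofReal ?_
  have : max (u y - h) 0 ≤ max (u y - k) 0 := max_le_max_right 0 (by linarith)
  gcongr

theorem levelSq_ne_top (hu : MemLp u 2 (muT R a T)) (k : ℝ) : levelSq R a u k T ≠ ⊤ := by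
  rw [levelSq, ← ofReal_integral_eq_lintegral_ofReal (integrable_max_sq hu k)
    (.of_forall fun y => sq_nonneg _)]
  exact ENNReal.ofReal_ne_top

/-- The constant in the recursion between successive levels. -/
def recursionConst (R a ν T K : ℝ) : ℝ :=
  2 + 4 * nashC₁ R a * (2 / ν * levelConst R ν K * 17) +
    4 * nashC₂ R a * (T * (8 * (levelConst R ν K * 65)) ^ 2)

/-- Successive levels are `L(2-p)` and `L(2-p/2)` with `p = 2⁻ⁿ`. The ratio is scale invariant,
hence free of `L`. The next lemma treats the level halfway between them. -/
theorem ratio_add_one_le {L p : ℝ} (hL : 0 < L) (hp : 0 < p) (hp1 : p ≤ 1) :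
    (L * (2 - p / 2)) ^ 2 / (L * (2 - p / 2) - L * (2 - p)) ^ 2 + 1 ≤ 17 / p ^ 2 := by
  have e : L * (2 - p / 2) - L * (2 - p) = L * (p / 2) := by ring
  rw [e, mul_pow, mul_pow, mul_div_mul_left _ _ (by positivity : L ^ 2 ≠ 0), div_add_one
    (by positivity), div_le_div_iff₀ (by positivity) (by positivity)]
  have : (2 - p / 2) ^ 2 + (p / 2) ^ 2 ≤ 17 / 4 := by nlinarith
  linarith [mul_le_mul_of_nonneg_right this (sq_nonneg p)]

theorem midpoint_ratio_add_one_le {L p : ℝ} (hL : 0 < L) (hp : 0 < p) (hp1 : p ≤ 1) :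
    (L * (2 - 3 * p / 4)) ^ 2 / (L * (2 - 3 * p / 4) - L * (2 - p)) ^ 2 + 1 ≤ 65 / p ^ 2 := by
  have e : L * (2 - 3 * p / 4) - L * (2 - p) = L * (p / 4) := by ring
  rw [e, mul_pow, mul_pow, mul_div_mul_left _ _ (by positivity : L ^ 2 ≠ 0), div_add_one
    (by positivity), div_le_div_iff₀ (by positivity) (by positivity)]
  have : (2 - 3 * p / 4) ^ 2 + (p / 4) ^ 2 ≤ 65 / 16 := by nlinarith
  linarith [mul_le_mul_of_nonneg_right this (sq_nonneg p)]

theorem first_coefficient_le {N C c l p r : ℝ} (hN : 0 ≤ N) (hC : 0 ≤ C) (hν : 0 < ν)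
    (hp : 0 < p) (hr : r ≤ 17 / p ^ 2) (hc : 4 * N * (2 / ν * C * 17) ≤ c) :
    4 * (N * l ^ 2) * (2 / ν * C * r) ≤ c * l ^ 2 * (1 / p ^ 2) := by
  calc _ ≤ 4 * (N * l ^ 2) * (2 / ν * C * (17 / p ^ 2)) := by gcongr
    _ = 4 * N * (2 / ν * C * 17) * (l ^ 2 * (1 / p ^ 2)) := by ring
    _ ≤ c * (l ^ 2 * (1 / p ^ 2)) := mul_le_mul_of_nonneg_right hc (by positivity)
    _ = _ := by ring

/-- The gap of levels contributes `1/(Lp)` and the ratio `1/p²`. Their product squared gives `p⁻⁶ =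
64ⁿ` and the factor `L⁻²` that makes the recursion homogeneous. -/
theorem second_coefficient_le {N C c l p r L : ℝ} (hN : 0 ≤ N) (hC : 0 ≤ C) (hT : 0 ≤ T)
    (hL : 0 < L) (hp : 0 < p) (hr0 : 0 ≤ r) (hr : r ≤ 65 / p ^ 2)
    (hc : 4 * N * (T * (8 * (C * 65)) ^ 2) ≤ c) :
    4 * (N * (l ^ 6)⁻¹) * (T * (8 / (L * p) * (C * r)) ^ 2) ≤
      c * (l ^ 6)⁻¹ * (1 / p ^ 6) / L ^ 2 := by
  calc _ ≤ 4 * (N * (l ^ 6)⁻¹) * (T * (8 / (L * p) * (C * (65 / p ^ 2))) ^ 2) := by gcongr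
    _ = 4 * N * (T * (8 * (C * 65)) ^ 2) * ((l ^ 6)⁻¹ * (1 / p ^ 6) / L ^ 2) := by
      rw [show 8 / (L * p) * (C * (65 / p ^ 2)) = 8 * (C * 65) / (L * p ^ 3) by field_simp, div_pow]
      field_simp
    _ ≤ c * ((l ^ 6)⁻¹ * (1 / p ^ 6) / L ^ 2) := mul_le_mul_of_nonneg_right hc (by positivity)
    _ = _ := by ring

/-- After division by `L²` the recursion does not depend on `L` or on the data, so the smallness
threshold depends on `R`, `a`, `ν`, `T` and `K` alone. -/
theorem EnergySystem.levelSq_recursion (S : EnergySystem R a ν T u g Du u₀) (hR : 0 < R)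
    (hν : 0 < ν) (hT : 0 < T) {K : ℝ} (hK : ∀ᵐ y ∂(muT R a T), |deriv (axisCutoff R) (axSq y)| ≤ K)
    (hK0 : 0 ≤ K) {L : ℝ} (hB : LevelBound R a T g u₀ L) (n : ℕ) {l : ℝ}
    (hl : 0 < l) (hl2 : l ≤ 1 / 2) :
    (levelSq R a u (L * (2 - (1 / 2) ^ (n + 1))) T).toReal / L ^ 2 ≤
      recursionConst R a ν T K * l ^ 2 * 4 ^ n *
        ((levelSq R a u (L * (2 - (1 / 2) ^ n)) T).toReal / L ^ 2) +
      recursionConst R a ν T K * (l ^ 6)⁻¹ * 64 ^ n *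
        ((levelSq R a u (L * (2 - (1 / 2) ^ n)) T).toReal / L ^ 2) ^ 2 := by
  have hL := hB.pos
  have hC : 0 < levelConst R ν K := by unfold levelConst; positivity
  have hC₁ : 0 ≤ nashC₁ R a := by unfold nashC₁; positivity
  have hC₂ : 0 ≤ nashC₂ R a := by unfold nashC₂; positivity
  obtain ⟨p, hp⟩ : ∃ p : ℝ, p = (1 / 2) ^ n := ⟨_, rfl⟩
  have hp0 : 0 < p := by rw [hp]; positivity
  have hp1 : p ≤ 1 := by rw [hp]; exact pow_le_one₀ (by norm_num) (by norm_num)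
  have e4 : (4 : ℝ) ^ n = 1 / p ^ 2 := by
    rw [hp, ← pow_mul, mul_comm n 2, pow_mul, one_div, ← inv_pow]; norm_num
  have e64 : (64 : ℝ) ^ n = 1 / p ^ 6 := by
    rw [hp, ← pow_mul, mul_comm n 6, pow_mul, one_div, ← inv_pow]; norm_num
  have ep : (1 / 2 : ℝ) ^ (n + 1) = p / 2 := by rw [pow_succ, hp]; ring
  rw [ep, ← hp, e4, e64]
  have hLp : 0 < L * p := mul_pos hL hp0
  have hBk : LevelBound R a T g u₀ (L * (2 - p)) := hB.mono (by nlinarith)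
  have h := S.levelSq_le hR hν hT hK hK0 hBk (h := L * (2 - 3 * p / 4)) (h' := L * (2 - p / 2))
    (by nlinarith) (by nlinarith) hl hl2
  have hA := levelSq_ne_top S.memLp_u (L * (2 - p))
  obtain ⟨A, hA0, hAe⟩ : ∃ A : ℝ, 0 ≤ A ∧ levelSq R a u (L * (2 - p)) T = ENNReal.ofReal A :=
    ⟨_, ENNReal.toReal_nonneg, (ENNReal.ofReal_toReal hA).symm⟩
  rw [hAe, ← ENNReal.ofReal_pow hA0, ← ENNReal.ofReal_mul (by positivity),
    ← ENNReal.ofReal_mul (by positivity), ← ENNReal.ofReal_add (by positivity) (by positivity)] at h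
  have h1 := ENNReal.toReal_le_of_le_ofReal (by positivity) h
  rw [hAe, ENNReal.toReal_ofReal hA0]
  have b1 := ratio_add_one_le hL hp0 hp1
  have b2 := midpoint_ratio_add_one_le hL hp0 hp1
  have e3 : 2 / (L * (2 - p / 2) - L * (2 - 3 * p / 4)) = 8 / (L * p) := by
    have e : L * (2 - p / 2) - L * (2 - 3 * p / 4) = L * p / 4 := by ring
    rw [e]; field_simp; norm_num
  rw [e3] at h1
  have c1 : 4 * nashC₁ R a * (2 / ν * levelConst R ν K * 17) ≤ recursionConst R a ν T K := by
    unfold recursionConst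
    have : 0 ≤ 4 * nashC₂ R a * (T * (8 * (levelConst R ν K * 65)) ^ 2) := by positivity
    linarith
  have c2 : 4 * nashC₂ R a * (T * (8 * (levelConst R ν K * 65)) ^ 2) ≤
      recursionConst R a ν T K := by
    unfold recursionConst
    have : 0 ≤ 4 * nashC₁ R a * (2 / ν * levelConst R ν K * 17) := by positivity
    linarith
  have hc : 0 ≤ recursionConst R a ν T K := le_trans (by positivity) c1
  generalize recursionConst R a ν T K = c at c1 c2 hc ⊢
  generalize levelConst R ν K = C at hC h1 c1 c2
  generalize nashC₁ R a = N₁ at hC₁ h1 c1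
  generalize nashC₂ R a = N₂ at hC₂ h1 c2
  have d1 := first_coefficient_le (l := l) hC₁ hC.le hν hp0 b1 c1
  have d2 := second_coefficient_le (l := l) hC₂ hC.le hT.le hL hp0 (by positivity) b2 c2
  rw [div_le_iff₀ (by positivity)]
  refine h1.trans ((add_le_add (mul_le_mul_of_nonneg_right d1 hA0)
    (mul_le_mul_of_nonneg_right d2 (sq_nonneg A))).trans_eq ?_)
  field_simp

theorem exists_upper_bound (hR : 0 < R) (hν : 0 < ν) (hT : 0 < T) :
    ∃ Λ : ℝ, 0 < Λ ∧ ∀ (u g : SpaceTime → ℝ) (Du : Fin 3 → SpaceTime → ℝ) (u₀ : Space → ℝ) (k : ℝ),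
      EnergySystem R a ν T u g Du u₀ → LevelBound R a T g u₀ k →
      ∀ᵐ y ∂(muT R a T), u y ≤ Λ * k := by
  have hχ' : Continuous fun y => deriv (axisCutoff R) (axSq y) :=
    ((contDiff_axisCutoff R).continuous_deriv (by norm_num)).comp contDiff_axSq.continuous
  obtain ⟨K', hK'⟩ := exists_bound_on_cylT hχ' R a T
  set K := max K' 0
  have hK : ∀ᵐ y ∂(muT R a T), |deriv (axisCutoff R) (axSq y)| ≤ K :=
    hK'.mono fun y hy => hy.trans (le_max_left _ _)
  have hK0 : 0 ≤ K := le_max_right _ _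
  have hC : 0 < levelConst R ν K := by unfold levelConst; positivity
  have hC₁ : 0 ≤ nashC₁ R a := by unfold nashC₁; positivity
  have hC₂ : 0 ≤ nashC₂ R a := by unfold nashC₂; positivity
  have hc : 2 ≤ recursionConst R a ν T K := by
    unfold recursionConst
    have : 0 ≤ 4 * nashC₁ R a * (2 / ν * levelConst R ν K * 17) := by positivity
    have : 0 ≤ 4 * nashC₂ R a * (T * (8 * (levelConst R ν K * 65)) ^ 2) := by positivity
    linarith
  obtain ⟨δ, hδ, hconv⟩ := exists_tendsto_zero_of_recursion hc
  set M := (muT R a T).real univ * (Real.exp (2 * levelConst R ν K * T) - 1)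
  have hM : 0 ≤ M := mul_nonneg measureReal_nonneg
    (sub_nonneg.2 (Real.one_le_exp (by positivity)))
  -- At the starting level `L = Λk` one has `A_L/L² ≤ M/Λ²`, and this is at most `δ` since `Λ² ≥ Λ ≥
  -- M/δ`. The levels increase to `2L`, whence the final factor 2.
  set Λ := 1 + M / δ
  have hΛ : 1 ≤ Λ := le_add_of_nonneg_right (by positivity)
  refine ⟨Λ * 2, by linarith, fun u g Du u₀ k S hB => ?_⟩
  have hk := hB.pos
  have hBL : LevelBound R a T g u₀ (Λ * k) := hB.mono (le_mul_of_one_le_left hk.le hΛ)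
  set L := Λ * k
  have hL := hBL.pos
  have hlim := hconv (fun n => (levelSq R a u (L * (2 - (1 / 2) ^ n)) T).toReal / L ^ 2)
    (fun n => by positivity)
    (fun n l hl hl2 => S.levelSq_recursion hR hν hT hK hK0 hBL n hl hl2) ?_
  · have hle : ∀ n : ℕ, (levelSq R a u (L * 2) T).toReal / L ^ 2 ≤
        (levelSq R a u (L * (2 - (1 / 2) ^ n)) T).toReal / L ^ 2 := by
      intro n
      gcongr
      · exact levelSq_ne_top S.memLp_u _
      · refine levelSq_mono ?_ T
        have : (0 : ℝ) < (1 / 2) ^ n := by positivity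
        nlinarith
    have h0 := ge_of_tendsto' hlim hle
    rw [div_le_iff₀ (by positivity), zero_mul] at h0
    have hz : levelSq R a u (L * 2) T = 0 := by
      have := le_antisymm h0 ENNReal.toReal_nonneg
      rcases (ENNReal.toReal_eq_zero_iff _).1 this with h | h
      · exact h
      · exact absurd h (levelSq_ne_top S.memLp_u _)
    have hum := S.meas_u
    rw [levelSq, lintegral_eq_zero_iff (by fun_prop)] at hz
    filter_upwards [hz] with y hy
    have h1 : max (u y - L * 2) 0 ^ 2 ≤ 0 := ENNReal.ofReal_eq_zero.1 hy
    have h2 : max (u y - L * 2) 0 = 0 := by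
      rw [← sq_eq_zero_iff]; exact le_antisymm h1 (sq_nonneg _)
    have h3 := max_eq_right_iff.1 h2
    have : Λ * 2 * k = L * 2 := by ring
    linarith
  · have h1 := (levelSq_mono (le_mul_of_one_le_left hk.le hΛ) T).trans
      (S.levelSq_le_base hR hν hT hK hK0 hB)
    have h2 := ENNReal.toReal_le_of_le_ofReal (by positivity) h1
    have e : L * (2 - (1 / 2) ^ 0) = Λ * k := by rw [pow_zero]; ring
    rw [e, div_le_iff₀ (by positivity)]
    refine h2.trans ?_
    have h3 : M ≤ δ * Λ := by
      have : δ * Λ = δ + M := by simp only [Λ]; field_simp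
      linarith
    have h4 : δ * Λ ≤ δ * Λ ^ 2 := by gcongr; nlinarith
    calc M * k ^ 2 ≤ δ * Λ ^ 2 * k ^ 2 := by gcongr; linarith
      _ = δ * L ^ 2 := by simp only [L]; ring

end AxisymNS

/-! ### Conclusion: the two-sided bound. -/

namespace AxisymNS

theorem ae_abs_le_normLinf {α : Type*} [MeasurableSpace α] {μ : Measure α} {h : α → ℝ}
    (hh : MemLp h ⊤ μ) : ∀ᵐ x ∂μ, |h x| ≤ normLinf μ h := by
  filter_upwards [ae_le_eLpNormEssSup (f := h) (μ := μ)] with x hx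
  rw [← eLpNorm_exponent_top, ← ENNReal.coe_toNNReal hh.2.ne, enorm_le_coe] at hx
  exact_mod_cast hx

end AxisymNS

end

theorem lemma3p1 (R a ν T : ℝ) (hR : 0 < R) (ha : 0 < a) (hν : 0 < ν) (hT : 0 < T) :
    ∃ d₆ : ℝ≥0 → ℝ≥0 → ℝ≥0,
      ∀ (v : AxisymNS.SpaceTime → AxisymNS.Space) (p : AxisymNS.SpaceTime → ℝ)
        (f : AxisymNS.SpaceTime → AxisymNS.Space) (v₀ : AxisymNS.Space → AxisymNS.Space),
        AxisymNS.IsAxisymSolution R a ν T v p f v₀ →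
        MemLp (AxisymNS.swirl₀ v₀) ⊤ (AxisymNS.muX R a) →
        MemLp (AxisymNS.swirl f) ⊤ (AxisymNS.muT R a T) →
        MemLp (AxisymNS.swirl v) ⊤ (AxisymNS.muT R a T) ∧
        AxisymNS.normLinf (AxisymNS.muT R a T) (AxisymNS.swirl v) ≤
          d₆ (AxisymNS.normLinf (AxisymNS.muX R a) (AxisymNS.swirl₀ v₀))
            (AxisymNS.normLinf (AxisymNS.muT R a T) (AxisymNS.swirl f)) := by
  obtain ⟨Λ, hΛ, hbound⟩ := AxisymNS.exists_upper_bound (a := a) hR hν hT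
  refine ⟨fun x y => (Λ * (x + y + 1)).toNNReal, fun v p f v₀ hsol hu₀ hg => ?_⟩
  obtain ⟨ut, Du, S⟩ := hsol.swirlSystem hg
  obtain ⟨u, Du', hu, E⟩ := S.exists_energySystem hR ha hT
  set x := AxisymNS.normLinf (AxisymNS.muX R a) (AxisymNS.swirl₀ v₀)
  set y := AxisymNS.normLinf (AxisymNS.muT R a T) (AxisymNS.swirl f)
  -- The summand 1 keeps the level positive when both data vanish.
  set k : ℝ := x + y + 1 with hk
  have hx0 : (0 : ℝ) ≤ x := x.2
  have hy0 : (0 : ℝ) ≤ y := y.2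
  have hu₀' := AxisymNS.ae_abs_le_normLinf hu₀
  have hg' := AxisymNS.ae_abs_le_normLinf hg
  have hB : AxisymNS.LevelBound R a T (AxisymNS.swirl f) (AxisymNS.swirl₀ v₀) k :=
    ⟨by positivity, hu₀'.mono fun z hz => (le_abs_self _).trans (hz.trans (by linarith)),
      hg'.mono fun z hz => hz.trans (by linarith)⟩
  have hB' : AxisymNS.LevelBound R a T (fun z => -AxisymNS.swirl f z)
      (fun z => -AxisymNS.swirl₀ v₀ z) k :=
    ⟨by positivity, hu₀'.mono fun z hz => (neg_le_abs _).trans (hz.trans (by linarith)),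
      hg'.mono fun z hz => by rw [abs_neg]; exact hz.trans (by linarith)⟩
  have hle : ∀ᵐ z ∂(AxisymNS.muT R a T), ‖AxisymNS.swirl v z‖ ≤ Λ * k := by
    -- The upper bound is applied to `u` and, through the reflected system, to `-u`.
    filter_upwards [hu, hbound _ _ _ _ _ E hB, hbound _ _ _ _ _ E.neg hB'] with z h1 h2 h3
    rw [h1]
    exact abs_le.2 ⟨by linarith, h2⟩
  refine ⟨MemLp.of_bound S.memLp_u.1 _ hle, ?_⟩
  have h1 := eLpNorm_le_of_ae_bound (p := ⊤) hle
  simp only [ENNReal.toReal_top, inv_zero, ENNReal.rpow_zero, one_mul] at h1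
  exact ENNReal.toNNReal_mono ENNReal.ofReal_ne_top h1
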